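/- **Setting.** A characteristic triplet is $(\gamma,b,\nu)$ with $\gamma\in\mathbb R$, $b\ge 0$ and $\nu$ a Lévy measure on $\mathbb R$ ($\nu(\{0\})=0$, $\int(1\wedge x^2)\,\nu(\mathrm dx)<\infty$); its exponent is $$\psi(z)=i\gamma z-\tfrac12 b^2z^2+\int_{\mathbb R}\big(e^{izx}-1-izx\mathbf 1_{\{|x|\le1\}}\big)\nu(\mathrm dx).$$ Let $L$ be a homogeneous Lévy basis on $\mathbb R^2$ with triplet $(\gamma,b,\nu)$, i.e. a family of random variables $L(A)$, $A$ Borel with $\mathrm{Leb}(A)<\infty$, which is almost surely $\sigma$-additive, independently scattered ($L(A_1),L(A_2),\dots$ are independent for disjoint $A_1,A_2,\dots$), and satisfies $\mathbb E e^{izL(A)}=e^{\mathrm{Leb}(A)\psi(z)}$. Its Lévy seed $L'$ is a random variable with $\mathbb E e^{izL'}=e^{\psi(z)}$. The Blumenthal–Getoor index is $\beta_\nu=\inf\{\beta>0:\int_{|x|\le1}|x|^\beta\nu(\mathrm dx)<\infty\}$, and $\nu^+(x)=\nu(x,\infty)$, $\nu^-(x)=\nu(-\infty,-x)$ for $x>0$.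 For a trawl function $a$ on $[0,\infty)$ put $A=\{(r,y):r\le0,\ 0\le y\le a(-r)\}$, $X_t=L(A+(t,0))$, and $$S^{\Delta}_m=\sum_{k=0}^{m-1}\big(X_{k\Delta}-\mathbb E X_{k\Delta}\big),\qquad \mathbf S^n_t=S^{\Delta_n}_{\lfloor nt\rfloor},\quad t\ge0.$$ **Strictly stable laws.** Let $0<\beta<2$, $\beta\ne1$, $K_\pm\ge0$, $K_++K_->0$. The strictly $\beta$-stable law with parameters $(\beta,K_+,K_-,\tilde\gamma)$ has triplet $(\tilde\gamma,0,\nu_\beta)$ with $\nu_\beta(\mathrm dx)=(K_+\mathbf 1_{\{x>0\}}+K_-\mathbf 1_{\{x<0\}})|x|^{-1-\beta}\mathrm dx$ and $\tilde\gamma=(K_+-K_-)/(1-\beta)$. Its exponent is $$\psi(z;\beta,K_+,K_-,\tilde\gamma)=-\sigma|z|^\beta\big(1-i\rho\,\mathrm{sign}(z)\tan(\pi\beta/2)\big),$$ $$\sigma=\frac{\Gamma(2-\beta)}{\beta(1-\beta)}\cos(\pi\beta/2)(K_++K_-),\qquad \rho=\frac{K_+-K_-}{K_++K_-}.$$ **Theorem.**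 Suppose that $2<\kappa<3$, $c_a>0$ and $a(s)=\int_s^\infty a'(y)\,\mathrm dy$ for all $s\ge0$, where $a'$ is a strictly positive continuous integrable function on $[0,\infty)$, regularly varying at $\infty$ (that is, $a'(tx)/a'(t)\to x^{-\kappa}$ as $t\to\infty$ for every $x>0$), with $a'(y)\sim c_ay^{-\kappa}$ as $y\to\infty$. Suppose that $b=0$ and $\mathbb E|L'|^2<\infty$, and that $\Delta_n>0$, $\Delta_n\to0$ and $n\Delta_n\to\infty$. (i) If $\nu\neq0$ and $\beta_\nu<\kappa-1$, then $\int|x|^{\kappa-1}\nu(\mathrm dx)<\infty$ and $$\frac{\Delta_n}{(c_an\Delta_n)^{1/(\kappa-1)}}\,\mathbf S^n\longrightarrow Y$$ in the sense of finite-dimensional distributions on $[0,\infty)$, where $Y$ is a Lévy process (null at zero almost surely, with independent stationary increments, continuous in probability) such that $Y_1$ is strictly $(\kappa-1)$-stable with exponent $\psi(z;\kappa-1,K_{+,\kappa},K_{-,\kappa},\tilde\gamma)$, $K_{+,\kappa}=\int_0^\infty x^{\kappa-1}\nu(\mathrm dx)$, $K_{-,\kappa}=\int_{-\infty}^0|x|^{\kappa-1}\nu(\mathrm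 dx)$. (ii) If $\kappa-1<\beta_\nu<2$ and $x^{\beta_\nu}\nu^\pm(x)\to\tilde K_\pm$ as $x\downarrow0$ for some $\tilde K_\pm$ with $\tilde K_++\tilde K_->0$, then $$\frac{1}{n\,(a(n\Delta_n)\,n\Delta_n)^{1/\beta_\nu}}\,\mathbf S^n_1\longrightarrow\xi$$ in distribution, where $\xi$ is strictly $\beta_\nu$-stable with exponent $\psi(z;\beta_\nu,\varrho_a\beta_\nu\tilde K_+,\varrho_a\beta_\nu\tilde K_-,\tilde\gamma)$ and $$\varrho_a=\frac1{\kappa-2}+(\kappa-1)\int_0^1(1-s)s^{\beta_\nu-\kappa}\,\mathrm ds+2\int_0^1s^{\beta_\nu-\kappa+1}\,\mathrm ds.$$ -/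

import Mathlib

open MeasureTheory ProbabilityTheory Filter Topology Set
open scoped NNReal ENNReal

noncomputable section

/-! ### Infinitely divisible laws -/

/-- A characteristic triplet `(γ, b, ν)`: `γ ∈ ℝ`, `b ≥ 0` and `ν` a Lévy measure on `ℝ`. -/
structure LevyTriplet where
  γ : ℝ
  b : ℝ
  b_nonneg : 0 ≤ b
  ν : Measure ℝ
  ν_zero : ν {0} = 0
  ν_finite : ∫⁻ x, ENNReal.ofReal (min 1 (x ^ 2)) ∂ν < ∞

/-- The characteristic exponent
`ψ(z) = iγz - b²z²/2 + ∫ (e^{izx} - 1 - izx 1_{|x| ≤ 1}) ν(dx)`. -/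
def LevyTriplet.exponent (T : LevyTriplet) (z : ℝ) : ℂ :=
  Complex.I * T.γ * z - (T.b : ℂ) ^ 2 * (z : ℂ) ^ 2 / 2
    + ∫ x : ℝ, (Complex.exp (Complex.I * z * x) - 1
        - (if |x| ≤ 1 then Complex.I * z * x else 0)) ∂T.ν

/-- `μ` is the infinitely divisible law with characteristic triplet `T`. -/
def HasLevyTriplet (μ : Measure ℝ) (T : LevyTriplet) : Prop :=
  IsProbabilityMeasure μ ∧ ∀ z : ℝ, charFun μ z = Complex.exp (T.exponent z)

/-- The Lévy seed, a random variable whose law has triplet `T`, has a finite second moment. -/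
def LevyTriplet.SquareIntegrableSeed (T : LevyTriplet) : Prop :=
  ∃ μ : Measure ℝ, HasLevyTriplet μ T ∧ MemLp (fun x : ℝ => x) 2 μ

/-- The Blumenthal-Getoor index `inf {β > 0 : ∫_{|x| ≤ 1} |x|^β ν(dx) < ∞}`. -/
def blumenthalGetoor (ν : Measure ℝ) : ℝ :=
  sInf {β : ℝ | 0 < β ∧ ∫⁻ x in {x : ℝ | |x| ≤ 1}, ENNReal.ofReal (|x| ^ β) ∂ν < ∞}

/-! ### Strictly stable laws -/

/-- The measure with Lebesgue density
`K₊ |x|^{-1-β} 1_{x > 0} + K₋ |x|^{-1-β} 1_{x < 0}`. -/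
def stableLevyMeasure (β Kp Km : ℝ) : Measure ℝ :=
  volume.withDensity fun x : ℝ => ENNReal.ofReal
    (if 0 < x then Kp * |x| ^ (-1 - β) else if x < 0 then Km * |x| ^ (-1 - β) else 0)

/-- `μ` is the strictly `β`-stable law with parameters `(β, K₊, K₋, γ)`. For `β ≠ 1` strictness
determines `γ`. -/
def IsStrictlyStableLaw (β Kp Km γ : ℝ) (μ : Measure ℝ) : Prop :=
  0 < β ∧ β < 2 ∧ 0 ≤ Kp ∧ 0 ≤ Km ∧ 0 < Kp + Km ∧
    (β ≠ 1 → γ = (Kp - Km) / (1 - β)) ∧ (β = 1 → Kp = Km) ∧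
    ∃ T : LevyTriplet, T.γ = γ ∧ T.b = 0 ∧ T.ν = stableLevyMeasure β Kp Km ∧ HasLevyTriplet μ T

/-- The explicit exponent `ψ(z; β, K₊, K₋, γ)` of a strictly stable law. -/
def stableExponent (β Kp Km γ z : ℝ) : ℂ :=
  if β = 1 then -((Kp * Real.pi * |z| : ℝ) : ℂ) + Complex.I * γ * z
  else
    -(((Real.Gamma (2 - β) / (β * (1 - β)) * Real.cos (Real.pi * β / 2) * (Kp + Km))
        * |z| ^ β : ℝ) : ℂ)
      * (1 - Complex.I *
          (((Kp - Km) / (Kp + Km) * Real.sign z * Real.tan (Real.pi * β / 2) : ℝ) : ℂ))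

/-! ### Lévy processes and convergence of finite-dimensional distributions -/

/-- A real Lévy process: null at zero, with independent and stationary increments, and
stochastically continuous. -/
structure IsLevyProcess {Ω : Type*} [MeasurableSpace Ω] (P : Measure Ω)
    (Y : ℝ≥0 → Ω → ℝ) : Prop where
  measurable : ∀ t, Measurable (Y t)
  zero : ∀ᵐ ω ∂P, Y 0 ω = 0
  indepIncrements : HasIndepIncrements Y P
  stationaryIncrements : ∀ s t, IdentDistrib (fun ω => Y (s + t) ω - Y s ω) (Y t) P P
  stochContinuous : ∀ t, TendstoInMeasure P Y (𝓝 t) (Y t)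

/-- Convergence of the finite-dimensional distributions of the processes `Z n` to those
of `Y`. -/
def TendstoFDD {Ω Ω' : Type*} [MeasurableSpace Ω] [MeasurableSpace Ω']
    (Z : ℕ → ℝ≥0 → Ω → ℝ) (P : Measure Ω) [IsProbabilityMeasure P]
    (Y : ℝ≥0 → Ω' → ℝ) (P' : Measure Ω') [IsProbabilityMeasure P'] : Prop :=
  ∀ (k : ℕ) (t : Fin k → ℝ≥0),
    TendstoInDistribution (fun (n : ℕ) (ω : Ω) (j : Fin k) => Z n (t j) ω) atTop
      (fun (ω : Ω') (j : Fin k) => Y (t j) ω) (fun _ => P) P'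

/-! ### Lévy bases and trawl processes -/

/-- `L` is a homogeneous Lévy basis on `ℝ²` with characteristic triplet `T`: an almost surely
`σ`-additive, independently scattered family indexed by the Borel sets of finite Lebesgue measure,
`L A` being infinitely divisible with cumulant `Leb(A) ψ`. The almost sure convergence of
`∑ L (A i)` is that of the partial sums; it need not be absolute. -/
structure IsHomogeneousLevyBasis {Ω : Type*} [MeasurableSpace Ω] (P : Measure Ω)
    (L : Set (ℝ × ℝ) → Ω → ℝ) (T : LevyTriplet) : Prop where
  measurable : ∀ A, MeasurableSet A → volume A < ∞ → Measurable (L A)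
  indep : ∀ A : ℕ → Set (ℝ × ℝ), (∀ i, MeasurableSet (A i)) → (∀ i, volume (A i) < ∞) →
    Pairwise (fun i j => Disjoint (A i) (A j)) → iIndepFun (fun i => L (A i)) P
  sigmaAdditive : ∀ A : ℕ → Set (ℝ × ℝ), (∀ i, MeasurableSet (A i)) →
    volume (⋃ i, A i) < ∞ → Pairwise (fun i j => Disjoint (A i) (A j)) →
    ∀ᵐ ω ∂P, Tendsto (fun N : ℕ => ∑ i ∈ Finset.range N, L (A i) ω) atTop
      (𝓝 (L (⋃ i, A i) ω))
  charFun_eq : ∀ A, MeasurableSet A → volume A < ∞ → ∀ z : ℝ,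
    charFun (P.map (L A)) z = Complex.exp (((volume A).toReal : ℂ) * T.exponent z)

/-- The trawl set `A = {(r, y) : r ≤ 0, 0 ≤ y ≤ a(-r)}`. -/
def trawlSet (a : ℝ → ℝ) : Set (ℝ × ℝ) :=
  {p | p.1 ≤ 0 ∧ 0 ≤ p.2 ∧ p.2 ≤ a (-p.1)}

/-- The trawl process `X_t = L(A_t)`, where `A_t = A + (t, 0)`. -/
def trawlProcess {Ω : Type*} (L : Set (ℝ × ℝ) → Ω → ℝ) (a : ℝ → ℝ) (t : ℝ) : Ω → ℝ :=
  L ((fun p : ℝ × ℝ => p + (t, 0)) '' trawlSet a)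

/-- The centred partial sums `S_m^Δ = ∑_{k < m} (X_{kΔ} - E X_{kΔ})`. -/
def trawlSum {Ω : Type*} [MeasurableSpace Ω] (P : Measure Ω) (L : Set (ℝ × ℝ) → Ω → ℝ)
    (a : ℝ → ℝ) (δ : ℝ) (m : ℕ) (ω : Ω) : ℝ :=
  ∑ k ∈ Finset.range m,
    (trawlProcess L a (δ * k) ω - ∫ ω', trawlProcess L a (δ * k) ω' ∂P)

/-- The process `𝐒^n_t = S_{[nt]}^{Δ_n}`, `t ≥ 0`. -/
def trawlSumProcess {Ω : Type*} [MeasurableSpace Ω] (P : Measure Ω) (L : Set (ℝ × ℝ) → Ω → ℝ)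
    (a : ℝ → ℝ) (Δ : ℕ → ℝ) (n : ℕ) (t : ℝ≥0) : Ω → ℝ :=
  trawlSum P L a (Δ n) ⌊(n : ℝ≥0) * t⌋₊

/-! ### Long memory -/

/-- `g` is regularly varying at infinity, `g(tx)/g(t) → x^{-α}` for every `x > 0`. -/
def RegularlyVaryingAtTop (g : ℝ → ℝ) (α : ℝ) : Prop :=
  ∀ x : ℝ, 0 < x → Tendsto (fun t => g (t * x) / g t) atTop (𝓝 (x ^ (-α)))

/-- Long memory: `a(s) = ∫_s^∞ a'(y) dy` for `s ≥ 0`, with `a'` (here `aprime`) strictly positive,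
continuous and regularly varying of index `κ ∈ (2, 3)`. Such an `a` is automatically positive,
continuous, decreasing and integrable on `[0, ∞)`. -/
structure LongMemory (a aprime : ℝ → ℝ) (κ : ℝ) : Prop where
  two_lt : 2 < κ
  lt_three : κ < 3
  pos : ∀ y, 0 ≤ y → 0 < aprime y
  cont : ContinuousOn aprime (Ici 0)
  regVar : RegularlyVaryingAtTop aprime κ
  integrable : IntegrableOn aprime (Ioi 0)
  eq_integral : ∀ s, 0 ≤ s → a s = ∫ y in Ioi s, aprime y

/-- Long memory with `a'(y) ~ c_a y^{-κ}` as `y → ∞`, `c_a > 0`. -/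
structure PowerLongMemory (a aprime : ℝ → ℝ) (κ ca : ℝ) : Prop extends
    LongMemory a aprime κ where
  ca_pos : 0 < ca
  equiv : Asymptotics.IsEquivalent atTop aprime (fun y : ℝ => ca * y ^ (-κ))

/-- `ϱ_a = 1/(κ-2) + (κ-1) ∫_0^1 (1-s) s^{β-κ} ds + 2 ∫_0^1 s^{β-κ+1} ds`. -/
def rhoConst (κ β : ℝ) : ℝ :=
  1 / (κ - 2) + (κ - 1) * (∫ s in (0 : ℝ)..1, (1 - s) * s ^ (β - κ))
    + 2 * ∫ s in (0 : ℝ)..1, s ^ (β - κ + 1)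

end

/-! Everything is read off characteristic exponents. Since b = 0 and the seed is square integrable,
∫ x² dν is finite (`LevyTriplet.SquareIntegrableSeed.integrable_sq`). Centring therefore leaves the
driftless exponent ψ(z) = ∫ (e^{izx} - 1 - izx) ν(dx), and a combination of centred values L(A_k)
with weights θ_k has log-characteristic function ∫ ψ(∑ θ_k 1_{A_k})
(`IsHomogeneousLevyBasis.charFun_centered`). As a is strictly decreasing, the horizontal section of
A + (t, 0) at height a(u) is the interval [t - u, t]. The substitution y = a(u) then turns the
exponent of the partial sums into ∫_0^∞ a'(u) J_n(u) du, where J_n(u) = ∫ ψ(w ∑_j z_j N_j(r, u)) dr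
and N_j(r, u) counts the lattice times kΔ_n, k < M_j, in [r, r + u]
(`PowerLongMemory.charFun_trawlSum`).

Because a'(u) ~ c_a u^{-κ}, the substitution u = B_n v gives the limit ∫ c_a v^{-κ} g(v) dv as soon
as B_n^{1-κ} J_n(B_n v) → g(v) with domination and the range u ≤ 1 is negligible
(`PowerLongMemory.tendsto_integral_scaled`). The two parts of the theorem are two choices of B_n.
Put T_n = nΔ_n and r = T_n s.

Part (i): B_n = (c_a T_n)^{1/(κ-1)}. Since 1/2 < 1/(κ-1) < 1, B_n ≪ T_n ≪ B_n². A section of length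
B_n v is long compared with the mesh and short compared with the horizon, so Δ_n N_j / B_n → v 1_{0
< s < t_j}. The limit exponent is ∫∫ v^{-κ} ψ(v Θ(s)) dv ds with Θ(s) = ∑ z_j 1_{0 < s < t_j}. By
homogeneity the v-integral turns a jump x of ν into |x|^{κ-1} times a one-sided stable exponent,
whence the moments K_±; the s-integral that remains is the joint exponent of a Lévy process.
Domination comes from |ψ(y)| ≤ C min(|y|^p, y²) for some p strictly between the Blumenthal-Getoor
index and κ - 1.

Part (ii): B_n = T_n. Now N/n tends to the length of [s, s + v] ∩ [0, 1], and the argument of ψ is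
of order (a(T_n) T_n)^{-1/β}, β = β_ν, which tends to infinity. Only ψ at infinity matters, and
there the tails of ν at 0 make ψ asymptotically stable (`compExponent_asymptotics`). Integrating the
β-th power of the overlap against (κ - 1) v^{-κ} gives the constant ϱ_a (`rhoConst_eq`).

The limit objects are constructed, not assumed: Lévy's continuity theorem gives the
finite-dimensional laws, Kolmogorov's theorem the process. The closed form of the stable exponent
comes from the Gamma integral, continued analytically to the right half-plane and then taken to its
boundary. -/

/-! ### Kolmogorov's extension theorem and Lévy's continuity theorem -/

/-- A consistent family of finite-dimensional real laws is continuous at the empty set. -/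
theorem projectiveFamilyContent_tendsto_zero {ι : Type*} {P : ∀ J : Finset ι, Measure (J → ℝ)}
    [∀ J, IsProbabilityMeasure (P J)] (hP : IsProjectiveMeasureFamily (α := fun _ => ℝ) P)
    {B : ℕ → Set (ι → ℝ)} (hB : ∀ n, B n ∈ measurableCylinders fun _ : ι => ℝ)
    (hBa : Antitone B) (hBi : ⋂ n, B n = ∅) :
    Tendsto (fun n => projectiveFamilyContent hP (B n)) atTop (𝓝 0) := by
  have hmono : Antitone fun n => projectiveFamilyContent hP (B n) := fun m n h =>
    projectiveFamilyContent_mono hP (hB n) (hB m) (hBa h)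
  have hlim := tendsto_atTop_iInf hmono
  set ε := ⨅ n, projectiveFamilyContent hP (B n) with hε
  rcases eq_or_ne ε 0 with h0 | h0
  · rwa [h0] at hlim
  exfalso
  -- Each B n will be approximated from inside by a compact cylinder with loss at most η n. The
  -- total loss stays below ε, so no finite intersection of these cylinders can be empty.
  obtain ⟨η, hη, hηsum⟩ := ENNReal.exists_pos_sum_of_countable' h0 ℕ
  have hch : ∀ n, ∃ (s : Finset ι) (K : Set (s → ℝ)), IsCompact K ∧ IsClosed K ∧
      cylinder s K ⊆ B n ∧ projectiveFamilyContent hP (B n \ cylinder s K) ≤ η n := by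
    intro n
    obtain ⟨s, S, hS, hBS⟩ := (mem_measurableCylinders _).1 (hB n)
    obtain ⟨K, hKS, ⟨hKc, hKcl⟩, hK⟩ :=
      (innerRegular_isCompact_isClosed_measurableSet_of_finite (P s)).exists_subset_lt_add
        (by simp) hS (measure_ne_top _ _) (hη n).ne'
    refine ⟨s, K, hKc, hKcl, ?_, ?_⟩
    · rw [hBS]; exact fun x hx => hKS hx
    · have : B n \ cylinder s K = cylinder s (S \ K) := by rw [hBS, sdiff_cylinder_same]
      rw [this, projectiveFamilyContent_cylinder hP (hS.diff hKcl.measurableSet),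
        measure_sdiff hKS hKcl.measurableSet.nullMeasurableSet (measure_ne_top _ _)]
      exact tsub_le_iff_left.2 hK.le
  choose s K hKc hKcl hKB hKη using hch
  have hCm : ∀ n, cylinder (s n) (K n) ∈ measurableCylinders fun _ : ι => ℝ := fun n =>
    cylinder_mem_measurableCylinders _ _ (hKcl n).measurableSet
  have hne : ∀ n, (⋂ m ∈ Finset.range (n + 1),
      cylinder (α := fun _ : ι => ℝ) (s m) (K m)).Nonempty := by
    intro n
    by_contra hemp
    rw [Set.not_nonempty_iff_eq_empty] at hemp
    have hsub : B n ⊆ ⋃ m ∈ Finset.range (n + 1),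
        B m \ cylinder (α := fun _ : ι => ℝ) (s m) (K m) := by
      intro x hx
      by_contra hx'
      have : x ∈ ⋂ m ∈ Finset.range (n + 1),
          cylinder (α := fun _ : ι => ℝ) (s m) (K m) := by
        simp only [mem_iInter]
        intro m hm
        by_contra hxm
        refine hx' (mem_biUnion hm ⟨hBa (by simpa [Nat.lt_succ_iff] using hm) hx, hxm⟩)
      rw [hemp] at this; exact this
    have hle : projectiveFamilyContent hP (B n) ≤ ∑ m ∈ Finset.range (n + 1), η m := by
      have hdm : ∀ m ∈ Finset.range (n + 1), B m \ cylinder (α := fun _ : ι => ℝ) (s m) (K m) ∈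
          measurableCylinders fun _ : ι => ℝ := fun m _ => sdiff_mem_measurableCylinders (hB m) (hCm m)
      exact (projectiveFamilyContent_mono hP (hB n)
        (isSetRing_measurableCylinders.biUnion_mem _ hdm) hsub).trans
        ((addContent_biUnion_le isSetRing_measurableCylinders hdm).trans
          (Finset.sum_le_sum fun m _ => hKη m))
    exact absurd (((iInf_le _ n).trans hle).trans (ENNReal.sum_le_tsum _)) (not_le.2 hηsum)
  choose x hx using hne
  have hxm : ∀ m n, m ≤ n → (s m).restrict (x n) ∈ K m := fun m n hmn => by
    have := mem_iInter₂.1 (hx n) m (by simpa [Nat.lt_succ_iff] using hmn)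
    exact this
  -- An ultrafilter replaces the diagonal extraction: for each m the restrictions of x n to s m
  -- eventually lie in the compact K m, hence converge. Coordinates lying in no s m receive an
  -- arbitrary value, which no cylinder sees.
  let F : Ultrafilter ℕ := Ultrafilter.of atTop
  have hF : (F : Filter ℕ) ≤ atTop := Ultrafilter.of_le _
  have hlimm : ∀ m, ∃ y ∈ K m, Tendsto (fun n => (s m).restrict (x n)) F (𝓝 y) := by
    intro m
    obtain ⟨y, hy, hle⟩ := (hKc m).ultrafilter_le_nhds (F.map fun n => (s m).restrict (x n)) (by
      rw [Ultrafilter.coe_map, le_principal_iff]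
      exact hF ((eventually_ge_atTop m).mono fun n hn => hxm m n hn))
    exact ⟨y, hy, hle⟩
  choose y hyK hy using hlimm
  have : (fun i => limUnder (F : Filter ℕ) fun n => x n i) ∈ ⋂ n, B n := by
    refine mem_iInter.2 fun m => hKB m ?_
    have : (s m).restrict (fun i => limUnder (F : Filter ℕ) fun n => x n i) = y m := by
      ext i
      exact ((tendsto_pi_nhds.1 (hy m)) i).limUnder_eq
    rw [mem_cylinder, this]; exact hyK m
  rw [hBi] at this; exact this

/-- **Kolmogorov's extension theorem** for real-valued families. -/
theorem exists_isProjectiveLimit {ι : Type*} (P : ∀ J : Finset ι, Measure (J → ℝ))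
    [∀ J, IsProbabilityMeasure (P J)] (hP : IsProjectiveMeasureFamily (α := fun _ => ℝ) P) :
    ∃ μ : Measure (ι → ℝ), IsProjectiveLimit (α := fun _ => ℝ) μ P := by
  have hsub : (projectiveFamilyContent hP).IsSigmaSubadditive :=
    isSigmaSubadditive_of_addContent_iUnion_eq_tsum isSetRing_measurableCylinders
      fun f hf hU hd => addContent_iUnion_eq_sum_of_tendsto_zero isSetRing_measurableCylinders
        (projectiveFamilyContent hP) (fun s _ => projectiveFamilyContent_ne_top hP)
        (fun _ hs ha hi => projectiveFamilyContent_tendsto_zero hP hs ha hi) hf hU hd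
  refine ⟨(projectiveFamilyContent hP).measure isSetSemiring_measurableCylinders
    generateFrom_measurableCylinders.ge hsub, fun I => ?_⟩
  ext S hS
  rw [Measure.map_apply (Finset.measurable_restrict I) hS, ← cylinder, AddContent.measure_eq,
    projectiveFamilyContent_cylinder hP hS]
  · exact generateFrom_measurableCylinders.symm
  · exact cylinder_mem_measurableCylinders _ _ hS

/-- A pointwise limit of characteristic functions which is continuous at `0` is a characteristic
function. -/
theorem exists_charFun_eq_of_tendsto {E : Type*} [NormedAddCommGroup E] [InnerProductSpace ℝ E]
    [FiniteDimensional ℝ E] [MeasurableSpace E] [BorelSpace E] (μ : ℕ → ProbabilityMeasure E)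
    {f : E → ℂ} (hf : ContinuousAt f 0)
    (h : ∀ t, Tendsto (fun n => charFun (μ n : Measure E) t) atTop (𝓝 (f t))) :
    ∃ μ₀ : ProbabilityMeasure E, (∀ t, charFun (μ₀ : Measure E) t = f t) ∧
      Tendsto μ atTop (𝓝 μ₀) := by
  have ht : IsTightMeasureSet (range fun n => (μ n : Measure E)) :=
    isTightMeasureSet_of_tendsto_charFun hf h
  have hc : IsCompact (closure (range μ)) := isCompact_closure_of_isTightMeasureSet (by
    convert ht using 1
    ext ν; simp)
  -- A cluster point of the tight sequence has characteristic function f. That identifies it, and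
  -- Lévy's theorem then gives convergence of the whole sequence.
  let F : Ultrafilter ℕ := Ultrafilter.of atTop
  have hF : (F : Filter ℕ) ≤ atTop := Ultrafilter.of_le _
  obtain ⟨μ₀, -, hle⟩ := hc.ultrafilter_le_nhds (F.map μ) (by
    rw [Ultrafilter.coe_map, le_principal_iff]
    exact Filter.mem_map.2 (Eventually.of_forall fun n => subset_closure (mem_range_self n)))
  have hμ₀ : ∀ t, charFun (μ₀ : Measure E) t = f t := by
    intro t
    have hle' : Tendsto μ F (𝓝 μ₀) := hle
    rw [ProbabilityMeasure.tendsto_iff_forall_integral_rclike_tendsto ℂ] at hle'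
    have h1 := hle' (BoundedContinuousFunction.innerProbChar t)
    simp_rw [← charFun_eq_integral_innerProbChar] at h1
    exact tendsto_nhds_unique h1 ((h t).mono_left hF)
  exact ⟨μ₀, hμ₀, ProbabilityMeasure.tendsto_of_tendsto_charFun fun t => by
    rw [hμ₀]; exact h t⟩


/-! ### Joint characteristic functions on `ι → ℝ` -/

section JointCharFun

variable {ι : Type*} [Fintype ι]

/-- `charFun` needs an inner product, whereas projective limits live on plain products; this is the
bridge between `EuclideanSpace` and `ι → ℝ`. -/
theorem charFun_map_toLp_eq (ν : Measure (ι → ℝ)) (z : EuclideanSpace ℝ ι) :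
    charFun (ν.map (WithLp.toLp 2)) z
      = ∫ x, Complex.exp (Complex.I * ((∑ j, z j * x j : ℝ) : ℂ)) ∂ν := by
  rw [charFun_apply, ← MeasurableEquiv.coe_toLp, integral_map_equiv]
  refine integral_congr_ae (ae_of_all _ fun x => ?_)
  simp only [MeasurableEquiv.coe_toLp, PiLp.inner_apply, RCLike.inner_apply, conj_trivial]
  rw [mul_comm]

theorem aestronglyMeasurable_jointExp (z : ι → ℝ) (ν : Measure (ι → ℝ)) :
    AEStronglyMeasurable (fun x : ι → ℝ => Complex.exp (Complex.I * ((∑ j, z j * x j : ℝ) : ℂ))) ν :=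
  Measurable.aestronglyMeasurable (by fun_prop)

/-- Finite measures on `ι → ℝ` are determined by their joint characteristic functions. -/
theorem ext_of_jointCharFun {ν ν' : Measure (ι → ℝ)} [IsFiniteMeasure ν] [IsFiniteMeasure ν']
    (h : ∀ z : ι → ℝ, ∫ x, Complex.exp (Complex.I * ((∑ j, z j * x j : ℝ) : ℂ)) ∂ν
      = ∫ x, Complex.exp (Complex.I * ((∑ j, z j * x j : ℝ) : ℂ)) ∂ν') : ν = ν' := by
  refine (MeasurableEquiv.toLp 2 (ι → ℝ)).map_measurableEquiv_injective ?_
  refine Measure.ext_of_charFun (funext fun z => ?_)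
  rw [MeasurableEquiv.coe_toLp, charFun_map_toLp_eq, charFun_map_toLp_eq, h]

/-- A pointwise limit of joint characteristic functions which is continuous at `0` is a joint
characteristic function. -/
theorem exists_jointCharFun_eq_of_tendsto (ν : ℕ → Measure (ι → ℝ))
    [∀ n, IsProbabilityMeasure (ν n)] {f : (ι → ℝ) → ℂ} (hf : ContinuousAt f 0)
    (h : ∀ z : ι → ℝ, Tendsto (fun n => ∫ x, Complex.exp
      (Complex.I * ((∑ j, z j * x j : ℝ) : ℂ)) ∂(ν n)) atTop (𝓝 (f z))) :
    ∃ μ : Measure (ι → ℝ), IsProbabilityMeasure μ ∧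
      ∀ z : ι → ℝ, ∫ x, Complex.exp (Complex.I * ((∑ j, z j * x j : ℝ) : ℂ)) ∂μ = f z := by
  have hpr : ∀ n, IsProbabilityMeasure ((ν n).map (WithLp.toLp 2 : (ι → ℝ) → EuclideanSpace ℝ ι)) :=
    fun n => Measure.isProbabilityMeasure_map (by fun_prop)
  obtain ⟨μ, hμ, -⟩ := exists_charFun_eq_of_tendsto (E := EuclideanSpace ℝ ι)
    (fun n => ⟨(ν n).map (WithLp.toLp 2), hpr n⟩) (f := fun z => f z.ofLp)
    (by
      refine ContinuousAt.comp (f := fun z : EuclideanSpace ℝ ι => z.ofLp) ?_ (by fun_prop)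
      simpa using hf)
    (fun z => by
      simp only [ProbabilityMeasure.coe_mk, charFun_map_toLp_eq]
      exact h z.ofLp)
  refine ⟨(μ : Measure (EuclideanSpace ℝ ι)).map WithLp.ofLp,
    Measure.isProbabilityMeasure_map (by fun_prop), fun z => ?_⟩
  rw [← charFun_map_toLp_eq _ (WithLp.toLp 2 z), Measure.map_map (by fun_prop) (by fun_prop)]
  have : (WithLp.toLp 2 ∘ WithLp.ofLp : EuclideanSpace ℝ ι → EuclideanSpace ℝ ι) = id := by
    ext; rfl
  rw [this, Measure.map_id, hμ]

/-- Convergence of the joint characteristic functions implies convergence in distribution. -/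
theorem tendstoInDistribution_of_jointCharFun {Ω Ω' : Type*} [MeasurableSpace Ω]
    [MeasurableSpace Ω'] {P : Measure Ω} [IsProbabilityMeasure P] {P' : Measure Ω'}
    [IsProbabilityMeasure P'] {X : ℕ → Ω → ι → ℝ} {Y : Ω' → ι → ℝ} (hX : ∀ n, Measurable (X n))
    (hY : Measurable Y)
    (h : ∀ z : ι → ℝ, Tendsto
      (fun n => ∫ ω, Complex.exp (Complex.I * ((∑ j, z j * X n ω j : ℝ) : ℂ)) ∂P) atTop
      (𝓝 (∫ ω, Complex.exp (Complex.I * ((∑ j, z j * Y ω j : ℝ) : ℂ)) ∂P'))) :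
    TendstoInDistribution X atTop Y (fun _ => P) P' := by
  have key : TendstoInDistribution (fun n ω => (WithLp.toLp 2 (X n ω) : EuclideanSpace ℝ ι)) atTop
      (fun ω => WithLp.toLp 2 (Y ω)) (fun _ => P) P' := by
    refine ⟨fun n => by fun_prop, by fun_prop, ?_⟩
    refine ProbabilityMeasure.tendsto_of_tendsto_charFun fun z => ?_
    have e1 : ∀ n, charFun (P.map fun ω => (WithLp.toLp 2 (X n ω) : EuclideanSpace ℝ ι)) z
        = ∫ ω, Complex.exp (Complex.I * ((∑ j, z j * X n ω j : ℝ) : ℂ)) ∂P := fun n => by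
      rw [← Function.comp_def (WithLp.toLp 2) (X n), ← Measure.map_map (by fun_prop) (hX n),
        charFun_map_toLp_eq, integral_map (hX n).aemeasurable (aestronglyMeasurable_jointExp _ _)]
    have e2 : charFun (P'.map fun ω => (WithLp.toLp 2 (Y ω) : EuclideanSpace ℝ ι)) z
        = ∫ ω, Complex.exp (Complex.I * ((∑ j, z j * Y ω j : ℝ) : ℂ)) ∂P' := by
      rw [← Function.comp_def (WithLp.toLp 2) Y, ← Measure.map_map (by fun_prop) hY,
        charFun_map_toLp_eq, integral_map hY.aemeasurable (aestronglyMeasurable_jointExp _ _)]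
    simp only [ProbabilityMeasure.coe_mk, e1, e2]
    exact h z.ofLp
  exact key.continuous_comp (g := WithLp.ofLp) (by fun_prop)

end JointCharFun

/-! ### The joint exponent of a Lévy process -/

/-- The exponent `∫_0^∞ ψ(∑_j z_j 1_{s < t_j}) ds` of `∑_j z_j Y(t_j)` for a Lévy process `Y` with
exponent `ψ`. -/
noncomputable def levyJointExponent (ψ : ℝ → ℂ) {ι : Type*} [Fintype ι] (t : ι → ℝ≥0)
    (z : ι → ℝ) : ℂ :=
  ∫ s in Ioi (0 : ℝ), ψ (∑ j, if s < t j then z j else 0)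

section LevyJointExponent

variable {ι : Type*} [Fintype ι] {ψ : ℝ → ℂ}

theorem measurable_stepSum (t : ι → ℝ≥0) (z : ι → ℝ) :
    Measurable fun s : ℝ => ∑ j, if s < t j then z j else 0 :=
  Finset.measurable_sum _ fun _ _ =>
    Measurable.ite (measurableSet_lt measurable_id measurable_const) measurable_const
      measurable_const

/-- Dominated convergence: the integrand vanishes for s ≥ ∑ t_j, and for z near z₀ the argument of ψ
stays in a compact interval. Continuity at 0 is what Lévy's theorem requires. -/
theorem continuous_levyJointExponent (hψ : Continuous ψ) (h0 : ψ 0 = 0) (t : ι → ℝ≥0) :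
    Continuous (levyJointExponent ψ t) := by
  rw [continuous_iff_continuousAt]
  intro z₀
  set R : ℝ := ∑ j, (|z₀ j| + 1) with hR
  obtain ⟨C, hC⟩ := (isCompact_Icc (a := -R) (b := R)).exists_bound_of_continuousOn hψ.continuousOn
  set M : ℝ := ∑ j, (t j : ℝ) with hM
  have hle : ∀ j, (t j : ℝ) ≤ M := fun j =>
    Finset.single_le_sum (f := fun j => (t j : ℝ)) (fun i _ => (t i).2) (Finset.mem_univ j)
  refine continuousAt_of_dominated (bound := (Iio M).indicator fun _ => C) ?_ ?_ ?_ ?_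
  · exact Eventually.of_forall fun z =>
      (hψ.measurable.comp (measurable_stepSum t z)).aestronglyMeasurable
  · have : ∀ᶠ z : ι → ℝ in 𝓝 z₀, ∀ j, |z j| ≤ |z₀ j| + 1 := by
      refine eventually_all.2 fun j => ?_
      have : Tendsto (fun z : ι → ℝ => |z j|) (𝓝 z₀) (𝓝 |z₀ j|) :=
        ((continuous_apply j).abs).tendsto z₀
      exact (this.eventually (gt_mem_nhds (lt_add_one _))).mono fun z hz => hz.le
    filter_upwards [this] with z hz
    refine ae_of_all _ fun s => ?_
    by_cases hs : s < M
    · rw [indicator_of_mem (show s ∈ Iio M from hs)]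
      refine hC _ (abs_le.1 ((Finset.abs_sum_le_sum_abs _ _).trans (Finset.sum_le_sum fun j _ => ?_)))
      split_ifs
      · exact hz j
      · simpa using by positivity
    · rw [indicator_of_notMem (show s ∉ Iio M from hs)]
      have : ∀ j, ¬ s < t j := fun j h => hs (h.trans_le (hle j))
      simp [this, h0]
  · rw [integrable_indicator_iff measurableSet_Iio]
    refine (integrableOn_const ?_)
    rw [Measure.restrict_apply measurableSet_Iio, Iio_inter_Ioi]
    simp
  · refine ae_of_all _ fun s => Continuous.continuousAt ?_
    refine hψ.comp (continuous_finsetSum _ fun j _ => ?_)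
    split_ifs
    · exact continuous_apply j
    · exact continuous_const

theorem integral_Ioi_step {s t : ℝ≥0} (hst : s ≤ t) (z : ℝ) :
    ∫ x in Ioi (0 : ℝ), (Ico (s : ℝ) t).indicator (fun _ => ψ z) x = ((t : ℝ) - s : ℝ) * ψ z := by
  rw [← integral_Ici_eq_integral_Ioi, setIntegral_indicator measurableSet_Ico,
    inter_eq_right.2 (show Ico (s : ℝ) t ⊆ Ici 0 from fun x hx => s.2.trans hx.1)]
  simp [hst]

/-- The joint exponent of the increments over successive intervals is the sum of the exponents. -/
theorem levyJointExponent_increments (h0 : ψ 0 = 0) {n : ℕ} (t : Fin (n + 1) → ℝ≥0)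
    (ht : Monotone t) (z : Fin n → ℝ) :
    levyJointExponent ψ (Sum.elim (fun i : Fin n => t i.succ) fun i : Fin n => t i.castSucc)
      (Sum.elim z fun i => -z i)
      = ∑ i : Fin n, (((t i.succ : ℝ) - t i.castSucc : ℝ) : ℂ) * ψ (z i) := by
  have hle : ∀ i : Fin n, t i.castSucc ≤ t i.succ := fun i => ht i.castSucc_lt_succ.le
  have hpt : ∀ s : ℝ, ψ (∑ j, if s < (Sum.elim (fun i : Fin n => t i.succ)
        (fun i : Fin n => t i.castSucc) j : ℝ≥0) then (Sum.elim z fun i => -z i) j else 0)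
      = ∑ i : Fin n, (Ico (t i.castSucc : ℝ) (t i.succ)).indicator (fun _ => ψ (z i)) s := by
    intro s
    -- A right endpoint with weight z i and the left endpoint with weight -z i combine into z i
    -- times the indicator of the half-open interval between them.
    have e : (∑ j, if s < (Sum.elim (fun i : Fin n => t i.succ)
        (fun i : Fin n => t i.castSucc) j : ℝ≥0) then (Sum.elim z fun i => -z i) j else 0)
        = ∑ i : Fin n, (Ico (t i.castSucc : ℝ) (t i.succ)).indicator (fun _ => z i) s := by
      rw [Fintype.sum_sum_type, ← Finset.sum_add_distrib]
      refine Finset.sum_congr rfl fun i _ => ?_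
      have := hle i
      simp only [Sum.elim_inl, Sum.elim_inr, indicator, mem_Ico]
      by_cases h1 : s < t i.castSucc
      · have h2 : s < t i.succ := h1.trans_le (NNReal.coe_le_coe.2 this)
        simp [h1, h2, not_le.2 h1]
      · by_cases h2 : s < t i.succ <;> simp [h1, h2, not_lt.1 h1]
    rw [e]
    -- The intervals are disjoint by monotonicity, so at most one term is nonzero and ψ commutes
    -- with the sum.
    by_cases hex : ∃ i : Fin n, s ∈ Ico (t i.castSucc : ℝ) (t i.succ)
    · obtain ⟨i, hi⟩ := hex
      have hother : ∀ j, j ≠ i → s ∉ Ico (t j.castSucc : ℝ) (t j.succ) := by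
        intro j hj hsj
        rcases lt_or_gt_of_ne hj with h | h
        · have : t j.succ ≤ t i.castSucc := ht (Fin.succ_le_castSucc_iff.2 h)
          exact absurd (hsj.2.trans_le (NNReal.coe_le_coe.2 this)) (not_lt.2 hi.1)
        · have : t i.succ ≤ t j.castSucc := ht (Fin.succ_le_castSucc_iff.2 h)
          exact absurd (hi.2.trans_le (NNReal.coe_le_coe.2 this)) (not_lt.2 hsj.1)
      rw [Finset.sum_eq_single i (fun j _ hj => indicator_of_notMem (hother j hj) _) (by simp),
        Finset.sum_eq_single i (fun j _ hj => indicator_of_notMem (hother j hj) _) (by simp),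
        indicator_of_mem hi, indicator_of_mem hi]
    · push Not at hex
      rw [Finset.sum_eq_zero fun i _ => indicator_of_notMem (hex i) _, h0,
        Finset.sum_eq_zero fun i _ => indicator_of_notMem (hex i) _]
  unfold levyJointExponent
  simp_rw [hpt]
  rw [integral_finsetSum]
  · exact Finset.sum_congr rfl fun i _ => integral_Ioi_step (hle i) (z i)
  · intro i _
    rw [integrable_indicator_iff measurableSet_Ico]
    refine (integrableOn_const ?_)
    refine ((Measure.restrict_apply_le _ _).trans_lt ?_).ne
    simp

end LevyJointExponent


/-! ### Lévy processes from their joint characteristic functions -/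

section LevyProcess

variable {ψ : ℝ → ℂ}

/-- A family of real random variables whose joint characteristic functions are those of a Lévy
process with exponent `ψ` is a Lévy process. -/
theorem isLevyProcess_of_jointCharFun {Ω : Type*} [MeasurableSpace Ω] {P : Measure Ω}
    [IsProbabilityMeasure P] {Y : ℝ≥0 → Ω → ℝ} (hY : ∀ t, Measurable (Y t))
    (hψ : Continuous ψ) (h0 : ψ 0 = 0)
    (h : ∀ (ι : Type) [Fintype ι] (t : ι → ℝ≥0) (z : ι → ℝ),
      ∫ ω, Complex.exp (Complex.I * ((∑ j, z j * Y (t j) ω : ℝ) : ℂ)) ∂P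
        = Complex.exp (levyJointExponent ψ t z)) :
    IsLevyProcess P Y ∧ ∀ t z, charFun (P.map (Y t)) z = Complex.exp ((t : ℝ) * ψ z) := by
  -- Factorisation of the joint characteristic function of successive increments. Independence,
  -- stationarity and the marginal laws of increments are all consequences.
  have hmono : ∀ (n : ℕ) (t : Fin (n + 1) → ℝ≥0), Monotone t → ∀ z : Fin n → ℝ,
      ∫ ω, Complex.exp (Complex.I *
        ((∑ i : Fin n, z i * (Y (t i.succ) ω - Y (t i.castSucc) ω) : ℝ) : ℂ)) ∂P
      = ∏ i : Fin n, Complex.exp ((((t i.succ : ℝ) - t i.castSucc : ℝ) : ℂ) * ψ (z i)) := by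
    intro n t ht z
    rw [← Complex.exp_sum, ← levyJointExponent_increments h0 t ht z, ← h]
    refine integral_congr_ae (ae_of_all _ fun ω => ?_)
    simp only [Fintype.sum_sum_type, Sum.elim_inl, Sum.elim_inr, mul_sub, neg_mul,
      Finset.sum_sub_distrib, Finset.sum_neg_distrib, ← sub_eq_add_neg]
  have hsub : ∀ s t, Measurable fun ω => Y t ω - Y s ω := fun s t => (hY t).sub (hY s)
  have hincr : ∀ s t : ℝ≥0, s ≤ t → ∀ z, charFun (P.map fun ω => Y t ω - Y s ω) z
      = Complex.exp ((((t : ℝ) - s : ℝ) : ℂ) * ψ z) := by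
    intro s t hst z
    have := hmono 1 ![s, t] (by
      intro i j hij
      fin_cases i <;> fin_cases j <;> simp_all) (fun _ => z)
    simp only [Finset.univ_unique, Fin.default_eq_zero, Finset.sum_singleton,
      Finset.prod_singleton] at this
    rw [charFun_apply_real, integral_map (hsub s t).aemeasurable (by fun_prop)]
    refine Eq.trans (integral_congr_ae (ae_of_all _ fun ω => ?_)) this
    simp only [Fin.succ_zero_eq_one, Fin.castSucc_zero, Matrix.cons_val_zero, Matrix.cons_val_one]
    push_cast; ring_nf
  have hone : ∀ t z, charFun (P.map (Y t)) z = Complex.exp ((t : ℝ) * ψ z) := by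
    intro t z
    have h1 := h Unit (fun _ => t) (fun _ => z)
    rw [charFun_apply_real, integral_map (hY t).aemeasurable (by fun_prop)]
    have e : levyJointExponent ψ (fun _ : Unit => t) (fun _ => z) = (t : ℝ) * ψ z := by
      have := integral_Ioi_step (ψ := ψ) (show (0 : ℝ≥0) ≤ t from t.2) z
      simp only [NNReal.coe_zero, sub_zero] at this
      rw [← this]
      refine setIntegral_congr_fun measurableSet_Ioi fun x hx => ?_
      have hx' : (0 : ℝ) ≤ x := (mem_Ioi.1 hx).le
      by_cases hxt : x < t <;> simp [indicator, hxt, hx', h0]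
    rw [← e, ← h1]
    refine integral_congr_ae (ae_of_all _ fun ω => ?_)
    simp only [Finset.univ_unique, Finset.sum_singleton]
    push_cast; ring_nf
  have hpm : ∀ f : Ω → ℝ, Measurable f → IsProbabilityMeasure (P.map f) := fun f hf =>
    Measure.isProbabilityMeasure_map hf.aemeasurable
  refine ⟨⟨hY, ?_, ?_, ?_, ?_⟩, hone⟩
  · have hd : P.map (Y 0) = Measure.dirac 0 := by
      have := hpm _ (hY 0)
      refine Measure.ext_of_charFun (funext fun z => ?_)
      rw [hone, charFun_dirac]; simp
    have : ∀ᵐ x ∂(P.map (Y 0)), x = 0 := by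
      rw [hd]
      exact (ae_dirac_iff (measurableSet_eq)).2 rfl
    exact ae_of_ae_map (hY 0).aemeasurable this
  · intro n t ht
    rw [iIndepFun_iff_charFun_pi fun i => (hsub _ _).aemeasurable]
    intro z
    have hmeas : Measurable fun ω => fun i : Fin n => Y (t i.succ) ω - Y (t i.castSucc) ω :=
      measurable_pi_lambda _ fun i => (hY _).sub (hY _)
    have e1 := hmono n t ht z
    have e2 : P.map (fun ω => WithLp.toLp 2 fun i : Fin n => Y (t i.succ) ω - Y (t i.castSucc) ω)
        = (P.map fun ω => fun i : Fin n => Y (t i.succ) ω - Y (t i.castSucc) ω).map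
          (WithLp.toLp 2) := by
      rw [Measure.map_map (by fun_prop) hmeas]; rfl
    rw [e2, charFun_map_toLp_eq, integral_map hmeas.aemeasurable
      (aestronglyMeasurable_jointExp _ _), e1]
    exact Finset.prod_congr rfl fun i _ => (hincr _ _ (ht i.castSucc_lt_succ.le) _).symm
  · intro s t
    refine ⟨(hsub _ _).aemeasurable, (hY t).aemeasurable, ?_⟩
    have i1 := hpm _ (hsub s (s + t))
    have i2 := hpm _ (hY t)
    refine Measure.ext_of_charFun (funext fun z => ?_)
    refine (hincr s (s + t) le_self_add z).trans ?_
    rw [hone]; push_cast; ring_nf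
  · intro t
    rw [tendstoInMeasure_iff_measureReal_dist]
    intro ε hε
    -- The truncation inequality bounds the tail beyond ε/2 by an average of 1 - charFun over |z| ≤
    -- 2/(ε/2), and C bounds ψ on that window. The level ε/2 instead of ε passes from the event with
    -- ≥ to the event with >.
    obtain ⟨C, hC⟩ := (isCompact_Icc (a := -2 * (ε / 2)⁻¹) (b := 2 * (ε / 2)⁻¹)
      ).exists_bound_of_continuousOn hψ.continuousOn
    have hC0 : 0 ≤ C := (norm_nonneg _).trans (hC 0 ⟨by simp; positivity, by positivity⟩)
    have hbound : ∀ s u : ℝ≥0, s ≤ u → ((u : ℝ) - s) * C ≤ 1 →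
        P.real {ω | ε / 2 < |Y u ω - Y s ω|} ≤ 2 * (2 * (((u : ℝ) - s) * C)) := by
      intro s u hsu hle
      have := hpm _ (hsub s u)
      have hr : 0 < ε / 2 := by positivity
      have h1 := measureReal_abs_gt_le_integral_charFun (μ := P.map fun ω => Y u ω - Y s ω) hr
      rw [map_measureReal_apply (hsub s u)
        (measurableSet_lt measurable_const (by fun_prop : Measurable fun x : ℝ => |x|))] at h1
      refine h1.trans ?_
      have h2 : ‖∫ z in (-2 * (ε / 2)⁻¹)..(2 * (ε / 2)⁻¹),
          (1 - charFun (P.map fun ω => Y u ω - Y s ω) z)‖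
          ≤ 2 * (((u : ℝ) - s) * C) * |2 * (ε / 2)⁻¹ - -2 * (ε / 2)⁻¹| := by
        refine intervalIntegral.norm_integral_le_of_norm_le_const fun z hz => ?_
        rw [uIoc_of_le (by have : 0 < (ε / 2)⁻¹ := by positivity
                           linarith)] at hz
        rw [hincr s u hsu, ← norm_neg, neg_sub]
        have hn : ‖(((u : ℝ) - s : ℝ) : ℂ) * ψ z‖ ≤ ((u : ℝ) - s) * C := by
          rw [norm_mul, Complex.norm_real, Real.norm_of_nonneg (sub_nonneg.2 (NNReal.coe_le_coe.2 hsu))]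
          exact mul_le_mul_of_nonneg_left (hC z ⟨hz.1.le, hz.2⟩)
            (sub_nonneg.2 (NNReal.coe_le_coe.2 hsu))
        exact (Complex.norm_exp_sub_one_le (hn.trans hle)).trans (by linarith)
      refine (mul_le_mul_of_nonneg_left h2 (by positivity)).trans (le_of_eq ?_)
      rw [abs_of_pos (by have : 0 < (ε / 2)⁻¹ := by positivity
                         linarith)]
      field_simp
      ring
    have hto : Tendsto (fun s : ℝ≥0 => |(s : ℝ) - t| * C) (𝓝 t) (𝓝 0) := by
      have : Continuous fun s : ℝ≥0 => |(s : ℝ) - t| * C := by fun_prop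
      simpa using this.tendsto t
    refine tendsto_of_tendsto_of_tendsto_of_le_of_le' tendsto_const_nhds
      (h := fun s : ℝ≥0 => 2 * (2 * (|(s : ℝ) - t| * C))) ?_
      (Eventually.of_forall fun _ => measureReal_nonneg) ?_
    · simpa using (hto.const_mul 2).const_mul 2
    · filter_upwards [hto.eventually (gt_mem_nhds one_pos)] with s hs
      have hsub : {ω | ε ≤ dist (Y s ω) (Y t ω)} ⊆ {ω | ε / 2 < |Y s ω - Y t ω|} := fun ω hω => by
        simp only [mem_ofPred_eq, Real.dist_eq] at hω ⊢
        linarith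
      refine (measureReal_mono hsub).trans ?_
      rcases le_total s t with hst | hst
      · rw [abs_of_nonpos (sub_nonpos.2 (NNReal.coe_le_coe.2 hst)), neg_sub] at hs ⊢
        simp_rw [abs_sub_comm (Y s _)]
        exact hbound s t hst hs.le
      · rw [abs_of_nonneg (sub_nonneg.2 (NNReal.coe_le_coe.2 hst))] at hs ⊢
        exact hbound t s hst hs.le

/-- If the joint characteristic functions of the processes `Z n` converge to those of a Lévy process
with continuous exponent `ψ`, then this Lévy process exists and is the limit of the `Z n` in the
sense of finite-dimensional distributions. -/
theorem exists_isLevyProcess_tendstoFDD {Ω : Type*} [MeasurableSpace Ω] (P : Measure Ω)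
    [IsProbabilityMeasure P] (Z : ℕ → ℝ≥0 → Ω → ℝ) (hZ : ∀ n t, Measurable (Z n t))
    (hψ : Continuous ψ) (h0 : ψ 0 = 0)
    (h : ∀ (ι : Type) [Fintype ι] (t : ι → ℝ≥0) (z : ι → ℝ), Tendsto
      (fun n => ∫ ω, Complex.exp (Complex.I * ((∑ j, z j * Z n (t j) ω : ℝ) : ℂ)) ∂P) atTop
      (𝓝 (Complex.exp (levyJointExponent ψ t z)))) :
    ∃ (Ω' : Type) (_ : MeasurableSpace Ω') (P' : Measure Ω') (_ : IsProbabilityMeasure P')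
      (Y : ℝ≥0 → Ω' → ℝ), IsLevyProcess P' Y ∧
        (∀ t z, charFun (P'.map (Y t)) z = Complex.exp ((t : ℝ) * ψ z)) ∧ TendstoFDD Z P Y P' := by
  -- The law at the times in J is obtained as a limit of laws of Z n. No infinitely divisible law
  -- has to be built by hand.
  have hex : ∀ J : Finset ℝ≥0, ∃ μ : Measure (J → ℝ), IsProbabilityMeasure μ ∧ ∀ z : J → ℝ,
      ∫ x, Complex.exp (Complex.I * ((∑ j, z j * x j : ℝ) : ℂ)) ∂μ
        = Complex.exp (levyJointExponent ψ (fun j : J => (j : ℝ≥0)) z) := by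
    intro J
    have hm : ∀ n, Measurable fun ω => fun j : J => Z n j ω := fun n =>
      measurable_pi_lambda _ fun j => hZ n j
    have : ∀ n, IsProbabilityMeasure (P.map fun ω => fun j : J => Z n j ω) := fun n =>
      Measure.isProbabilityMeasure_map (hm n).aemeasurable
    refine exists_jointCharFun_eq_of_tendsto (fun n => P.map fun ω => fun j : J => Z n j ω)
      ((Complex.continuous_exp.comp (continuous_levyJointExponent hψ h0 _)).continuousAt)
      fun z => ?_
    refine (h J _ z).congr fun n => ?_
    exact (integral_map (hm n).aemeasurable (aestronglyMeasurable_jointExp z _)).symm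
  choose M hMp hM using hex
  have hproj : IsProjectiveMeasureFamily (α := fun _ => ℝ) M := by
    intro I J hJI
    have : IsProbabilityMeasure ((M I).map (Finset.restrict₂ (π := fun _ => ℝ) hJI)) :=
      Measure.isProbabilityMeasure_map (Finset.measurable_restrict₂ hJI).aemeasurable
    refine ext_of_jointCharFun fun z => ?_
    rw [hM, integral_map (Finset.measurable_restrict₂ (X := fun _ => ℝ) hJI).aemeasurable
      (aestronglyMeasurable_jointExp _ _)]
    -- Consistency: extending the weights by 0 outside J changes neither the joint exponent nor the
    -- linear form.
    set z' : I → ℝ := fun i => if hi : (i : ℝ≥0) ∈ J then z ⟨i, hi⟩ else 0 with hz'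
    have hsum : ∀ f : ℝ≥0 → ℝ → ℝ, (∀ x, f x 0 = 0) →
        ∑ i : I, f i (z' i) = ∑ j : J, f j (z j) := by
      intro f hf
      have h1 : ∑ i : I, f i (z' i) = ∑ x ∈ I, f x (if hi : x ∈ J then z ⟨x, hi⟩ else 0) :=
        Finset.sum_coe_sort I fun x => f x (if hi : x ∈ J then z ⟨x, hi⟩ else 0)
      have h2 : ∑ j : J, f j (z j) = ∑ x ∈ J, f x (if hi : x ∈ J then z ⟨x, hi⟩ else 0) := by
        rw [← Finset.sum_coe_sort J]
        exact Finset.sum_congr rfl fun j _ => by simp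
      rw [h1, h2]
      refine (Finset.sum_subset hJI fun x _ hx => ?_).symm
      simp [hx, hf]
    have e1 : levyJointExponent ψ (fun j : J => (j : ℝ≥0)) z
        = levyJointExponent ψ (fun i : I => (i : ℝ≥0)) z' := by
      unfold levyJointExponent
      congr 1; ext s
      rw [hsum (fun x y => if s < x then y else 0) (by simp)]
    rw [e1, ← hM]
    refine integral_congr_ae (ae_of_all _ fun x => ?_)
    have : ∑ j : I, z' j * x j = ∑ j : J, z j * Finset.restrict₂ (π := fun _ => ℝ) hJI x j := by
      have := hsum (fun t y => y * if hi : t ∈ I then x ⟨t, hi⟩ else 0) (by simp)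
      simp only [Finset.coe_mem, dite_true, Subtype.coe_eta] at this
      rw [this]
      exact Finset.sum_congr rfl fun j _ => by simp [hJI j.2]
    simp only [this]
  obtain ⟨P', hP'⟩ := exists_isProjectiveLimit M hproj
  have hpr : IsProbabilityMeasure P' := hP'.isProbabilityMeasure
  have hjoint : ∀ (ι : Type) [Fintype ι] (t : ι → ℝ≥0) (z : ι → ℝ),
      ∫ ω : ℝ≥0 → ℝ, Complex.exp (Complex.I * ((∑ j, z j * ω (t j) : ℝ) : ℂ)) ∂P'
        = Complex.exp (levyJointExponent ψ t z) := by
    intro ι _ t z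
    classical
    set J : Finset ℝ≥0 := Finset.univ.image t with hJ
    have hmem : ∀ j, t j ∈ J := fun j => Finset.mem_image_of_mem t (Finset.mem_univ j)
    -- The times t j may repeat, whereas J is a set; the weights of equal times are added up.
    set z' : J → ℝ := fun x => ∑ j ∈ Finset.univ.filter fun j => t j = x, z j with hz'
    have hsum : ∀ f : ℝ≥0 → ℝ, ∑ x : J, z' x * f x = ∑ j, z j * f (t j) := by
      intro f
      have h1 : ∑ x : J, z' x * f x
          = ∑ x ∈ J, ∑ j ∈ Finset.univ.filter (fun j => t j = x), z j * f (t j) := by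
        rw [← Finset.sum_coe_sort J]
        refine Finset.sum_congr rfl fun x _ => ?_
        rw [hz', Finset.sum_mul]
        refine Finset.sum_congr rfl fun j hj => ?_
        rw [(Finset.mem_filter.1 hj).2]
      rw [h1, Finset.sum_fiberwise_of_maps_to fun j _ => hmem j]
    have e1 : levyJointExponent ψ t z = levyJointExponent ψ (fun x : J => (x : ℝ≥0)) z' := by
      unfold levyJointExponent
      congr 1; ext s
      have := hsum fun x => if s < x then 1 else 0
      simp only [mul_ite, mul_one, mul_zero] at this
      rw [this]
    rw [e1, ← hM J, ← hP' J, integral_map (Finset.measurable_restrict J).aemeasurable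
      (aestronglyMeasurable_jointExp _ _)]
    refine integral_congr_ae (ae_of_all _ fun ω => ?_)
    simp only [← hsum fun x => ω x]
    rfl
  have hmeas : ∀ t : ℝ≥0, Measurable fun ω : ℝ≥0 → ℝ => ω t := fun t => measurable_pi_apply t
  obtain ⟨h1, h2⟩ := isLevyProcess_of_jointCharFun (Y := fun t (ω : ℝ≥0 → ℝ) => ω t) hmeas hψ h0
    hjoint
  refine ⟨ℝ≥0 → ℝ, inferInstance, P', hpr, fun t ω => ω t, h1, h2, fun k t => ?_⟩
  refine tendstoInDistribution_of_jointCharFun (fun n => measurable_pi_lambda _ fun j => hZ n _)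
    (measurable_pi_lambda _ fun j => hmeas _) fun z => ?_
  rw [hjoint]
  exact h (Fin k) t z

end LevyProcess


/-! ### Integrals of power type on the half-line -/

section PowerIntegrals

theorem integrableOn_Ioc_rpow {a : ℝ} (ha : -1 < a) :
    IntegrableOn (fun v : ℝ => v ^ a) (Ioc 0 1) :=
  (intervalIntegrable_iff_integrableOn_Ioc_of_le zero_le_one).1
    (intervalIntegral.intervalIntegrable_rpow' ha)

/-- A function of power type `v^a` near `0` and `v^b` near infinity, `b < -1 < a`, is integrable
on the half-line. -/
theorem integrableOn_Ioi_of_norm_le_rpow {E : Type*} [NormedAddCommGroup E] {f : ℝ → E} {a b C : ℝ}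
    (hf : AEStronglyMeasurable f (volume.restrict (Ioi 0))) (ha : -1 < a) (hb : b < -1)
    (h1 : ∀ v, 0 < v → v ≤ 1 → ‖f v‖ ≤ C * v ^ a) (h2 : ∀ v, 1 < v → ‖f v‖ ≤ C * v ^ b) :
    IntegrableOn f (Ioi 0) := by
  rw [← Ioc_union_Ioi_eq_Ioi (zero_le_one (α := ℝ)), integrableOn_union]
  constructor
  · refine Integrable.mono' ((integrableOn_Ioc_rpow ha).const_mul C)
      (hf.mono_measure (Measure.restrict_mono Ioc_subset_Ioi_self le_rfl)) ?_
    exact (ae_restrict_iff' measurableSet_Ioc).2 (ae_of_all _ fun v hv => h1 v hv.1 hv.2)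
  · refine Integrable.mono' ((integrableOn_Ioi_rpow_of_lt hb one_pos).const_mul C)
      (hf.mono_measure (Measure.restrict_mono (Ioi_subset_Ioi zero_le_one) le_rfl)) ?_
    exact (ae_restrict_iff' measurableSet_Ioi).2 (ae_of_all _ fun v hv => h2 v hv)

end PowerIntegrals

/-! ### Laplace integrals of powers and their integrations by parts -/

section Laplace

theorem integrableOn_rpow_mul_exp_neg_mul {s : ℝ} (hs : 0 < s) {p : ℂ} (hp : 0 < p.re) :
    IntegrableOn (fun w : ℝ => ((w ^ (s - 1) : ℝ) : ℂ) * Complex.exp (-(p * w))) (Ioi 0) := by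
  have h := integrableOn_rpow_mul_exp_neg_mul_rpow (s := s - 1) (p := 1) (by linarith) one_pos hp
  simp only [Real.rpow_one] at h
  refine Integrable.mono' h (Measurable.aestronglyMeasurable (by fun_prop)) ?_
  refine (ae_restrict_iff' measurableSet_Ioi).2 (ae_of_all _ fun w hw => ?_)
  rw [norm_mul, Complex.norm_real, Complex.norm_exp,
    Real.norm_of_nonneg (Real.rpow_nonneg (mem_Ioi.1 hw).le _)]
  simp

/-- The Laplace transform of a power, on the right half-plane. -/
theorem integral_rpow_mul_exp_neg_complex_mul {s : ℝ} (hs : 0 < s) {p : ℂ} (hp : 0 < p.re) :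
    ∫ w in Ioi (0 : ℝ), ((w ^ (s - 1) : ℝ) : ℂ) * Complex.exp (-(p * w))
      = (1 / p) ^ (s : ℂ) * (Real.Gamma s : ℂ) := by
  set U : Set ℂ := {p : ℂ | 0 < p.re} with hU
  have hUo : IsOpen U := isOpen_lt continuous_const Complex.continuous_re
  have hd1 : DifferentiableOn ℂ
      (fun p : ℂ => ∫ w in Ioi (0 : ℝ), ((w ^ (s - 1) : ℝ) : ℂ) * Complex.exp (-(p * w))) U := by
    intro p hp
    have hp' : 0 < p.re := hp
    -- The derivative in p brings down a factor w; on the neighbourhood Re q > Re p / 2 this single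
    -- function dominates it.
    have hb : IntegrableOn (fun w : ℝ => w ^ s * Real.exp (-(p.re / 2) * w)) (Ioi 0) := by
      have := integrableOn_rpow_mul_exp_neg_mul_rpow (s := s) (p := 1) (b := p.re / 2)
        (by linarith) one_pos (by linarith)
      simpa only [Real.rpow_one] using this
    have hmem : {q : ℂ | p.re / 2 < q.re} ∈ 𝓝 p :=
      (isOpen_lt continuous_const Complex.continuous_re).mem_nhds (by
        simp only [mem_ofPred_eq]; linarith)
    refine (hasDerivAt_integral_of_dominated_loc_of_deriv_le
      (F := fun (p : ℂ) (w : ℝ) => ((w ^ (s - 1) : ℝ) : ℂ) * Complex.exp (-(p * w)))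
      (F' := fun (p : ℂ) (w : ℝ) => ((w ^ (s - 1) : ℝ) : ℂ) * (Complex.exp (-(p * w)) * (-w)))
      hmem ?_ (integrableOn_rpow_mul_exp_neg_mul hs hp') ?_ ?_ hb ?_
      ).2.differentiableAt.differentiableWithinAt
    · exact Eventually.of_forall fun q => Measurable.aestronglyMeasurable (by fun_prop)
    · exact Measurable.aestronglyMeasurable (by fun_prop)
    · refine (ae_restrict_iff' measurableSet_Ioi).2 (ae_of_all _ fun w hw q hq => ?_)
      have hw' : 0 < w := hw
      have hq' : p.re / 2 < q.re := hq
      rw [norm_mul, norm_mul, Complex.norm_real, Complex.norm_exp, norm_neg, Complex.norm_real,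
        Real.norm_of_nonneg (Real.rpow_nonneg hw'.le _), Real.norm_of_nonneg hw'.le]
      have : w ^ s = w ^ (s - 1) * w := by
        rw [← Real.rpow_add_one hw'.ne']; ring_nf
      rw [this, mul_assoc, mul_comm w]
      gcongr
      simp only [Complex.neg_re, Complex.mul_re, Complex.ofReal_re, Complex.ofReal_im, mul_zero,
        sub_zero]
      nlinarith
    · refine ae_of_all _ fun w q _ => ?_
      have : HasDerivAt (fun q : ℂ => -(q * w)) (-(w : ℂ)) q := by
        simpa using ((hasDerivAt_id q).mul_const (w : ℂ)).fun_neg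
      exact this.cexp.const_mul _
  have hd2 : DifferentiableOn ℂ (fun p : ℂ => (1 / p) ^ (s : ℂ) * (Real.Gamma s : ℂ)) U := by
    intro p hp
    have hp' : 0 < p.re := hp
    have hp0 : p ≠ 0 := fun h => by simp [h] at hp'
    have hre : 0 < (1 / p).re := by
      rw [one_div, Complex.inv_re]
      exact div_pos hp' (Complex.normSq_pos.2 hp0)
    refine DifferentiableAt.differentiableWithinAt ?_
    refine DifferentiableAt.mul_const (DifferentiableAt.cpow_const ?_ (Or.inl hre)) _
    exact (differentiableAt_const _).div differentiableAt_id hp0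
  -- Identity theorem: both sides are analytic on the half-plane and agree, by the real Gamma
  -- integral, at the points 1 + 1/(n+1), which accumulate at 1.
  have heq := AnalyticOnNhd.eqOn_of_preconnected_of_frequently_eq (hd1.analyticOnNhd hUo)
    (hd2.analyticOnNhd hUo) (convex_halfSpace_re_gt 0).isPreconnected
    (z₀ := 1) (by simp [hU]) ?_
  · exact heq hp
  · have ht : Tendsto (fun n : ℕ => (((1 : ℝ) + 1 / ((n : ℝ) + 1) : ℝ) : ℂ)) atTop (𝓝[≠] 1) := by
      refine tendsto_nhdsWithin_iff.2 ⟨?_, Eventually.of_forall fun n => ?_⟩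
      · have h1 := (tendsto_one_div_add_atTop_nhds_zero_nat (𝕜 := ℝ)).const_add 1
        rw [add_zero] at h1
        exact (Complex.continuous_ofReal.tendsto 1).comp h1
      · have : (0 : ℝ) < 1 / ((n : ℝ) + 1) := by positivity
        simp only [mem_compl_iff, mem_singleton_iff]
        rw [← Complex.ofReal_one, Complex.ofReal_inj]
        linarith
    refine ht.frequently (Frequently.of_forall fun n => ?_)
    set r : ℝ := 1 + 1 / ((n : ℝ) + 1) with hr
    have hr0 : 0 < r := by positivity
    have := Complex.integral_cpow_mul_exp_neg_mul_Ioi (a := s) (by simpa using hs) hr0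
    rw [Complex.Gamma_ofReal] at this
    rw [← this]
    refine setIntegral_congr_fun measurableSet_Ioi fun w hw => ?_
    rw [Complex.ofReal_cpow (mem_Ioi.1 hw).le]
    push_cast; ring_nf

theorem norm_one_sub_exp_neg_le {z : ℂ} (hz : 0 ≤ z.re) :
    ‖1 - Complex.exp (-z)‖ ≤ 2 ∧ ‖1 - Complex.exp (-z)‖ ≤ 2 * ‖z‖ := by
  have h2 : ‖1 - Complex.exp (-z)‖ ≤ 2 := by
    refine (norm_sub_le _ _).trans ?_
    rw [norm_one, Complex.norm_exp]
    have : Real.exp (-z).re ≤ 1 := Real.exp_le_one_iff.2 (by simpa using hz)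
    linarith
  refine ⟨h2, ?_⟩
  rcases le_total ‖z‖ 1 with h | h
  · rw [norm_sub_rev]
    simpa using Complex.norm_exp_sub_one_le (x := -z) (by simpa using h)
  · linarith

/-- The quadratic bound serves near 0 and the linear one at infinity; together they make the
integral against w^(-1-β) converge at both ends for 1 < β < 2. -/
theorem norm_exp_neg_sub_one_add_le {z : ℂ} (hz : 0 ≤ z.re) :
    ‖Complex.exp (-z) - 1 + z‖ ≤ 3 * ‖z‖ ∧ ‖Complex.exp (-z) - 1 + z‖ ≤ 3 * ‖z‖ ^ 2 := by
  have h1 : ‖Complex.exp (-z) - 1 + z‖ ≤ 3 * ‖z‖ := by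
    refine (norm_add_le _ _).trans ?_
    rw [norm_sub_rev]
    linarith [(norm_one_sub_exp_neg_le hz).2]
  refine ⟨h1, ?_⟩
  rcases le_total ‖z‖ 1 with h | h
  · have := Complex.norm_exp_sub_one_sub_id_le (x := -z) (by simpa using h)
    rw [sub_neg_eq_add, norm_neg] at this
    nlinarith [sq_nonneg ‖z‖]
  · nlinarith

variable {β : ℝ}

theorem integrableOn_rpow_mul_compensated (hβ1 : 1 < β) (hβ2 : β < 2) {p : ℂ} (hp : 0 ≤ p.re) :
    IntegrableOn (fun w : ℝ => (Complex.exp (-(p * w)) - 1 + p * w) * ((w ^ (-1 - β) : ℝ) : ℂ))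
      (Ioi 0) := by
  have hb : ∀ w : ℝ, 0 < w → 0 ≤ (p * w).re := fun w hw => by
    simpa using mul_nonneg hp hw.le
  refine integrableOn_Ioi_of_norm_le_rpow (a := 1 - β) (b := -β) (C := 3 * (‖p‖ + ‖p‖ ^ 2))
    (Measurable.aestronglyMeasurable (by fun_prop)) (by linarith) (by linarith) ?_ ?_
  · intro w hw _
    have := (norm_exp_neg_sub_one_add_le (hb w hw)).2
    rw [norm_mul, Complex.norm_real, Real.norm_of_nonneg (Real.rpow_nonneg hw.le _)]
    have e : w ^ (1 - β) = w ^ 2 * w ^ (-1 - β) := by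
      rw [← Real.rpow_natCast, ← Real.rpow_add hw]; norm_num; ring_nf
    rw [e, ← mul_assoc]
    refine mul_le_mul_of_nonneg_right (this.trans ?_) (Real.rpow_nonneg hw.le _)
    rw [norm_mul, Complex.norm_real, Real.norm_of_nonneg hw.le]
    nlinarith [norm_nonneg p, sq_nonneg w, mul_nonneg (norm_nonneg p) (sq_nonneg w)]
  · intro w hw
    have hw0 : 0 < w := one_pos.trans hw
    have := (norm_exp_neg_sub_one_add_le (hb w hw0)).1
    rw [norm_mul, Complex.norm_real, Real.norm_of_nonneg (Real.rpow_nonneg hw0.le _)]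
    have e : w ^ (-β) = w * w ^ (-1 - β) := by
      rw [← Real.rpow_one_add' hw0.le (by linarith)]; ring_nf
    rw [e, ← mul_assoc]
    refine mul_le_mul_of_nonneg_right (this.trans ?_) (Real.rpow_nonneg hw0.le _)
    rw [norm_mul, Complex.norm_real, Real.norm_of_nonneg hw0.le]
    nlinarith [norm_nonneg p, mul_nonneg (sq_nonneg ‖p‖) hw0.le]

theorem integrableOn_rpow_mul_one_sub_exp (hβ1 : 1 < β) (hβ2 : β < 2) {p : ℂ} (hp : 0 ≤ p.re) :
    IntegrableOn (fun w : ℝ => (1 - Complex.exp (-(p * w))) * ((w ^ (-β) : ℝ) : ℂ)) (Ioi 0) := by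
  have hb : ∀ w : ℝ, 0 < w → 0 ≤ (p * w).re := fun w hw => by
    simpa using mul_nonneg hp hw.le
  refine integrableOn_Ioi_of_norm_le_rpow (a := 1 - β) (b := -β) (C := 2 + 2 * ‖p‖)
    (Measurable.aestronglyMeasurable (by fun_prop)) (by linarith) (by linarith) ?_ ?_
  · intro w hw _
    have := (norm_one_sub_exp_neg_le (hb w hw)).2
    rw [norm_mul, Complex.norm_real, Real.norm_of_nonneg (Real.rpow_nonneg hw.le _)]
    have e : w ^ (1 - β) = w * w ^ (-β) := by
      rw [← Real.rpow_one_add' hw.le (by linarith)]; ring_nf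
    rw [e, ← mul_assoc]
    refine mul_le_mul_of_nonneg_right (this.trans ?_) (Real.rpow_nonneg hw.le _)
    rw [norm_mul, Complex.norm_real, Real.norm_of_nonneg hw.le]
    nlinarith [norm_nonneg p]
  · intro w hw
    have hw0 : 0 < w := one_pos.trans hw
    have := (norm_one_sub_exp_neg_le (hb w hw0)).1
    rw [norm_mul, Complex.norm_real, Real.norm_of_nonneg (Real.rpow_nonneg hw0.le _)]
    refine mul_le_mul_of_nonneg_right (this.trans ?_) (Real.rpow_nonneg hw0.le _)
    linarith [norm_nonneg p]

theorem hasDerivAt_ofReal_rpow {a : ℝ} {w : ℝ} (hw : 0 < w) (ha : a ≠ 0) :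
    HasDerivAt (fun w : ℝ => ((w ^ a / a : ℝ) : ℂ)) ((w ^ (a - 1) : ℝ) : ℂ) w := by
  have := ((Real.hasDerivAt_rpow_const (p := a) (Or.inl hw.ne')).div_const a).ofReal_comp
  rwa [mul_div_assoc, mul_comm, div_mul_cancel₀ _ ha] at this

theorem tendsto_zero_of_norm_le_rpow {f : ℝ → ℂ} {a C : ℝ} (ha : 0 < a)
    (h : ∀ w, 0 < w → ‖f w‖ ≤ C * w ^ a) : Tendsto f (𝓝[>] 0) (𝓝 0) := by
  refine squeeze_zero_norm' (a := fun w => C * w ^ a)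
    (eventually_mem_nhdsWithin.mono fun w hw => h w hw) ?_
  have : Tendsto (fun w : ℝ => w ^ a) (𝓝 0) (𝓝 (0 ^ a)) :=
    (Real.continuous_rpow_const ha.le).tendsto 0
  rw [Real.zero_rpow ha.ne'] at this
  simpa using (this.mono_left nhdsWithin_le_nhds).const_mul C

theorem tendsto_atTop_zero_of_norm_le_rpow {f : ℝ → ℂ} {a C : ℝ} (ha : a < 0)
    (h : ∀ w, 0 < w → ‖f w‖ ≤ C * w ^ a) : Tendsto f atTop (𝓝 0) := by
  refine squeeze_zero_norm' (a := fun w => C * w ^ a)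
    ((eventually_gt_atTop 0).mono fun w hw => h w hw) ?_
  have := (tendsto_rpow_neg_atTop (neg_pos.2 ha))
  rw [neg_neg] at this
  simpa using this.const_mul C

/-- Integration by parts with primitive -w^(-β)/β. The boundary terms are O(w^(2-β)) at 0 and
O(w^(1-β)) at infinity, which holds up to the imaginary axis. -/
theorem integral_rpow_mul_compensated_eq (hβ1 : 1 < β) (hβ2 : β < 2) {p : ℂ} (hp : 0 ≤ p.re) :
    ∫ w in Ioi (0 : ℝ), (Complex.exp (-(p * w)) - 1 + p * w) * ((w ^ (-1 - β) : ℝ) : ℂ)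
      = p / β * ∫ w in Ioi (0 : ℝ), (1 - Complex.exp (-(p * w))) * ((w ^ (-β) : ℝ) : ℂ) := by
  have hβ0 : (β : ℂ) ≠ 0 := by exact_mod_cast (by linarith : β ≠ 0)
  have hb : ∀ w : ℝ, 0 < w → 0 ≤ (p * w).re := fun w hw => by
    simpa using mul_nonneg hp hw.le
  have hI := integrableOn_rpow_mul_compensated hβ1 hβ2 hp
  have hI2 := integrableOn_rpow_mul_one_sub_exp hβ1 hβ2 hp
  have e : ∀ w : ℝ, (p * (1 - Complex.exp (-(p * w)))) * ((w ^ (-β) / (-β) : ℝ) : ℂ)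
      = -(p / β) * ((1 - Complex.exp (-(p * w))) * ((w ^ (-β) : ℝ) : ℂ)) := fun w => by
    push_cast; field_simp
  have hn : ∀ w : ℝ, 0 < w → ‖((w ^ (-β) / (-β) : ℝ) : ℂ)‖ = w ^ (-β) / β := fun w hw => by
    rw [Complex.norm_real, norm_div, norm_neg, Real.norm_of_nonneg (Real.rpow_nonneg hw.le _),
      Real.norm_of_nonneg (by linarith)]
  have key := integral_Ioi_mul_deriv_eq_deriv_mul (a := 0) (a' := 0) (b' := 0)
    (u := fun w : ℝ => Complex.exp (-(p * w)) - 1 + p * w)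
    (u' := fun w : ℝ => p * (1 - Complex.exp (-(p * w))))
    (v := fun w : ℝ => ((w ^ (-β) / (-β) : ℝ) : ℂ)) (v' := fun w : ℝ => ((w ^ (-1 - β) : ℝ) : ℂ))
    ?_ ?_ hI ?_ ?_ ?_
  · rw [key, sub_zero, zero_sub, ← integral_neg, ← integral_const_mul]
    refine setIntegral_congr_fun measurableSet_Ioi fun w _ => ?_
    rw [e]; ring
  · intro w _
    have h1 : HasDerivAt (fun w : ℝ => p * (w : ℂ)) p w := by
      simpa using (Complex.ofRealCLM.hasDerivAt (x := w)).const_mul p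
    have := (h1.fun_neg.cexp.sub_const 1).add h1
    refine this.congr_deriv ?_
    ring
  · intro w hw
    have := hasDerivAt_ofReal_rpow (a := -β) (mem_Ioi.1 hw) (by linarith)
    rwa [show -β - 1 = -1 - β by ring] at this
  · refine (hI2.const_mul (-(p / β))).congr (ae_of_all _ fun w => ?_)
    simp only [Pi.mul_apply]
    rw [e]
  · refine tendsto_zero_of_norm_le_rpow (a := 2 - β) (C := 3 * ‖p‖ ^ 2 / β) (by linarith)
      fun w hw => ?_
    have := (norm_exp_neg_sub_one_add_le (hb w hw)).2
    rw [Pi.mul_apply, norm_mul, hn w hw]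
    have e2 : w ^ (2 - β) = w ^ 2 * w ^ (-β) := by
      rw [← Real.rpow_natCast, ← Real.rpow_add hw]; norm_num; ring_nf
    rw [norm_mul, Complex.norm_real, Real.norm_of_nonneg hw.le] at this
    refine (mul_le_mul_of_nonneg_right this (by positivity)).trans (le_of_eq ?_)
    rw [e2]; ring
  · refine tendsto_atTop_zero_of_norm_le_rpow (a := 1 - β) (C := 3 * ‖p‖ / β) (by linarith)
      fun w hw => ?_
    have := (norm_exp_neg_sub_one_add_le (hb w hw)).1
    rw [Pi.mul_apply, norm_mul, hn w hw]
    have e2 : w ^ (1 - β) = w * w ^ (-β) := by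
      rw [← Real.rpow_one_add' hw.le (by linarith)]; ring_nf
    rw [norm_mul, Complex.norm_real, Real.norm_of_nonneg hw.le] at this
    refine (mul_le_mul_of_nonneg_right this (by positivity)).trans (le_of_eq ?_)
    rw [e2]; ring

/-- A second integration by parts reduces to the Gamma integral. Here Re p > 0 is essential: for
purely imaginary p the new integrand has modulus of order w^(1-β), not integrable at infinity. -/
theorem integral_rpow_mul_one_sub_exp_eq (hβ1 : 1 < β) (hβ2 : β < 2) {p : ℂ} (hp : 0 < p.re) :
    ∫ w in Ioi (0 : ℝ), (1 - Complex.exp (-(p * w))) * ((w ^ (-β) : ℝ) : ℂ)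
      = p / (β - 1) * ((1 / p) ^ ((2 - β : ℝ) : ℂ) * (Real.Gamma (2 - β) : ℂ)) := by
  have hβ0 : (β : ℂ) - 1 ≠ 0 := by exact_mod_cast (by linarith : β - 1 ≠ 0)
  have hb : ∀ w : ℝ, 0 < w → 0 ≤ (p * w).re := fun w hw => by
    simpa using mul_nonneg hp.le hw.le
  have hI := integrableOn_rpow_mul_one_sub_exp hβ1 hβ2 hp.le
  have hI2 := integrableOn_rpow_mul_exp_neg_mul (s := 2 - β) (by linarith) hp
  have e : ∀ w : ℝ, (p * Complex.exp (-(p * w))) * ((w ^ (1 - β) / (1 - β) : ℝ) : ℂ)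
      = -(p / (β - 1)) * (((w ^ (2 - β - 1) : ℝ) : ℂ) * Complex.exp (-(p * w))) := fun w => by
    rw [show 2 - β - 1 = 1 - β by ring]
    have : (1 : ℂ) - β ≠ 0 := by exact_mod_cast (by linarith : 1 - β ≠ 0)
    push_cast; field_simp; ring
  have hn : ∀ w : ℝ, 0 < w → ‖((w ^ (1 - β) / (1 - β) : ℝ) : ℂ)‖ = w ^ (1 - β) / (β - 1) :=
    fun w hw => by
      rw [Complex.norm_real, norm_div, Real.norm_of_nonneg (Real.rpow_nonneg hw.le _),
        Real.norm_of_nonpos (by linarith), neg_sub]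
  have key := integral_Ioi_mul_deriv_eq_deriv_mul (a := 0) (a' := 0) (b' := 0)
    (u := fun w : ℝ => 1 - Complex.exp (-(p * w)))
    (u' := fun w : ℝ => p * Complex.exp (-(p * w)))
    (v := fun w : ℝ => ((w ^ (1 - β) / (1 - β) : ℝ) : ℂ)) (v' := fun w : ℝ => ((w ^ (-β) : ℝ) : ℂ))
    ?_ ?_ hI ?_ ?_ ?_
  · rw [key, sub_zero, zero_sub, ← integral_neg,
      ← integral_rpow_mul_exp_neg_complex_mul (by linarith) hp, ← integral_const_mul]
    refine setIntegral_congr_fun measurableSet_Ioi fun w _ => ?_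
    rw [e]; ring
  · intro w _
    have h1 : HasDerivAt (fun w : ℝ => p * (w : ℂ)) p w := by
      simpa using (Complex.ofRealCLM.hasDerivAt (x := w)).const_mul p
    have := h1.fun_neg.cexp.const_sub 1
    refine this.congr_deriv ?_
    ring
  · intro w hw
    have := hasDerivAt_ofReal_rpow (a := 1 - β) (mem_Ioi.1 hw) (by linarith)
    rwa [show 1 - β - 1 = -β by ring] at this
  · refine (hI2.const_mul (-(p / (β - 1)))).congr (ae_of_all _ fun w => ?_)
    simp only [Pi.mul_apply]
    rw [e]
  · refine tendsto_zero_of_norm_le_rpow (a := 2 - β) (C := 2 * ‖p‖ / (β - 1)) (by linarith)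
      fun w hw => ?_
    have := (norm_one_sub_exp_neg_le (hb w hw)).2
    rw [Pi.mul_apply, norm_mul, hn w hw]
    have e2 : w ^ (2 - β) = w * w ^ (1 - β) := by
      rw [← Real.rpow_one_add' hw.le (by linarith)]; ring_nf
    rw [norm_mul, Complex.norm_real, Real.norm_of_nonneg hw.le] at this
    refine (mul_le_mul_of_nonneg_right this
      (div_nonneg (Real.rpow_nonneg hw.le _) (by linarith))).trans (le_of_eq ?_)
    rw [e2]; ring
  · refine tendsto_atTop_zero_of_norm_le_rpow (a := 1 - β) (C := 2 / (β - 1)) (by linarith)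
      fun w hw => ?_
    have := (norm_one_sub_exp_neg_le (hb w hw)).1
    rw [Pi.mul_apply, norm_mul, hn w hw]
    refine (mul_le_mul_of_nonneg_right this
      (div_nonneg (Real.rpow_nonneg hw.le _) (by linarith))).trans (le_of_eq ?_)
    ring

end Laplace


/-! ### The compensated exponential and the stable constant -/

/-- The compensated exponential `e^{iy} - 1 - iy`. -/
noncomputable def compExp (y : ℝ) : ℂ := Complex.exp (Complex.I * y) - 1 - Complex.I * y

section CompExp

@[fun_prop]
theorem continuous_compExp : Continuous compExp := by unfold compExp; fun_prop

@[simp] theorem compExp_zero : compExp 0 = 0 := by simp [compExp]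

theorem compExp_neg (y : ℝ) : compExp (-y) = (starRingEnd ℂ) (compExp y) := by
  simp [compExp, ← Complex.exp_conj]

theorem compExp_eq (y : ℝ) : compExp y = Complex.exp (-(-Complex.I * y)) - 1 + -Complex.I * y := by
  simp [compExp]; ring

theorem norm_compExp_le (y : ℝ) : ‖compExp y‖ ≤ 3 * |y| ∧ ‖compExp y‖ ≤ 3 * y ^ 2 := by
  have h := norm_exp_neg_sub_one_add_le (z := -Complex.I * y) (by simp)
  rw [← compExp_eq] at h
  simpa using h

/-- For 1 ≤ p ≤ 2 the power |y|^p dominates min(|y|, y²), so it interpolates between the linear and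
the quadratic bound. -/
theorem norm_compExp_le_rpow {p : ℝ} (hp1 : 1 ≤ p) (hp2 : p ≤ 2) (y : ℝ) :
    ‖compExp y‖ ≤ 3 * |y| ^ p := by
  rcases le_total |y| 1 with h | h
  · rcases eq_or_ne y 0 with rfl | h0
    · simp only [compExp_zero, norm_zero]; positivity
    · refine (norm_compExp_le y).2.trans ?_
      rw [← sq_abs, ← Real.rpow_natCast]
      gcongr 3 * ?_
      exact Real.rpow_le_rpow_of_exponent_ge (abs_pos.2 h0) h (by simpa using hp2)
  · refine (norm_compExp_le y).1.trans ?_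
    gcongr 3 * ?_
    nth_rewrite 1 [← Real.rpow_one |y|]
    exact Real.rpow_le_rpow_of_exponent_le h hp1

end CompExp

/-- The exponent `∫ (e^{izx} - 1 - izx) ν(dx)` of the centred law with Lévy measure `ν`. -/
noncomputable def compExponent (ν : Measure ℝ) (z : ℝ) : ℂ := ∫ x, compExp (z * x) ∂ν

/-- The constant `∫_0^∞ (e^{iv} - 1 - iv) v^{-1-β} dv`. -/
noncomputable def stableConst (β : ℝ) : ℂ :=
  ∫ v in Ioi (0 : ℝ), compExp v * ((v ^ (-1 - β) : ℝ) : ℂ)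

section StableConst

variable {β : ℝ}

theorem integrableOn_compExp_mul_rpow (hβ1 : 1 < β) (hβ2 : β < 2) (y : ℝ) :
    IntegrableOn (fun v : ℝ => compExp (y * v) * ((v ^ (-1 - β) : ℝ) : ℂ)) (Ioi 0) := by
  have h := integrableOn_rpow_mul_compensated hβ1 hβ2 (p := -Complex.I * y) (by simp)
  refine h.congr_fun (fun v _ => ?_) measurableSet_Ioi
  simp only [compExp_eq]; push_cast; ring_nf

/-- The form of the constant that appears once ν has been replaced by its tail function, as in
`setIntegral_compExp_asymptotics`. -/
theorem stableConst_eq_tail (hβ1 : 1 < β) (hβ2 : β < 2) :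
    ∫ v in Ioi (0 : ℝ), (Complex.I * (Complex.exp (Complex.I * v) - 1)) * ((v ^ (-β) : ℝ) : ℂ)
      = β * stableConst β := by
  have h := integral_rpow_mul_compensated_eq hβ1 hβ2 (p := -Complex.I) (by simp)
  have hβ0 : (β : ℂ) ≠ 0 := by exact_mod_cast (by linarith : β ≠ 0)
  simp_rw [← compExp_eq] at h
  rw [stableConst, h, ← mul_assoc, mul_div_cancel₀ _ hβ0, ← integral_const_mul]
  refine setIntegral_congr_fun measurableSet_Ioi fun v _ => ?_
  simp only [neg_mul, neg_neg]; ring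

/-- The constant is the Laplace formula at p = -i, a boundary point which the Gamma integral does
not reach. It is therefore computed as the limit along p = 1/(n+1) - i. -/
theorem stableConst_eq (hβ1 : 1 < β) (hβ2 : β < 2) :
    stableConst β = (Real.Gamma (2 - β) / (β * (β - 1)) : ℝ) *
      ((Real.cos (Real.pi * β / 2) : ℂ) - Complex.I * Real.sin (Real.pi * β / 2)) := by
  have hβ0 : (β : ℂ) ≠ 0 := by exact_mod_cast (by linarith : β ≠ 0)
  have hβ1' : (β : ℂ) - 1 ≠ 0 := by exact_mod_cast (by linarith : β - 1 ≠ 0)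
  set p : ℕ → ℂ := fun n => ((1 / ((n : ℝ) + 1) : ℝ) : ℂ) - Complex.I with hp
  have hre : ∀ n, 0 < (p n).re := fun n => by
    simp only [hp, Complex.sub_re, Complex.ofReal_re, Complex.I_re, sub_zero]; positivity
  have hpl : Tendsto p atTop (𝓝 (-Complex.I)) := by
    have h1 := (Complex.continuous_ofReal.tendsto 0).comp
      (tendsto_one_div_add_atTop_nhds_zero_nat (𝕜 := ℝ))
    simpa [hp, Function.comp_def] using h1.sub_const Complex.I
  have hpn : ∀ n, ‖p n‖ ≤ 2 := fun n => by
    refine (norm_sub_le _ _).trans ?_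
    rw [Complex.norm_real, Complex.norm_I, Real.norm_of_nonneg (by positivity)]
    have : 1 / ((n : ℝ) + 1) ≤ 1 := by
      rw [div_le_one (by positivity)]; linarith [(n.cast_nonneg : (0 : ℝ) ≤ n)]
    linarith
  have hval : ∀ n, ∫ w in Ioi (0 : ℝ), (Complex.exp (-(p n * w)) - 1 + p n * w) *
      ((w ^ (-1 - β) : ℝ) : ℂ)
      = p n / β * (p n / (β - 1) * ((1 / p n) ^ ((2 - β : ℝ) : ℂ) * (Real.Gamma (2 - β) : ℂ))) :=
    fun n => by
      rw [integral_rpow_mul_compensated_eq hβ1 hβ2 (hre n).le,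
        integral_rpow_mul_one_sub_exp_eq hβ1 hβ2 (hre n)]
  have hlim1 : Tendsto (fun n => ∫ w in Ioi (0 : ℝ), (Complex.exp (-(p n * w)) - 1 + p n * w) *
      ((w ^ (-1 - β) : ℝ) : ℂ)) atTop (𝓝 (stableConst β)) := by
    -- With |p n| ≤ 2 the two bounds 3|z| and 3|z|² become 6w and 12w²; hence the factor 12.
    have hbi : IntegrableOn (fun w : ℝ => 12 * (min w (w ^ 2)) * w ^ (-1 - β)) (Ioi 0) := by
      refine integrableOn_Ioi_of_norm_le_rpow (a := 1 - β) (b := -β) (C := 12)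
        (Measurable.aestronglyMeasurable (by fun_prop)) (by linarith) (by linarith) ?_ ?_
      · intro w hw _
        have e : w ^ (1 - β) = w ^ 2 * w ^ (-1 - β) := by
          rw [← Real.rpow_natCast, ← Real.rpow_add hw]; norm_num; ring_nf
        have hm : 0 ≤ min w (w ^ 2) := by positivity
        rw [Real.norm_of_nonneg (by positivity), e, ← mul_assoc]
        gcongr
        exact min_le_right _ _
      · intro w hw
        have hw0 : 0 < w := one_pos.trans hw
        have e : w ^ (-β) = w * w ^ (-1 - β) := by
          rw [← Real.rpow_one_add' hw0.le (by linarith)]; ring_nf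
        have hm : 0 ≤ min w (w ^ 2) := by positivity
        rw [Real.norm_of_nonneg (by positivity), e, ← mul_assoc]
        gcongr
        exact min_le_left _ _
    refine tendsto_integral_of_dominated_convergence _
      (fun n => Measurable.aestronglyMeasurable (by fun_prop)) hbi (fun n => ?_) ?_
    · refine (ae_restrict_iff' measurableSet_Ioi).2 (ae_of_all _ fun w hw => ?_)
      have hw' : 0 < w := hw
      rw [norm_mul, Complex.norm_real, Real.norm_of_nonneg (Real.rpow_nonneg hw'.le _)]
      refine mul_le_mul_of_nonneg_right ?_ (Real.rpow_nonneg hw'.le _)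
      have h := norm_exp_neg_sub_one_add_le (z := p n * w) (by
        simpa using mul_nonneg (hre n).le hw'.le)
      have hz : ‖p n * w‖ ≤ 2 * w := by
        rw [norm_mul, Complex.norm_real, Real.norm_of_nonneg hw'.le]
        exact mul_le_mul_of_nonneg_right (hpn n) hw'.le
      rcases le_total w (w ^ 2) with h' | h'
      · rw [min_eq_left h']; linarith [h.1]
      · rw [min_eq_right h']; nlinarith [h.2, norm_nonneg (p n * w)]
    · refine ae_of_all _ fun w => ?_
      have hc : Continuous fun q : ℂ => (Complex.exp (-(q * w)) - 1 + q * w) *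
          ((w ^ (-1 - β) : ℝ) : ℂ) := by fun_prop
      have := (hc.tendsto (-Complex.I)).comp hpl
      rw [compExp_eq]
      exact this
  have hlim2 : Tendsto (fun n => p n / β * (p n / (β - 1) * ((1 / p n) ^ ((2 - β : ℝ) : ℂ) *
      (Real.Gamma (2 - β) : ℂ)))) atTop (𝓝 (-Complex.I / β * (-Complex.I / (β - 1) *
        ((1 / -Complex.I) ^ ((2 - β : ℝ) : ℂ) * (Real.Gamma (2 - β) : ℂ))))) := by
    have hinv : Tendsto (fun n => 1 / p n) atTop (𝓝 (1 / -Complex.I)) :=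
      tendsto_const_nhds.div hpl (by simp)
    have hcp : Tendsto (fun n => (1 / p n) ^ ((2 - β : ℝ) : ℂ)) atTop
        (𝓝 ((1 / -Complex.I) ^ ((2 - β : ℝ) : ℂ))) := by
      refine hinv.cpow tendsto_const_nhds (Or.inr ?_)
      simp
    exact (hpl.div_const _).mul ((hpl.div_const _).mul (hcp.mul_const _))
  have heq := tendsto_nhds_unique hlim1 (hlim2.congr fun n => (hval n).symm)
  -- Principal branch: 1/(-i) = i, and i^(2-β) = exp(i(π - πβ/2)).
  have hI : (1 / -Complex.I : ℂ) ^ ((2 - β : ℝ) : ℂ)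
      = -((Real.cos (Real.pi * β / 2) : ℂ) - Complex.I * Real.sin (Real.pi * β / 2)) := by
    have h1 : (1 / -Complex.I : ℂ) = Complex.I := by
      rw [one_div, inv_neg, Complex.inv_I, neg_neg]
    rw [h1, Complex.cpow_def_of_ne_zero Complex.I_ne_zero, Complex.log_I]
    have h2 : (Real.pi / 2 * Complex.I * ((2 - β : ℝ) : ℂ) : ℂ)
        = ((Real.pi - Real.pi * β / 2 : ℝ) : ℂ) * Complex.I := by push_cast; ring
    rw [h2, Complex.exp_mul_I, ← Complex.ofReal_cos, ← Complex.ofReal_sin, Real.cos_pi_sub,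
      Real.sin_pi_sub]
    push_cast; ring
  rw [heq, hI]
  push_cast
  field_simp
  rw [Complex.I_sq]
  ring

end StableConst

/-! ### The stable exponent as a homogeneous function -/

/-- The exponent of the strictly stable law of index `1 < β < 2`, in terms of `stableConst`. -/
noncomputable def stableSymbol (β Kp Km z : ℝ) : ℂ :=
  ((|z| ^ β : ℝ) : ℂ) * (if 0 ≤ z then Kp * stableConst β + Km * (starRingEnd ℂ) (stableConst β)
    else Kp * (starRingEnd ℂ) (stableConst β) + Km * stableConst β)

section StableSymbol

variable {β Kp Km : ℝ}

theorem stableSymbol_eq_stableExponent (hβ1 : 1 < β) (hβ2 : β < 2) (hK : 0 < Kp + Km) (γ z : ℝ) :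
    stableSymbol β Kp Km z = stableExponent β Kp Km γ z := by
  have hβ0 : β ≠ 0 := by linarith
  have hβ1' : β - 1 ≠ 0 := by linarith
  have hβ1'' : 1 - β ≠ 0 := by linarith
  have hcos : Real.cos (Real.pi * β / 2) ≠ 0 := by
    refine (Real.cos_neg_of_pi_div_two_lt_of_lt ?_ ?_).ne <;> nlinarith [Real.pi_pos]
  rcases eq_or_ne z 0 with rfl | hz
  · simp [stableSymbol, stableExponent, Real.zero_rpow hβ0, (by linarith : β ≠ 1)]
  rw [stableSymbol, stableExponent, if_neg (by linarith : β ≠ 1), stableConst_eq hβ1 hβ2,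
    Real.tan_eq_sin_div_cos]
  set C := Real.cos (Real.pi * β / 2)
  set S := Real.sin (Real.pi * β / 2)
  set G := Real.Gamma (2 - β)
  have h1 : (β : ℂ) ≠ 0 := by exact_mod_cast hβ0
  have h2 : (β : ℂ) - 1 ≠ 0 := by exact_mod_cast hβ1'
  have h3 : (1 : ℂ) - β ≠ 0 := by exact_mod_cast hβ1''
  have h4 : (C : ℂ) ≠ 0 := by exact_mod_cast hcos
  have h5 : (Kp : ℂ) + Km ≠ 0 := by exact_mod_cast hK.ne'
  have h6 : (1 : ℂ) - β = -(β - 1) := by ring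
  rcases lt_or_gt_of_ne hz with hz | hz
  · rw [if_neg (not_le.2 hz), Real.sign_of_neg hz]
    simp only [map_mul, map_sub, Complex.conj_ofReal, Complex.conj_I]
    push_cast
    rw [h6]
    field_simp
    ring
  · rw [if_pos hz.le, Real.sign_of_pos hz]
    simp only [map_mul, map_sub, Complex.conj_ofReal, Complex.conj_I]
    push_cast
    rw [h6]
    field_simp
    ring

/-- For y > 0 the substitution v ↦ yv pulls out y^β; for y < 0 the integrand is the conjugate of the
one at -y. -/
theorem integral_compExp_mul_rpow (hβ1 : 1 < β) (y : ℝ) :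
    ∫ v in Ioi (0 : ℝ), compExp (y * v) * ((v ^ (-1 - β) : ℝ) : ℂ) = stableSymbol β 1 0 y := by
  have hpos : ∀ y : ℝ, 0 < y → ∫ v in Ioi (0 : ℝ), compExp (y * v) * ((v ^ (-1 - β) : ℝ) : ℂ)
      = ((y ^ β : ℝ) : ℂ) * stableConst β := by
    intro y hy
    have h := integral_comp_mul_left_Ioi
      (fun v : ℝ => compExp v * ((v ^ (-1 - β) : ℝ) : ℂ)) 0 hy
    rw [mul_zero] at h
    change _ = y⁻¹ • stableConst β at h
    have e : ∀ v ∈ Ioi (0 : ℝ), compExp (y * v) * ((v ^ (-1 - β) : ℝ) : ℂ)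
        = ((y ^ (1 + β) : ℝ) : ℂ) * (compExp (y * v) * (((y * v) ^ (-1 - β) : ℝ) : ℂ)) := by
      intro v hv
      have : y ^ (1 + β) * y ^ (-1 - β) = 1 := by
        rw [← Real.rpow_add hy]; ring_nf; simp
      rw [Real.mul_rpow hy.le (mem_Ioi.1 hv).le]
      push_cast
      have h' : ((y ^ (1 + β) : ℝ) : ℂ) * ((y ^ (-1 - β) : ℝ) : ℂ) = 1 := by exact_mod_cast this
      linear_combination (-(compExp (y * v) * ((v ^ (-1 - β) : ℝ) : ℂ))) * h'
    rw [setIntegral_congr_fun measurableSet_Ioi e, integral_const_mul, h, Complex.real_smul,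
      ← mul_assoc, ← Complex.ofReal_mul]
    congr 3
    rw [Real.rpow_add hy, Real.rpow_one]
    field_simp
  rcases lt_trichotomy y 0 with hy | rfl | hy
  · have h := hpos (-y) (by linarith)
    rw [stableSymbol, if_neg (not_le.2 hy), abs_of_neg hy]
    have e : ∀ v : ℝ, compExp (y * v) * ((v ^ (-1 - β) : ℝ) : ℂ)
        = (starRingEnd ℂ) (compExp (-y * v) * ((v ^ (-1 - β) : ℝ) : ℂ)) := fun v => by
      rw [map_mul, ← compExp_neg, Complex.conj_ofReal]; ring_nf
    simp_rw [e]
    rw [integral_conj, h, map_mul, Complex.conj_ofReal]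
    simp
  · simp [stableSymbol, Real.zero_rpow (by linarith : β ≠ 0)]
  · rw [hpos y hy, stableSymbol, if_pos hy.le, abs_of_pos hy]
    simp

theorem stableSymbol_combine (hβ : β ≠ 0) (z : ℝ) :
    (Kp : ℂ) * stableSymbol β 1 0 z + Km * stableSymbol β 1 0 (-z) = stableSymbol β Kp Km z := by
  simp only [stableSymbol, abs_neg]
  rcases lt_trichotomy z 0 with hz | rfl | hz
  · rw [if_neg (not_le.2 hz), if_neg (not_le.2 hz), if_pos (by linarith)]; push_cast; ring
  · simp [Real.zero_rpow hβ]
  · rw [if_pos hz.le, if_pos hz.le, if_neg (by linarith)]; push_cast; ring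

theorem continuous_stableSymbol (hβ : 0 < β) (Kp Km : ℝ) : Continuous (stableSymbol β Kp Km) := by
  have h : stableSymbol β Kp Km = fun z => if 0 ≤ z then
      ((|z| ^ β : ℝ) : ℂ) * (Kp * stableConst β + Km * (starRingEnd ℂ) (stableConst β))
      else ((|z| ^ β : ℝ) : ℂ) * (Kp * (starRingEnd ℂ) (stableConst β) + Km * stableConst β) := by
    funext z; rw [stableSymbol, mul_ite]
  have hc : Continuous fun z : ℝ => ((|z| ^ β : ℝ) : ℂ) :=
    Complex.continuous_ofReal.comp (continuous_abs.rpow_const fun _ => Or.inr hβ.le)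
  rw [h]
  refine Continuous.if_le (hc.mul continuous_const) (hc.mul continuous_const) continuous_const
    continuous_id fun z hz => ?_
  simp [← (show (0 : ℝ) = z from hz), Real.zero_rpow hβ.ne']

theorem stableSymbol_zero (hβ : β ≠ 0) (Kp Km : ℝ) : stableSymbol β Kp Km 0 = 0 := by
  simp [stableSymbol, Real.zero_rpow hβ]

theorem stableSymbol_smul (r : ℝ) (z : ℝ) :
    stableSymbol β (r * Kp) (r * Km) z = r * stableSymbol β Kp Km z := by
  simp only [stableSymbol]
  split_ifs <;> push_cast <;> ring

theorem stableSymbol_mul_left {r : ℝ} (hr : 0 < r) (z : ℝ) :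
    stableSymbol β Kp Km (r * z) = ((r ^ β : ℝ) : ℂ) * stableSymbol β Kp Km z := by
  simp only [stableSymbol, abs_mul, abs_of_pos hr, Real.mul_rpow hr.le (abs_nonneg z),
    mul_nonneg_iff_of_pos_left hr]
  push_cast; ring

end StableSymbol


/-! ### Exponents with full compensation -/

section Exponent

theorem min_abs_sq_nonneg (x : ℝ) : 0 ≤ min |x| (x ^ 2) := by positivity

theorem norm_compExp_mul_le_min (z x : ℝ) :
    ‖compExp (z * x)‖ ≤ 3 * max |z| (z ^ 2) * min |x| (x ^ 2) := by
  rcases le_total |x| (x ^ 2) with h | h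
  · rw [min_eq_left h, mul_assoc]
    refine (norm_compExp_le _).1.trans ?_
    rw [abs_mul]
    gcongr
    exact le_max_left _ _
  · rw [min_eq_right h, mul_assoc]
    refine (norm_compExp_le _).2.trans ?_
    rw [mul_pow]
    gcongr
    exact le_max_right _ _

theorem integrable_compExp_mul {ν : Measure ℝ}
    (hν : Integrable (fun x : ℝ => min |x| (x ^ 2)) ν) (z : ℝ) :
    Integrable (fun x => compExp (z * x)) ν :=
  (hν.const_mul (3 * max |z| (z ^ 2))).mono'
    (Continuous.aestronglyMeasurable (by fun_prop))
    (ae_of_all _ fun x => norm_compExp_mul_le_min z x)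

theorem integrableOn_id_one_lt_abs {ν : Measure ℝ}
    (hν : Integrable (fun x : ℝ => min |x| (x ^ 2)) ν) :
    IntegrableOn (fun x : ℝ => x) {x | 1 < |x|} ν := by
  have hm : MeasurableSet {x : ℝ | 1 < |x|} := measurableSet_lt measurable_const measurable_id.abs
  refine hν.integrableOn.mono' aestronglyMeasurable_id ?_
  refine (ae_restrict_iff' hm).2 (ae_of_all _ fun x hx => ?_)
  have hx' : 1 < |x| := hx
  rw [Real.norm_eq_abs, ← sq_abs]
  exact le_min le_rfl (by nlinarith)

/-- Compensating all jumps instead of those with |x| ≤ 1 moves the mean of the large jumps into the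
drift. Integrability of min(|x|, x²) allows this, and it covers both square-integrable Lévy measures
and stable ones of index in (1, 2). -/
theorem LevyTriplet.exponent_eq_compExponent (T : LevyTriplet) (hb : T.b = 0)
    (hν : Integrable (fun x : ℝ => min |x| (x ^ 2)) T.ν) (z : ℝ) :
    T.exponent z = Complex.I * ((T.γ + ∫ x in {x | 1 < |x|}, x ∂T.ν : ℝ) : ℂ) * z
      + compExponent T.ν z := by
  have hm : MeasurableSet {x : ℝ | 1 < |x|} := measurableSet_lt measurable_const measurable_id.abs
  have h1 : ∀ x : ℝ, Complex.exp (Complex.I * z * x) - 1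
        - (if |x| ≤ 1 then Complex.I * z * x else 0)
      = compExp (z * x) + (Complex.I * z) * ((({x : ℝ | 1 < |x|}.indicator (fun x => x) x : ℝ)) : ℂ) := by
    intro x
    by_cases hx : |x| ≤ 1
    · rw [if_pos hx, indicator_of_notMem (by simpa using hx)]
      simp [compExp]; ring_nf
    · rw [if_neg hx, indicator_of_mem (by simpa using hx)]
      simp [compExp]; ring_nf
  have hi := (integrable_indicator_iff hm).2 (integrableOn_id_one_lt_abs hν)
  rw [LevyTriplet.exponent]
  simp_rw [h1]
  have hi' : Integrable (fun x => (Complex.I * z) *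
      ((({x : ℝ | 1 < |x|}.indicator (fun x => x) x : ℝ)) : ℂ)) T.ν := hi.ofReal.const_mul _
  rw [integral_add (integrable_compExp_mul hν z) hi', integral_const_mul,
    integral_complex_ofReal, integral_indicator hm, hb, compExponent]
  push_cast
  ring

end Exponent

/-! ### The stable Lévy measure and its triplet -/

section StableMeasure

variable {β Kp Km : ℝ} {E : Type*} [NormedAddCommGroup E] [NormedSpace ℝ E]

/-- Unfolds the density into two Lebesgue integrals over (0, ∞), the negative half-line being
reflected; all integrals against the stable measure go through this. -/
theorem integrable_stableLevyMeasure (hKp : 0 ≤ Kp) (hKm : 0 ≤ Km) {f : ℝ → E}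
    (hp : IntegrableOn (fun v : ℝ => v ^ (-1 - β) • f v) (Ioi 0))
    (hm : IntegrableOn (fun v : ℝ => v ^ (-1 - β) • f (-v)) (Ioi 0)) :
    Integrable f (stableLevyMeasure β Kp Km) ∧
      ∫ x, f x ∂stableLevyMeasure β Kp Km = Kp • (∫ v in Ioi (0 : ℝ), v ^ (-1 - β) • f v)
        + Km • ∫ v in Ioi (0 : ℝ), v ^ (-1 - β) • f (-v) := by
  set d : ℝ → ℝ := fun x =>
    if 0 < x then Kp * |x| ^ (-1 - β) else if x < 0 then Km * |x| ^ (-1 - β) else 0 with hd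
  have hdm : Measurable d :=
    Measurable.ite measurableSet_Ioi (by fun_prop)
      (Measurable.ite measurableSet_Iio (by fun_prop) measurable_const)
  have hd0 : ∀ x, 0 ≤ d x := fun x => by simp only [hd]; split_ifs <;> positivity
  have hdm' : Measurable fun x => ENNReal.ofReal (d x) := hdm.ennreal_ofReal
  have hfin : ∀ᵐ x : ℝ, ENNReal.ofReal (d x) < ∞ := ae_of_all _ fun x => ENNReal.ofReal_lt_top
  have hsl : stableLevyMeasure β Kp Km = volume.withDensity fun x => ENNReal.ofReal (d x) := rfl
  have ht : ∀ x, (ENNReal.ofReal (d x)).toReal = d x := fun x => ENNReal.toReal_ofReal (hd0 x)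
  have e1 : EqOn (fun v : ℝ => Kp • v ^ (-1 - β) • f v) (fun v => d v • f v) (Ioi 0) := by
    intro v hv
    have hv' : 0 < v := hv
    simp only [hd, if_pos hv', abs_of_pos hv', smul_smul]
  have e2 : EqOn (fun v : ℝ => Km • v ^ (-1 - β) • f (-v)) (fun v => d (-v) • f (-v)) (Ioi 0) := by
    intro v hv
    have hv' : 0 < v := hv
    have h1 : ¬ 0 < -v := by linarith
    have h2 : -v < 0 := by linarith
    simp only [hd, if_neg h1, if_pos h2, abs_neg, abs_of_pos hv', smul_smul]
  have i1 : IntegrableOn (fun v => d v • f v) (Ioi 0) :=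
    IntegrableOn.congr_fun (hp.smul Kp) e1 measurableSet_Ioi
  have i2' : IntegrableOn (fun v => d (-v) • f (-v)) (Ioi 0) :=
    IntegrableOn.congr_fun (hm.smul Km) e2 measurableSet_Ioi
  have i2 : IntegrableOn (fun v => d v • f v) (Iio 0) := by
    have := (Measure.measurePreserving_neg (volume : Measure ℝ)).integrableOn_comp_preimage
      (MeasurableEquiv.neg ℝ).measurableEmbedding (f := fun v => d v • f v) (s := Iio 0)
    rw [← this]
    simpa [Function.comp_def] using i2'
  have i2c : IntegrableOn (fun v => d v • f v) (Iic 0) := by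
    rwa [integrableOn_Iic_iff_integrableOn_Iio]
  have i3 : Integrable (fun v => d v • f v) := by
    rw [← integrableOn_univ, ← Iic_union_Ioi (a := (0 : ℝ))]
    exact i2c.union i1
  constructor
  · rw [hsl, integrable_withDensity_iff_integrable_smul' hdm' hfin]
    simpa only [ht] using i3
  · rw [hsl, integral_withDensity_eq_integral_toReal_smul hdm' hfin]
    simp only [ht]
    rw [← intervalIntegral.integral_Iic_add_Ioi i2c i1, ← integral_smul, ← integral_smul,
      setIntegral_congr_fun measurableSet_Ioi e1, setIntegral_congr_fun measurableSet_Ioi e2,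
      integral_comp_neg_Ioi 0 (fun v => d v • f v), neg_zero, add_comm]

theorem integrableOn_rpow_mul_min (hβ1 : 1 < β) (hβ2 : β < 2) :
    IntegrableOn (fun v : ℝ => v ^ (-1 - β) • min |v| (v ^ 2)) (Ioi 0) := by
  refine integrableOn_Ioi_of_norm_le_rpow (a := 1 - β) (b := -β) (C := 1)
    (Measurable.aestronglyMeasurable (by fun_prop)) (by linarith) (by linarith) ?_ ?_
  · intro w hw _
    have e : w ^ (1 - β) = w ^ (-1 - β) * w ^ 2 := by
      rw [← Real.rpow_natCast, ← Real.rpow_add hw]; norm_num; ring_nf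
    rw [smul_eq_mul, Real.norm_of_nonneg (by positivity), e, one_mul]
    gcongr
    exact min_le_right _ _
  · intro w hw
    have hw0 : 0 < w := one_pos.trans hw
    have e : w ^ (-β) = w ^ (-1 - β) * |w| := by
      rw [abs_of_pos hw0, mul_comm, ← Real.rpow_one_add' hw0.le (by linarith)]; ring_nf
    rw [smul_eq_mul, Real.norm_of_nonneg (by positivity), e, one_mul]
    gcongr
    exact min_le_left _ _

theorem integrable_min_stableLevyMeasure (hβ1 : 1 < β) (hβ2 : β < 2) (hKp : 0 ≤ Kp)
    (hKm : 0 ≤ Km) : Integrable (fun x : ℝ => min |x| (x ^ 2)) (stableLevyMeasure β Kp Km) :=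
  (integrable_stableLevyMeasure hKp hKm (integrableOn_rpow_mul_min hβ1 hβ2)
    (by simpa using integrableOn_rpow_mul_min hβ1 hβ2)).1

theorem compExponent_stableLevyMeasure (hβ1 : 1 < β) (hβ2 : β < 2) (hKp : 0 ≤ Kp)
    (hKm : 0 ≤ Km) (z : ℝ) :
    compExponent (stableLevyMeasure β Kp Km) z = stableSymbol β Kp Km z := by
  have e : ∀ (y v : ℝ), v ^ (-1 - β) • compExp (y * v)
      = compExp (y * v) * ((v ^ (-1 - β) : ℝ) : ℂ) := fun y v => by
    rw [Complex.real_smul, mul_comm]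
  have h := (integrable_stableLevyMeasure (β := β) (f := fun x => compExp (z * x)) hKp hKm
    (by simpa only [e] using integrableOn_compExp_mul_rpow hβ1 hβ2 z)
    (by simpa only [mul_neg, ← neg_mul, e] using integrableOn_compExp_mul_rpow hβ1 hβ2 (-z))).2
  rw [compExponent, h]
  simp only [mul_neg, ← neg_mul, e]
  rw [integral_compExp_mul_rpow hβ1, integral_compExp_mul_rpow hβ1, Complex.real_smul,
    Complex.real_smul, stableSymbol_combine (by linarith)]

theorem integral_id_stableLevyMeasure (hβ1 : 1 < β) (hKp : 0 ≤ Kp) (hKm : 0 ≤ Km) :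
    ∫ x in {x | 1 < |x|}, x ∂stableLevyMeasure β Kp Km = (Kp - Km) / (β - 1) := by
  have hm : MeasurableSet {x : ℝ | 1 < |x|} := measurableSet_lt measurable_const measurable_id.abs
  have e1 : ∀ v ∈ Ioi (0 : ℝ), v ^ (-1 - β) • {x : ℝ | 1 < |x|}.indicator (fun x => x) v
      = (Ioi (1 : ℝ)).indicator (fun v => v ^ (-β)) v := by
    intro v hv
    have hv' : 0 < v := hv
    by_cases h : 1 < v
    · rw [indicator_of_mem (by simpa [abs_of_pos hv'] using h), indicator_of_mem (mem_Ioi.2 h), smul_eq_mul,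
        mul_comm, ← Real.rpow_one_add' hv'.le (by linarith)]
      ring_nf
    · rw [indicator_of_notMem (by simpa [abs_of_pos hv'] using h),
        indicator_of_notMem (notMem_Ioi.2 (not_lt.1 h)), smul_zero]
  have e2 : ∀ v ∈ Ioi (0 : ℝ), v ^ (-1 - β) • {x : ℝ | 1 < |x|}.indicator (fun x => x) (-v)
      = -(Ioi (1 : ℝ)).indicator (fun v => v ^ (-β)) v := by
    intro v hv
    rw [← e1 v hv]
    by_cases h : 1 < |v|
    · rw [indicator_of_mem (by simpa using h), indicator_of_mem (by simpa using h)]; simp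
    · rw [indicator_of_notMem (by simpa using h), indicator_of_notMem (by simpa using h)]; simp
  have hint : IntegrableOn ((Ioi (1 : ℝ)).indicator (fun v : ℝ => v ^ (-β))) (Ioi 0) :=
    ((integrable_indicator_iff measurableSet_Ioi).2
      (integrableOn_Ioi_rpow_of_lt (by linarith) one_pos)).integrableOn
  have hval : ∫ v in Ioi (0 : ℝ), (Ioi (1 : ℝ)).indicator (fun v : ℝ => v ^ (-β)) v
      = 1 / (β - 1) := by
    rw [setIntegral_indicator measurableSet_Ioi, inter_eq_right.2 (Ioi_subset_Ioi zero_le_one),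
      integral_Ioi_rpow_of_lt (by linarith) one_pos, Real.one_rpow,
      show -β + 1 = -(β - 1) by ring, neg_div_neg_eq]
  rw [← integral_indicator hm, (integrable_stableLevyMeasure hKp hKm
    (hint.congr_fun (fun v hv => (e1 v hv).symm) measurableSet_Ioi)
    (hint.neg.congr_fun (fun v hv => (e2 v hv).symm) measurableSet_Ioi)).2,
    setIntegral_congr_fun measurableSet_Ioi e1, setIntegral_congr_fun measurableSet_Ioi e2,
    integral_neg, hval]
  simp only [smul_eq_mul]
  ring

/-- The triplet of the strictly stable law of index `1 < β < 2`. -/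
noncomputable def stableTriplet (hβ1 : 1 < β) (hβ2 : β < 2) (hKp : 0 ≤ Kp) (hKm : 0 ≤ Km) :
    LevyTriplet where
  γ := (Kp - Km) / (1 - β)
  b := 0
  b_nonneg := le_rfl
  ν := stableLevyMeasure β Kp Km
  ν_zero := by
    rw [stableLevyMeasure, withDensity_apply _ (measurableSet_singleton _)]
    simp
  ν_finite := by
    refine lt_of_le_of_lt (lintegral_mono fun x => ENNReal.ofReal_le_ofReal ?_)
      (hasFiniteIntegral_iff_ofReal (ae_of_all _ fun x => min_abs_sq_nonneg x) |>.1
        (integrable_min_stableLevyMeasure hβ1 hβ2 hKp hKm).2)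
    rcases le_total |x| 1 with h | h
    · have : x ^ 2 ≤ |x| := by rw [← sq_abs]; nlinarith [abs_nonneg x]
      rw [min_eq_right this]; exact min_le_right _ _
    · have : |x| ≤ x ^ 2 := by rw [← sq_abs]; nlinarith [abs_nonneg x]
      rw [min_eq_left this]; exact (min_le_left _ _).trans h

/-- Strictness amounts to centring here: the drift (K₊ - K₋)/(1 - β) cancels the mean (K₊ - K₋)/(β -
1) of the jumps larger than 1. -/
theorem stableTriplet_exponent (hβ1 : 1 < β) (hβ2 : β < 2) (hKp : 0 ≤ Kp) (hKm : 0 ≤ Km) (z : ℝ) :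
    (stableTriplet hβ1 hβ2 hKp hKm).exponent z = stableSymbol β Kp Km z := by
  have h1 : 1 - β ≠ 0 := by linarith
  have h2 : β - 1 ≠ 0 := by linarith
  rw [LevyTriplet.exponent_eq_compExponent _ rfl
    (integrable_min_stableLevyMeasure hβ1 hβ2 hKp hKm)]
  change Complex.I * (((Kp - Km) / (1 - β) + ∫ x in {x | 1 < |x|}, x ∂stableLevyMeasure β Kp Km : ℝ) : ℂ) * z
    + compExponent (stableLevyMeasure β Kp Km) z = _
  rw [integral_id_stableLevyMeasure hβ1 hKp hKm, compExponent_stableLevyMeasure hβ1 hβ2 hKp hKm,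
    show (Kp - Km) / (1 - β) + (Kp - Km) / (β - 1) = 0 by
      rw [show 1 - β = -(β - 1) by ring, div_neg, neg_add_cancel]]
  simp

theorem isStrictlyStableLaw_of_charFun (hβ1 : 1 < β) (hβ2 : β < 2) (hKp : 0 ≤ Kp) (hKm : 0 ≤ Km)
    (hK : 0 < Kp + Km) {μ : Measure ℝ} [IsProbabilityMeasure μ]
    (hμ : ∀ z, charFun μ z = Complex.exp (stableSymbol β Kp Km z)) :
    IsStrictlyStableLaw β Kp Km ((Kp - Km) / (1 - β)) μ ∧
      ∀ z, charFun μ z = Complex.exp (stableExponent β Kp Km ((Kp - Km) / (1 - β)) z) := by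
  refine ⟨⟨by linarith, hβ2, hKp, hKm, hK, fun _ => rfl, fun h => absurd h hβ1.ne',
    stableTriplet hβ1 hβ2 hKp hKm, rfl, rfl, rfl, inferInstance, fun z => ?_⟩, fun z => ?_⟩
  · rw [hμ, stableTriplet_exponent]
  · rw [hμ, stableSymbol_eq_stableExponent hβ1 hβ2 hK]

end StableMeasure


/-! ### Second moments: from the seed to ν, and means from exponents -/

section SecondMoment

/-- The constant is π²/2 rounded up, from cos y ≤ 1 - 2y²/π² and π² ≤ 10. -/
theorem sq_le_five_mul_one_sub_cos {y : ℝ} (hy : |y| ≤ 1) : y ^ 2 ≤ 5 * (1 - Real.cos y) := by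
  have h := Real.cos_le_one_sub_mul_cos_sq (hy.trans (by linarith [Real.pi_gt_three]))
  have hp : Real.pi ^ 2 ≤ 10 := by nlinarith [Real.pi_lt_d2, Real.pi_pos]
  have h2 : 1 / 5 ≤ 2 / Real.pi ^ 2 := by
    rw [div_le_div_iff₀ (by norm_num) (by positivity)]; linarith
  nlinarith [sq_nonneg y]

/-- Fatou's lemma along z = z₀/(n+1): for each x, eventually 5(1 - cos(zx))/z² ≥ x², while its
integral stays below 5M. -/
theorem integrable_sq_of_one_sub_cos_le {ρ : Measure ℝ} {M z₀ : ℝ} (hz₀ : 0 < z₀)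
    (h : ∀ z : ℝ, 0 < z → z ≤ z₀ →
      ∫⁻ x, ENNReal.ofReal (1 - Real.cos (z * x)) ∂ρ ≤ ENNReal.ofReal (M * z ^ 2)) :
    Integrable (fun x : ℝ => x ^ 2) ρ := by
  set s : ℕ → ℝ := fun n => z₀ / ((n : ℝ) + 1) with hs
  have hs0 : ∀ n, 0 < s n := fun n => by simp only [hs]; positivity
  have hs1 : ∀ n, s n ≤ z₀ := fun n =>
    div_le_self hz₀.le (by linarith [(n.cast_nonneg : (0 : ℝ) ≤ n)])
  have hsl : Tendsto s atTop (𝓝 0) := by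
    simpa [hs, div_eq_mul_one_div z₀] using
      (tendsto_one_div_add_atTop_nhds_zero_nat (𝕜 := ℝ)).const_mul z₀
  refine ⟨Continuous.aestronglyMeasurable (by fun_prop), ?_⟩
  rw [hasFiniteIntegral_iff_ofReal (ae_of_all _ fun x => sq_nonneg x)]
  set f : ℕ → ℝ → ℝ≥0∞ := fun n x =>
    ENNReal.ofReal (5 / s n ^ 2) * ENNReal.ofReal (1 - Real.cos (s n * x)) with hf
  have hfm : ∀ n, Measurable (f n) := fun n => by fun_prop
  have hle : ∀ x, ENNReal.ofReal (x ^ 2) ≤ liminf (fun n => f n x) atTop := by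
    intro x
    refine le_liminf_of_le (by isBoundedDefault) ?_
    have h1 : Tendsto (fun n => |s n * x|) atTop (𝓝 0) := by
      simpa using (hsl.mul_const x).abs
    filter_upwards [h1.eventually (ge_mem_nhds one_pos)] with n hn
    have h2 := sq_le_five_mul_one_sub_cos hn
    simp only [hf]
    rw [← ENNReal.ofReal_mul (by positivity)]
    refine ENNReal.ofReal_le_ofReal ?_
    rw [div_mul_eq_mul_div, le_div_iff₀ (by have := hs0 n; positivity)]
    linarith [mul_pow (s n) x 2]
  refine lt_of_le_of_lt (lintegral_mono hle) (lt_of_le_of_lt (lintegral_liminf_le hfm) ?_)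
  refine lt_of_le_of_lt (liminf_le_of_frequently_le' (x := ENNReal.ofReal (5 * M))
    (Eventually.of_forall fun n => ?_).frequently) ENNReal.ofReal_lt_top
  simp only [hf]
  rw [lintegral_const_mul _ (by fun_prop)]
  refine (mul_le_mul_right (h _ (hs0 n) (hs1 n)) _).trans ?_
  have := hs0 n
  rw [← ENNReal.ofReal_mul (by positivity)]
  refine ENNReal.ofReal_le_ofReal (le_of_eq ?_)
  field_simp

theorem integral_one_sub_cos_eq {μ : Measure ℝ} [IsProbabilityMeasure μ] (z : ℝ) :
    ∫ x, (1 - Real.cos (z * x)) ∂μ = 1 - (charFun μ z).re := by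
  have hi : Integrable (fun x : ℝ => Complex.exp (z * x * Complex.I)) μ := by
    refine Integrable.of_bound (C := 1) (Continuous.aestronglyMeasurable (by fun_prop))
      (ae_of_all _ fun x => ?_)
    rw [← Complex.ofReal_mul, Complex.norm_exp_ofReal_mul_I]
  have hre : ∀ x : ℝ, (Complex.exp (z * x * Complex.I)).re = Real.cos (z * x) := fun x => by
    rw [← Complex.ofReal_mul, Complex.exp_ofReal_mul_I_re]
  have h2 : ∫ x, Real.cos (z * x) ∂μ = (charFun μ z).re := by
    rw [charFun_apply_real, ← Complex.reCLM_apply, ← Complex.reCLM.integral_comp_comm hi]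
    simp only [Complex.reCLM_apply, hre]
  have h3 : Integrable (fun x => Real.cos (z * x)) μ := by
    simpa only [RCLike.re_to_complex, hre] using hi.re
  rw [integral_sub (integrable_const _) h3, h2]
  simp

theorem integrable_one_sub_cos {ρ : Measure ℝ}
    (h : Integrable (fun x : ℝ => min 1 (x ^ 2)) ρ) (z : ℝ) :
    Integrable (fun x => 1 - Real.cos (z * x)) ρ := by
  refine (h.const_mul (2 + z ^ 2)).mono' (Continuous.aestronglyMeasurable (by fun_prop))
    (ae_of_all _ fun x => ?_)
  have h1 := Real.cos_le_one (z * x)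
  have h2 := Real.neg_one_le_cos (z * x)
  have h3 := Real.one_sub_sq_div_two_le_cos (x := z * x)
  rw [Real.norm_of_nonneg (by linarith)]
  rcases le_total 1 (x ^ 2) with h' | h'
  · rw [min_eq_left h']; nlinarith [sq_nonneg z]
  · rw [min_eq_right h']; nlinarith [sq_nonneg x, mul_pow z x 2]

theorem LevyTriplet.integrable_min_one_sq (T : LevyTriplet) :
    Integrable (fun x : ℝ => min 1 (x ^ 2)) T.ν :=
  ⟨Continuous.aestronglyMeasurable (by fun_prop), by
    rw [hasFiniteIntegral_iff_ofReal (ae_of_all _ fun x => by positivity)]; exact T.ν_finite⟩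

/-- Real parts discard the drift and the compensator and leave an integral of a nonnegative
function, to which the second-moment criterion applies. -/
theorem LevyTriplet.exponent_re (T : LevyTriplet) (hb : T.b = 0) (z : ℝ) :
    (T.exponent z).re = -∫ x, (1 - Real.cos (z * x)) ∂T.ν := by
  set g : ℝ → ℂ := fun x => Complex.exp (Complex.I * z * x) - 1
        - (if |x| ≤ 1 then Complex.I * z * x else 0) with hg
  have hgm : Measurable g := by
    refine Measurable.sub (by fun_prop) (Measurable.ite ?_ (by fun_prop) measurable_const)
    exact measurableSet_le measurable_id.abs measurable_const
  have hint : Integrable g T.ν := by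
    refine (T.integrable_min_one_sq.const_mul (2 + 3 * z ^ 2)).mono' hgm.aestronglyMeasurable
      (ae_of_all _ fun x => ?_)
    by_cases hx : |x| ≤ 1
    · have hx2 : x ^ 2 ≤ 1 := by rw [← sq_abs]; nlinarith [abs_nonneg x]
      have : g x = compExp (z * x) := by
        simp only [hg, if_pos hx, compExp]; push_cast; ring_nf
      rw [this, min_eq_right hx2]
      refine (norm_compExp_le _).2.trans ?_
      nlinarith [sq_nonneg x, mul_pow z x 2]
    · have hx2 : 1 ≤ x ^ 2 := by rw [← sq_abs]; nlinarith [abs_nonneg x]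
      have h2 : ‖g x‖ ≤ 2 := by
        simp only [hg, if_neg hx, sub_zero]
        refine (norm_sub_le _ _).trans ?_
        rw [show Complex.I * z * x = ((z * x : ℝ) : ℂ) * Complex.I by push_cast; ring,
          Complex.norm_exp_ofReal_mul_I, norm_one]
        norm_num
      rw [min_eq_left hx2]
      nlinarith [sq_nonneg z]
  have hre : ∀ x, (g x).re = -(1 - Real.cos (z * x)) := by
    intro x
    have h1 : (Complex.exp (Complex.I * z * x)).re = Real.cos (z * x) := by
      rw [show Complex.I * z * x = ((z * x : ℝ) : ℂ) * Complex.I by push_cast; ring,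
        Complex.exp_ofReal_mul_I_re]
    simp only [hg, Complex.sub_re, h1, Complex.one_re]
    split_ifs <;> simp
  have hI : (∫ x, g x ∂T.ν).re = -∫ x, (1 - Real.cos (z * x)) ∂T.ν := by
    rw [← Complex.reCLM_apply, ← Complex.reCLM.integral_comp_comm hint, ← integral_neg]
    simp only [Complex.reCLM_apply, hre]
  rw [LevyTriplet.exponent, hb]
  change (Complex.I * T.γ * z - ((0 : ℝ) : ℂ) ^ 2 * (z : ℂ) ^ 2 / 2 + ∫ x, g x ∂T.ν).re = _
  rw [Complex.add_re, hI]
  simp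

/-- The modulus of the characteristic function of the seed is exp(-J(z)) with J(z) = ∫ (1 - cos zx)
dν. The second moment M of the seed keeps this modulus above 1 - Mz²/2, which forces J(z) ≤ Mz² for
small z. -/
theorem LevyTriplet.SquareIntegrableSeed.integrable_sq {T : LevyTriplet}
    (h : T.SquareIntegrableSeed) (hb : T.b = 0) : Integrable (fun x : ℝ => x ^ 2) T.ν := by
  obtain ⟨μ, ⟨hμp, hμ⟩, hμ2⟩ := h
  have hsq : Integrable (fun x : ℝ => x ^ 2) μ := hμ2.integrable_sq
  set M : ℝ := ∫ x, x ^ 2 ∂μ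
  have hM : 0 ≤ M := integral_nonneg fun x => sq_nonneg x
  -- For z ≤ 1/(1+M) both z and zM are at most 1, so u = z²M ≤ 1.
  refine integrable_sq_of_one_sub_cos_le (M := M) (z₀ := 1 / (1 + M)) (by positivity)
    fun z hz hz' => ?_
  have hi := integrable_one_sub_cos T.integrable_min_one_sq z
  rw [← ofReal_integral_eq_lintegral_ofReal hi
    (ae_of_all _ fun x => by simpa using Real.cos_le_one (z * x))]
  refine ENNReal.ofReal_le_ofReal ?_
  set J := ∫ x, (1 - Real.cos (z * x)) ∂T.ν with hJ
  have h1 : Real.exp (-J) = ‖charFun μ z‖ := by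
    rw [hμ, Complex.norm_exp, T.exponent_re hb]
  have h2 : 1 - (charFun μ z).re ≤ z ^ 2 * M / 2 := by
    rw [← integral_one_sub_cos_eq, show z ^ 2 * M / 2 = ∫ x, (z ^ 2 / 2) * x ^ 2 ∂μ by
      rw [integral_const_mul]; ring]
    refine integral_mono_of_nonneg (ae_of_all _ fun x => by simpa using Real.cos_le_one (z * x))
      (hsq.const_mul _) (ae_of_all _ fun x => ?_)
    have := Real.one_sub_sq_div_two_le_cos (x := z * x)
    simp only
    linarith [mul_pow z x 2]
  have h3 := Complex.re_le_norm (charFun μ z)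
  set u := z ^ 2 * M
  have hu0 : 0 ≤ u := by positivity
  have hu1 : u ≤ 1 := by
    have h4 : z * (1 + M) ≤ 1 := by rwa [le_div_iff₀ (by positivity)] at hz'
    have h5 : z * M ≤ 1 := by nlinarith
    have h6 : z ≤ 1 := by nlinarith
    calc u = z * (z * M) := by ring
      _ ≤ 1 * 1 := by gcongr
      _ = 1 := one_mul 1
  -- On [0, 1], e^{-u} ≤ 1 - u/2; this converts the lower bound 1 - u/2 for e^{-J} into J ≤ u.
  have h7 : Real.exp (-u) ≤ 1 - u / 2 := by
    have h := Real.add_one_le_exp u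
    have h' : 1 - u + u ^ 2 / 2 ≤ 1 - u / 2 := by nlinarith
    rw [Real.exp_neg, inv_le_comm₀ (Real.exp_pos _) (by linarith)]
    have : (1 - u / 2)⁻¹ ≤ 1 + u := by
      rw [inv_le_comm₀ (by linarith) (by linarith), inv_le_iff_one_le_mul₀ (by linarith)]
      nlinarith
    linarith
  have h8 : Real.exp (-u) ≤ Real.exp (-J) := by linarith
  have h9 := Real.exp_le_exp.1 h8
  calc J ≤ u := by linarith
    _ = M * z ^ 2 := mul_comm _ _

theorem integrable_min_abs_sq {ν : Measure ℝ} (h : Integrable (fun x : ℝ => x ^ 2) ν) :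
    Integrable (fun x : ℝ => min |x| (x ^ 2)) ν :=
  h.mono' (Continuous.aestronglyMeasurable (by fun_prop)) (ae_of_all _ fun x => by
    rw [Real.norm_of_nonneg (min_abs_sq_nonneg x)]; exact min_le_right _ _)

theorem norm_compExponent_le_sq {ν : Measure ℝ} (h : Integrable (fun x : ℝ => x ^ 2) ν) (z : ℝ) :
    ‖compExponent ν z‖ ≤ 3 * (∫ x, x ^ 2 ∂ν) * z ^ 2 := by
  rw [compExponent, show 3 * (∫ x, x ^ 2 ∂ν) * z ^ 2 = ∫ x, (3 * z ^ 2) * x ^ 2 ∂ν by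
    rw [integral_const_mul]; ring]
  refine norm_integral_le_of_norm_le (h.const_mul _) (ae_of_all _ fun x => ?_)
  have := (norm_compExp_le (z * x)).2
  rwa [mul_pow, ← mul_assoc] at this

theorem continuous_compExponent {ν : Measure ℝ} (h : Integrable (fun x : ℝ => x ^ 2) ν) :
    Continuous (compExponent ν) := by
  rw [continuous_iff_continuousAt]
  intro z₀
  refine continuousAt_of_dominated (bound := fun x => 3 * (|z₀| + 1) ^ 2 * x ^ 2)
    (Eventually.of_forall fun z => Continuous.aestronglyMeasurable (by fun_prop)) ?_
    (h.const_mul _) (ae_of_all _ fun x => Continuous.continuousAt (by fun_prop))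
  filter_upwards [Metric.ball_mem_nhds z₀ one_pos] with z hz
  refine ae_of_all _ fun x => ?_
  have := (norm_compExp_le (z * x)).2
  refine this.trans ?_
  rw [mul_pow, ← mul_assoc]
  have h1 : |z| ≤ |z₀| + 1 := by
    have := abs_sub_abs_le_abs_sub z z₀
    rw [Metric.mem_ball, Real.dist_eq] at hz
    linarith
  rw [← sq_abs z]
  gcongr

@[simp] theorem compExponent_zero (ν : Measure ℝ) : compExponent ν 0 = 0 := by
  simp [compExponent]

/-- A law with characteristic function `exp (v (imz + ψ(z)))`, where `ψ(z) = O(z²)`, has finite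
second moment and mean `vm`. -/
theorem integrable_sq_of_charFun_eq {μ : Measure ℝ} [IsProbabilityMeasure μ] {v m C : ℝ}
    {ψ : ℝ → ℂ} (hv : 0 ≤ v) (hψ : ∀ z, ‖ψ z‖ ≤ C * z ^ 2)
    (hμ : ∀ z : ℝ, charFun μ z = Complex.exp (v * (Complex.I * m * z + ψ z))) :
    Integrable (fun x : ℝ => x ^ 2) μ ∧ ∫ x, x ∂μ = v * m := by
  have hC : 0 ≤ C := by simpa using (norm_nonneg (ψ 1)).trans (hψ 1)
  have hnorm1 : ∀ z, ‖charFun μ z‖ ≤ 1 := fun z => norm_charFun_le_one _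
  have hsq : Integrable (fun x : ℝ => x ^ 2) μ := by
    -- Write the exponent as w. The first term of M bounds the remainder 3|w|², since |w| ≤ v(|m| +
    -- C)z for z ≤ 1. The second bounds -Re w, to which the drift does not contribute.
    refine integrable_sq_of_one_sub_cos_le
      (M := 3 * (v * (|m| + C)) ^ 2 + v * C) (z₀ := 1) one_pos fun z hz hz' => ?_
    rw [← ofReal_integral_eq_lintegral_ofReal
      (integrable_one_sub_cos (Integrable.of_bound (C := 1)
        (Continuous.aestronglyMeasurable (by fun_prop)) (ae_of_all _ fun x => by
          rw [Real.norm_of_nonneg (by positivity)]; exact min_le_left _ _)) z)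
      (ae_of_all _ fun x => by simpa using Real.cos_le_one (z * x)), integral_one_sub_cos_eq]
    refine ENNReal.ofReal_le_ofReal ?_
    have h1 := hnorm1 z
    rw [hμ] at h1 ⊢
    set w : ℂ := v * (Complex.I * m * z + ψ z) with hw
    have hwre : w.re ≤ 0 := by rwa [Complex.norm_exp, Real.exp_le_one_iff] at h1
    have h2 := (norm_exp_neg_sub_one_add_le (z := -w) (by simpa using hwre)).2
    rw [neg_neg, norm_neg] at h2
    have hwn : ‖w‖ ≤ v * (|m| + C) * z := by
      rw [hw, norm_mul, Complex.norm_real, Real.norm_of_nonneg hv, mul_assoc v]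
      refine mul_le_mul_of_nonneg_left ?_ hv
      refine (norm_add_le _ _).trans ?_
      rw [norm_mul, norm_mul, Complex.norm_I, Complex.norm_real, Complex.norm_real, one_mul,
        Real.norm_eq_abs, Real.norm_of_nonneg hz.le]
      nlinarith [hψ z, mul_nonneg hC (mul_nonneg hz.le (sub_nonneg.2 hz'))]
    have hre : -w.re ≤ v * (C * z ^ 2) := by
      have : w.re = v * (ψ z).re := by simp [hw]
      rw [this, ← mul_neg]
      gcongr
      exact (neg_le_abs _).trans ((Complex.abs_re_le_norm (ψ z)).trans (hψ z))
    have h3 : 1 - (Complex.exp w).re + w.re ≤ 3 * ‖w‖ ^ 2 := by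
      refine le_trans ?_ h2
      refine le_trans (le_of_eq ?_) ((Complex.re_le_norm _).trans_eq (norm_neg _))
      simp only [Complex.neg_re, Complex.add_re, Complex.sub_re, Complex.one_re]
      ring
    have h4 : ‖w‖ ^ 2 ≤ (v * (|m| + C) * z) ^ 2 := by gcongr
    nlinarith
  refine ⟨hsq, ?_⟩
  have hmem : MemLp id 2 μ := (memLp_two_iff_integrable_sq aestronglyMeasurable_id).2 hsq
  have hmem1 : MemLp id ((1 : ℕ) : ℝ≥0∞) μ := by
    rw [Nat.cast_one]; exact hmem.mono_exponent (by norm_num)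
  -- The mean is read off the derivative of the characteristic function at 0, where ψ = O(z²)
  -- contributes nothing.
  have hd := iteratedDeriv_charFun_zero hmem1
  rw [iteratedDeriv_one] at hd
  have hψ0 : HasDerivAt ψ 0 0 := by
    rw [hasDerivAt_iff_isLittleO]
    have h0 : ψ 0 = 0 := norm_le_zero_iff.1 (by simpa using hψ 0)
    simp only [h0, sub_zero, smul_zero]
    have hO : ψ =O[𝓝 0] fun z : ℝ => z ^ 2 :=
      Asymptotics.IsBigO.of_bound C (Eventually.of_forall fun z => by
        rw [Real.norm_of_nonneg (sq_nonneg z)]; exact hψ z)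
    refine hO.trans_isLittleO ?_
    simpa using Asymptotics.isLittleO_pow_pow (𝕜 := ℝ) (m := 1) (n := 2) one_lt_two
  have hd2 : HasDerivAt (charFun μ) (v * (Complex.I * m)) 0 := by
    have h0 : ψ 0 = 0 := norm_le_zero_iff.1 (by simpa using hψ 0)
    have e : charFun μ = fun z : ℝ => Complex.exp (v * (Complex.I * m * z + ψ z)) := funext hμ
    rw [e]
    have h1 : HasDerivAt (fun z : ℝ => (Complex.I * m : ℂ) * z) (Complex.I * m * 1) 0 :=
      (Complex.ofRealCLM.hasDerivAt (x := 0)).const_mul _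
    have h2 := ((h1.fun_add hψ0).const_mul (v : ℂ)).cexp
    simpa [h0] using h2
  rw [hd2.deriv, pow_one] at hd
  have hd3 : Complex.I * ((v * m : ℝ) : ℂ) = Complex.I * ((∫ x, x ∂μ : ℝ) : ℂ) := by
    push_cast
    simp only [pow_one] at hd
    rw [← hd]; ring
  exact (Complex.ofReal_injective (mul_left_cancel₀ Complex.I_ne_zero hd3)).symm

end SecondMoment


/-! ### Lévy bases on finitely many overlapping sets -/

namespace IsHomogeneousLevyBasis

variable {Ω : Type*} [MeasurableSpace Ω] {P : Measure Ω} {L : Set (ℝ × ℝ) → Ω → ℝ}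
  {T : LevyTriplet}

/-- For the constant sequence of empty sets, consecutive partial sums differ by L ∅ and yet
converge. -/
theorem empty (hL : IsHomogeneousLevyBasis P L T) : ∀ᵐ ω ∂P, L ∅ ω = 0 := by
  have h := hL.sigmaAdditive (fun _ => ∅) (fun _ => MeasurableSet.empty) (by simp)
    (fun _ _ _ => disjoint_bot_left)
  filter_upwards [h] with ω hω
  simp only [iUnion_empty] at hω
  have h1 := (tendsto_add_atTop_iff_nat 1).2 hω
  have h2 := h1.sub hω
  simp only [Finset.sum_range_succ, add_sub_cancel_left, sub_self] at h2
  exact tendsto_nhds_unique tendsto_const_nhds h2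

/-- Extension of a finite family of sets by the empty set. -/
noncomputable def padSet {ι : Type*} [Fintype ι] (B : ι → Set (ℝ × ℝ)) (n : ℕ) : Set (ℝ × ℝ) :=
  if h : n < Fintype.card ι then B ((Fintype.equivFin ι).symm ⟨n, h⟩) else ∅

section

variable {ι : Type*} [Fintype ι] {B : ι → Set (ℝ × ℝ)}

theorem padSet_equivFin (B : ι → Set (ℝ × ℝ)) (i : ι) :
    padSet B (Fintype.equivFin ι i) = B i := by
  simp [padSet]

theorem padSet_of_le (B : ι → Set (ℝ × ℝ)) {n : ℕ} (hn : Fintype.card ι ≤ n) :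
    padSet B n = ∅ := dif_neg (not_lt.2 hn)

theorem iUnion_padSet (B : ι → Set (ℝ × ℝ)) : ⋃ n, padSet B n = ⋃ i, B i := by
  refine Subset.antisymm (iUnion_subset fun n => ?_) (iUnion_subset fun i => ?_)
  · unfold padSet
    split_ifs with h
    · exact subset_iUnion B _
    · exact empty_subset _
  · rw [← padSet_equivFin B i]
    exact subset_iUnion (padSet B) _

theorem pairwise_disjoint_padSet (hB : Pairwise (fun i j => Disjoint (B i) (B j))) :
    Pairwise (fun i j => Disjoint (padSet B i) (padSet B j)) := by
  intro i j hij
  unfold padSet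
  split_ifs with h1 h2
  · exact hB fun h => hij (by simpa using h)
  · exact disjoint_bot_right
  · exact disjoint_bot_left
  · exact disjoint_bot_left

theorem measurableSet_padSet (hB : ∀ i, MeasurableSet (B i)) (n : ℕ) :
    MeasurableSet (padSet B n) := by
  unfold padSet
  split_ifs
  · exact hB _
  · exact MeasurableSet.empty

theorem iUnion_ae_eq_sum (hL : IsHomogeneousLevyBasis P L T) (hB : ∀ i, MeasurableSet (B i))
    (hfin : ∀ i, volume (B i) < ∞) (hd : Pairwise (fun i j => Disjoint (B i) (B j))) :
    ∀ᵐ ω ∂P, L (⋃ i, B i) ω = ∑ i, L (B i) ω := by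
  have h := hL.sigmaAdditive (padSet B) (measurableSet_padSet hB)
    (by rw [iUnion_padSet]
        exact (measure_iUnion_le B).trans_lt (by
          rw [tsum_fintype]; exact ENNReal.sum_lt_top.2 fun i _ => hfin i))
    (pairwise_disjoint_padSet hd)
  filter_upwards [h, hL.empty] with ω hω h0
  rw [iUnion_padSet] at hω
  have hconst : ∀ N, Fintype.card ι ≤ N →
      ∑ i ∈ Finset.range N, L (padSet B i) ω = ∑ i, L (B i) ω := by
    intro N hN
    rw [← Finset.sum_range_add_sum_Ico _ hN]
    have h1 : ∑ n ∈ Finset.Ico (Fintype.card ι) N, L (padSet B n) ω = 0 :=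
      Finset.sum_eq_zero fun n hn => by rw [padSet_of_le B (Finset.mem_Ico.1 hn).1, h0]
    rw [h1, add_zero, Finset.sum_range, ← (Fintype.equivFin ι).sum_comp]
    simp only [padSet_equivFin]
  refine tendsto_nhds_unique hω (tendsto_const_nhds.congr' ?_)
  filter_upwards [eventually_ge_atTop (Fintype.card ι)] with N hN
  exact (hconst N hN).symm

theorem iIndepFun_of_disjoint (hL : IsHomogeneousLevyBasis P L T) (hB : ∀ i, MeasurableSet (B i))
    (hfin : ∀ i, volume (B i) < ∞) (hd : Pairwise (fun i j => Disjoint (B i) (B j))) :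
    iIndepFun (fun i => L (B i)) P := by
  have h := hL.indep (padSet B) (measurableSet_padSet hB)
    (fun n => by unfold padSet; split_ifs <;> simp [hfin]) (pairwise_disjoint_padSet hd)
  have h2 := h.precomp (g := fun i : ι => ((Fintype.equivFin ι i : Fin _) : ℕ))
    (Fin.val_injective.comp (Fintype.equivFin ι).injective)
  simpa only [padSet_equivFin] using h2

/-- The atoms of a finite family of sets. -/
def atom (A : ι → Set (ℝ × ℝ)) (S : Finset ι) : Set (ℝ × ℝ) :=
  {p | (∀ k, p ∈ A k ↔ k ∈ S) ∧ p ∈ ⋃ k, A k}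

variable {A : ι → Set (ℝ × ℝ)}

theorem measurableSet_atom (hA : ∀ i, MeasurableSet (A i)) (S : Finset ι) :
    MeasurableSet (atom A S) := by
  refine MeasurableSet.inter ?_ (MeasurableSet.iUnion hA)
  change MeasurableSet {p | ∀ k, p ∈ A k ↔ k ∈ S}
  rw [ofPred_forall]
  refine MeasurableSet.iInter fun k => ?_
  by_cases h : k ∈ S
  · simpa [h] using hA k
  · simp only [h, iff_false]
    exact (hA k).compl

theorem pairwise_disjoint_atom {ι : Type*} {A : ι → Set (ℝ × ℝ)} :
    Pairwise (fun S S' => Disjoint (atom A S) (atom A S')) := by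
  intro S S' hne
  refine disjoint_left.2 fun p hp hp' => hne ?_
  ext k
  rw [← hp.1, ← hp'.1]

theorem volume_atom_lt_top (hfin : ∀ i, volume (A i) < ∞) (S : Finset ι) :
    volume (atom A S) < ∞ :=
  (measure_mono fun _ hp => hp.2).trans_lt ((measure_iUnion_le A).trans_lt (by
    rw [tsum_fintype]; exact ENNReal.sum_lt_top.2 fun i _ => hfin i))

open Classical in
theorem iUnion_atom (k : ι) : ⋃ S : Finset ι, (if k ∈ S then atom A S else ∅) = A k := by
  ext p
  simp only [mem_iUnion]
  constructor
  · rintro ⟨S, hS⟩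
    split_ifs at hS with h
    · exact (hS.1 k).2 h
    · exact absurd hS (notMem_empty p)
  · intro hp
    refine ⟨Finset.univ.filter fun j => p ∈ A j, ?_⟩
    rw [if_pos (by simpa using hp)]
    exact ⟨fun j => by simp, mem_iUnion.2 ⟨k, hp⟩⟩

open Classical in
theorem ae_eq_sum_atom (hL : IsHomogeneousLevyBasis P L T) (hA : ∀ i, MeasurableSet (A i))
    (hfin : ∀ i, volume (A i) < ∞) (k : ι) :
    ∀ᵐ ω ∂P, L (A k) ω = ∑ S : Finset ι, if k ∈ S then L (atom A S) ω else 0 := by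
  have h := hL.iUnion_ae_eq_sum (B := fun S : Finset ι => if k ∈ S then atom A S else ∅)
    (fun S => by split_ifs; exacts [measurableSet_atom hA S, MeasurableSet.empty])
    (fun S => by split_ifs <;> simp [volume_atom_lt_top hfin]) (fun S S' hne => by
      beta_reduce
      split_ifs
      · exact pairwise_disjoint_atom hne
      · exact disjoint_bot_right
      · exact disjoint_bot_left
      · exact disjoint_bot_left)
  rw [iUnion_atom] at h
  filter_upwards [h, hL.empty] with ω hω h0
  rw [hω]
  refine Finset.sum_congr rfl fun S _ => ?_
  split_ifs
  exacts [rfl, h0]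

-- The sum of indicators is constant on each atom, and ψ 0 = 0 disposes of the points outside all
-- sets. The atom of the empty index set is itself empty, so that every atom has finite measure.
open Classical in
theorem sum_indicator_eq (A : ι → Set (ℝ × ℝ)) (θ : ι → ℝ) {ψ : ℝ → ℂ} (h0 : ψ 0 = 0)
    (p : ℝ × ℝ) : ψ (∑ k, (A k).indicator (fun _ => θ k) p)
      = ∑ S : Finset ι, (atom A S).indicator (fun _ => ψ (∑ k ∈ S, θ k)) p := by
  set S₀ : Finset ι := Finset.univ.filter fun j => p ∈ A j with hS₀
  have hsum : ∑ k, (A k).indicator (fun _ => θ k) p = ∑ k ∈ S₀, θ k := by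
    rw [hS₀, Finset.sum_filter]
    rfl
  rw [hsum, Finset.sum_eq_single S₀]
  · by_cases hp : p ∈ ⋃ k, A k
    · rw [indicator_of_mem (show p ∈ atom A S₀ from ⟨fun k => by simp [hS₀], hp⟩)]
    · have : S₀ = ∅ := by
        simp only [mem_iUnion, not_exists] at hp
        simp [hS₀, hp]
      rw [this]
      simp only [Finset.sum_empty, h0]
      by_cases h : p ∈ atom A ∅ <;> simp [h]
  · intro S _ hS
    refine indicator_of_notMem (fun hp => hS ?_) _
    ext k
    rw [← hp.1]; simp [hS₀]
  · simp

open Classical in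
theorem integral_sum_indicator (hA : ∀ i, MeasurableSet (A i))
    (hfin : ∀ i, volume (A i) < ∞) (θ : ι → ℝ) {ψ : ℝ → ℂ} (h0 : ψ 0 = 0) :
    ∫ p, ψ (∑ k, (A k).indicator (fun _ => θ k) p)
      = ∑ S : Finset ι, ((volume (atom A S)).toReal : ℂ) * ψ (∑ k ∈ S, θ k) := by
  simp_rw [sum_indicator_eq A θ h0]
  rw [integral_finsetSum _ fun S _ => (integrable_indicator_iff (measurableSet_atom hA S)).2
    (integrableOn_const (volume_atom_lt_top hfin S).ne)]
  refine Finset.sum_congr rfl fun S _ => ?_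
  rw [integral_indicator (measurableSet_atom hA S), setIntegral_const, Complex.real_smul]
  rfl

-- On the disjoint atoms the values of L are independent; the weight carried by an atom is the total
-- weight of the sets containing it.
open Classical in
theorem charFun_sum [IsProbabilityMeasure P] (hL : IsHomogeneousLevyBasis P L T)
    (hA : ∀ i, MeasurableSet (A i)) (hfin : ∀ i, volume (A i) < ∞) (θ : ι → ℝ) :
    ∫ ω, Complex.exp (Complex.I * ((∑ k, θ k * L (A k) ω : ℝ) : ℂ)) ∂P
      = Complex.exp (∑ S : Finset ι, ((volume (atom A S)).toReal : ℂ) *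
        T.exponent (∑ k ∈ S, θ k)) := by
  have hae : ∀ᵐ ω ∂P, ∑ k, θ k * L (A k) ω
      = ∑ S : Finset ι, (∑ k ∈ S, θ k) * L (atom A S) ω := by
    filter_upwards [ae_all_iff.2 fun k => hL.ae_eq_sum_atom hA hfin k] with ω hω
    simp_rw [hω, Finset.mul_sum, Finset.sum_mul]
    rw [Finset.sum_comm]
    refine Finset.sum_congr rfl fun S _ => ?_
    simp
  have hm : ∀ S, Measurable (L (atom A S)) := fun S =>
    hL.measurable _ (measurableSet_atom hA S) (volume_atom_lt_top hfin S)
  have hind : iIndepFun (fun (S : Finset ι) ω => (∑ k ∈ S, θ k) * L (atom A S) ω) P :=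
    (hL.iIndepFun_of_disjoint (measurableSet_atom hA) (volume_atom_lt_top hfin)
      pairwise_disjoint_atom).comp (fun S x => (∑ k ∈ S, θ k) * x) fun S => by fun_prop
  have h1 := congrFun (hind.charFun_map_fun_sum_eq_prod
    fun S => ((hm S).const_mul _).aemeasurable) 1
  rw [Finset.prod_apply] at h1
  have h2 : ∀ S, charFun (P.map fun ω => (∑ k ∈ S, θ k) * L (atom A S) ω) 1
      = Complex.exp (((volume (atom A S)).toReal : ℂ) * T.exponent (∑ k ∈ S, θ k)) := fun S => by
    rw [charFun_map_mul_comp (hm S).aemeasurable, mul_one,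
      hL.charFun_eq _ (measurableSet_atom hA S) (volume_atom_lt_top hfin S)]
  simp_rw [h2] at h1
  rw [Complex.exp_sum, ← h1, charFun_apply_real,
    integral_map (by fun_prop) (Continuous.aestronglyMeasurable (by fun_prop))]
  refine integral_congr_ae ?_
  filter_upwards [hae] with ω hω
  rw [hω]
  simp [mul_comm]

end

theorem integral_eq [IsProbabilityMeasure P] (hL : IsHomogeneousLevyBasis P L T)
    (hb : T.b = 0) (hν : Integrable (fun x : ℝ => x ^ 2) T.ν) {A : Set (ℝ × ℝ)}
    (hA : MeasurableSet A) (hfin : volume A < ∞) :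
    ∫ ω, L A ω ∂P = (volume A).toReal * (T.γ + ∫ x in {x | 1 < |x|}, x ∂T.ν) := by
  have hm := (hL.measurable A hA hfin).aemeasurable (μ := P)
  have : IsProbabilityMeasure (P.map (L A)) := Measure.isProbabilityMeasure_map hm
  have h := (integrable_sq_of_charFun_eq (μ := P.map (L A)) (v := (volume A).toReal)
    ENNReal.toReal_nonneg (norm_compExponent_le_sq hν) fun z => by
      rw [hL.charFun_eq A hA hfin,
        T.exponent_eq_compExponent hb (integrable_min_abs_sq hν)]).2
  rwa [integral_map (f := fun x => x) hm aestronglyMeasurable_id] at h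

/-- The joint characteristic function of the centred values of a Lévy basis. -/
theorem charFun_centered [IsProbabilityMeasure P] (hL : IsHomogeneousLevyBasis P L T)
    (hb : T.b = 0) (hν : Integrable (fun x : ℝ => x ^ 2) T.ν) {ι : Type*} [Fintype ι]
    {A : ι → Set (ℝ × ℝ)} (hA : ∀ i, MeasurableSet (A i)) (hfin : ∀ i, volume (A i) < ∞)
    (θ : ι → ℝ) :
    ∫ ω, Complex.exp (Complex.I * ((∑ k, θ k * (L (A k) ω - ∫ ω', L (A k) ω' ∂P) : ℝ) : ℂ)) ∂P
      = Complex.exp (∫ p, compExponent T.ν (∑ k, (A k).indicator (fun _ => θ k) p)) := by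
  classical
  set m := T.γ + ∫ x in {x | 1 < |x|}, x ∂T.ν with hm
  have h1 := hL.charFun_sum hA hfin θ
  -- The atom formula for the identity function: the drift summed over atoms equals the drift summed
  -- over the sets A k, which the centring removes.
  have hlin : ∑ k, θ k * (volume (A k)).toReal
      = ∑ S : Finset ι, (volume (atom A S)).toReal * ∑ k ∈ S, θ k := by
    have h2 := integral_sum_indicator hA hfin θ (ψ := fun x => (x : ℂ)) (by simp)
    rw [integral_complex_ofReal, integral_finsetSum _ fun k _ =>
      (integrable_indicator_iff (hA k)).2 (integrableOn_const (hfin k).ne)] at h2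
    simp_rw [integral_indicator (hA _), setIntegral_const] at h2
    have h3 : ∑ k, (volume (A k)).toReal * θ k
      = ∑ S : Finset ι, (volume (atom A S)).toReal * ∑ k ∈ S, θ k := by exact_mod_cast h2
    rw [← h3]
    exact Finset.sum_congr rfl fun k _ => mul_comm _ _
  have hexp : ∑ S : Finset ι, ((volume (atom A S)).toReal : ℂ) * T.exponent (∑ k ∈ S, θ k)
      = Complex.I * ((m * ∑ k, θ k * (volume (A k)).toReal : ℝ) : ℂ)
        + ∫ p, compExponent T.ν (∑ k, (A k).indicator (fun _ => θ k) p) := by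
    rw [integral_sum_indicator hA hfin θ (compExponent_zero _), hlin]
    simp_rw [T.exponent_eq_compExponent hb (integrable_min_abs_sq hν), mul_add,
      Finset.sum_add_distrib]
    congr 1
    push_cast
    rw [Finset.mul_sum, Finset.mul_sum]
    refine Finset.sum_congr rfl fun S _ => ?_
    rw [hm]; push_cast; ring
  have hsplit : ∀ ω, Complex.exp (Complex.I *
      ((∑ k, θ k * (L (A k) ω - ∫ ω', L (A k) ω' ∂P) : ℝ) : ℂ))
      = Complex.exp (Complex.I * ((∑ k, θ k * L (A k) ω : ℝ) : ℂ)) *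
        Complex.exp (-(Complex.I * ((m * ∑ k, θ k * (volume (A k)).toReal : ℝ) : ℂ))) := by
    intro ω
    rw [← Complex.exp_add]
    congr 1
    have : ∑ k, θ k * (L (A k) ω - ∫ ω', L (A k) ω' ∂P)
        = ∑ k, θ k * L (A k) ω - m * ∑ k, θ k * (volume (A k)).toReal := by
      rw [Finset.mul_sum, ← Finset.sum_sub_distrib]
      refine Finset.sum_congr rfl fun k _ => ?_
      rw [hL.integral_eq hb hν (hA k) (hfin k)]
      ring
    rw [this]; push_cast; ring
  simp_rw [hsplit]
  rw [integral_mul_const, h1, hexp, ← Complex.exp_add]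
  congr 1
  ring

end IsHomogeneousLevyBasis


/-! ### Geometry of the trawl: horizontal sections -/

namespace LongMemory

variable {a aprime : ℝ → ℝ} {κ : ℝ}

theorem eq_sub_intervalIntegral (h : LongMemory a aprime κ) {s : ℝ} (hs : 0 ≤ s) :
    a s = a 0 - ∫ y in (0 : ℝ)..s, aprime y := by
  rw [h.eq_integral s hs, h.eq_integral 0 le_rfl, intervalIntegral.integral_of_le hs,
    ← Ioc_union_Ioi_eq_Ioi hs, setIntegral_union (Ioc_disjoint_Ioi le_rfl) measurableSet_Ioi
      (h.integrable.mono_set Ioc_subset_Ioi_self) (h.integrable.mono_set (Ioi_subset_Ioi hs))]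
  ring

theorem hasDerivAt (h : LongMemory a aprime κ) {u : ℝ} (hu : 0 < u) :
    HasDerivAt a (-aprime u) u := by
  have hc : ContinuousAt aprime u := h.cont.continuousAt (Ici_mem_nhds hu)
  have h1 : HasDerivAt (fun s => a 0 - ∫ y in (0 : ℝ)..s, aprime y) (-aprime u) u := by
    refine (intervalIntegral.integral_hasDerivAt_right ?_ ?_ hc).const_sub _
    · rw [intervalIntegrable_iff_integrableOn_Ioc_of_le hu.le]
      exact h.integrable.mono_set Ioc_subset_Ioi_self
    · exact ⟨Ici 0, Ici_mem_nhds hu, h.cont.aestronglyMeasurable measurableSet_Ici⟩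
  refine h1.congr_of_eventuallyEq ?_
  filter_upwards [Ioi_mem_nhds hu] with s hs
  exact h.eq_sub_intervalIntegral (le_of_lt hs)

theorem continuousOn (h : LongMemory a aprime κ) : ContinuousOn a (Ici 0) := by
  have h1 : ContinuousOn (fun s => a 0 - ∫ y in (0 : ℝ)..s, aprime y) (Ici 0) := by
    refine continuousOn_const.sub ?_
    intro s hs
    have h2 := intervalIntegral.continuousOn_primitive_interval' (μ := volume) (f := aprime)
      (a := 0) (b₁ := 0) (b₂ := s + 1) (by
        rw [intervalIntegrable_iff_integrableOn_Ioc_of_le (by linarith [mem_Ici.1 hs])]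
        exact h.integrable.mono_set Ioc_subset_Ioi_self) left_mem_uIcc
    rw [uIcc_of_le (by linarith [mem_Ici.1 hs])] at h2
    refine (h2 s ⟨hs, by linarith⟩).mono_of_mem_nhdsWithin ?_
    rw [← Ici_inter_Iic]
    exact inter_mem self_mem_nhdsWithin
      (mem_nhdsWithin_of_mem_nhds (Iic_mem_nhds (by linarith)))
  exact h1.congr fun s hs => h.eq_sub_intervalIntegral hs

theorem strictAntiOn (h : LongMemory a aprime κ) : StrictAntiOn a (Ici 0) := by
  refine strictAntiOn_of_deriv_neg (convex_Ici 0) h.continuousOn fun u hu => ?_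
  rw [interior_Ici] at hu
  rw [(h.hasDerivAt hu).deriv]
  linarith [h.pos u (le_of_lt hu)]

theorem tendsto_zero (h : LongMemory a aprime κ) : Tendsto a atTop (𝓝 0) := by
  have h1 := (intervalIntegral_tendsto_integral_Ioi 0 h.integrable tendsto_id).const_sub (a 0)
  rw [← h.eq_integral 0 le_rfl, sub_self] at h1
  refine h1.congr' ?_
  filter_upwards [eventually_ge_atTop 0] with s hs
  exact (h.eq_sub_intervalIntegral hs).symm

theorem apply_pos (h : LongMemory a aprime κ) {s : ℝ} (hs : 0 ≤ s) : 0 < a s := by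
  have h1 : a (s + 1) < a s := h.strictAntiOn hs (show (0 : ℝ) ≤ s + 1 by linarith) (by linarith)
  refine lt_of_le_of_lt ?_ h1
  rw [h.eq_integral _ (by linarith)]
  exact setIntegral_nonneg measurableSet_Ioi fun y hy => (h.pos y (by
    have := mem_Ioi.1 hy; linarith)).le

/-- Makes u ↦ a u a parametrisation of the heights, for the change of variables in
`integral_translate_sum`. -/
theorem image_Ioi (h : LongMemory a aprime κ) : a '' Ioi 0 = Ioo 0 (a 0) := by
  refine Subset.antisymm ?_ fun y hy => ?_
  · rintro _ ⟨u, hu, rfl⟩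
    exact ⟨h.apply_pos (le_of_lt hu), h.strictAntiOn self_mem_Ici (Ioi_subset_Ici_self hu) hu⟩
  · obtain ⟨M, hM0, hM⟩ := ((eventually_gt_atTop 0).and
      (h.tendsto_zero.eventually (gt_mem_nhds hy.1))).exists
    have h1 := intermediate_value_Ioo' (le_of_lt hM0)
      (h.continuousOn.mono Icc_subset_Ici_self)
    obtain ⟨u, hu, rfl⟩ := h1 ⟨hM, hy.2⟩
    exact ⟨u, hu.1, rfl⟩

/-- Nothing is known about a on the negative axis, so the continuous function s ↦ a (max 0 s) is
used; it describes the same set where r ≤ 0. -/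
theorem measurableSet_trawlSet (h : LongMemory a aprime κ) : MeasurableSet (trawlSet a) := by
  have hc : Continuous fun s : ℝ => a (max 0 s) :=
    h.continuousOn.comp_continuous (by fun_prop) fun s =>
      mem_Ici.2 (le_max_left _ _)
  have e : trawlSet a = {p : ℝ × ℝ | p.1 ≤ 0} ∩ ({p | 0 ≤ p.2} ∩ {p | p.2 ≤ a (max 0 (-p.1))}) := by
    ext p
    simp only [trawlSet, mem_inter_iff, mem_ofPred_eq]
    constructor
    · rintro ⟨h1, h2, h3⟩
      exact ⟨h1, h2, by rwa [max_eq_right (by linarith)]⟩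
    · rintro ⟨h1, h2, h3⟩
      exact ⟨h1, h2, by rwa [max_eq_right (by linarith)] at h3⟩
  rw [e]
  refine (measurableSet_le measurable_fst measurable_const).inter
    ((measurableSet_le measurable_const measurable_snd).inter (measurableSet_le measurable_snd ?_))
  exact hc.measurable.comp (by fun_prop)

/-- The translated trawl set. -/
theorem mem_translate_iff {t : ℝ} {p : ℝ × ℝ} :
    p ∈ (fun p : ℝ × ℝ => p + (t, 0)) '' trawlSet a ↔ p.1 ≤ t ∧ 0 ≤ p.2 ∧ p.2 ≤ a (t - p.1) := by
  rw [image_add_right]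
  simp [trawlSet, sub_eq_add_neg]

/-- As a is strictly decreasing, a u ≤ a (t - r) means t - r ≤ u: at height a u every translated
trawl has a section of length u, ending at its own time. -/
theorem mem_translate_apply_iff (h : LongMemory a aprime κ) {t u r : ℝ} (hu : 0 < u) :
    (r, a u) ∈ (fun p : ℝ × ℝ => p + (t, 0)) '' trawlSet a ↔ r ≤ t ∧ t ≤ r + u := by
  rw [mem_translate_iff]
  constructor
  · rintro ⟨h1, -, h3⟩
    refine ⟨h1, ?_⟩
    have := (h.strictAntiOn.le_iff_ge (show (0 : ℝ) ≤ u from hu.le)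
      (show (0 : ℝ) ≤ t - r by simpa using h1)).1 h3
    linarith
  · rintro ⟨h1, h2⟩
    exact ⟨h1, (h.apply_pos hu.le).le, (h.strictAntiOn.le_iff_ge (show (0 : ℝ) ≤ u from hu.le)
      (show (0 : ℝ) ≤ t - r by simpa using h1)).2 (by linarith)⟩

theorem measurableSet_translate (h : LongMemory a aprime κ) (t : ℝ) :
    MeasurableSet ((fun p : ℝ × ℝ => p + (t, 0)) '' trawlSet a) := by
  rw [image_add_right]
  exact h.measurableSet_trawlSet.preimage (by fun_prop)

theorem volume_trawlSet_lt_top (h : LongMemory a aprime κ) (hi : IntegrableOn a (Ioi 0)) :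
    volume (trawlSet a) < ∞ := by
  rw [Measure.volume_eq_prod, Measure.prod_apply h.measurableSet_trawlSet]
  have hle : ∀ r, volume (Prod.mk r ⁻¹' trawlSet a)
      ≤ (Iic (0 : ℝ)).indicator (fun r => ENNReal.ofReal (a (-r))) r := by
    intro r
    by_cases hr : r ≤ 0
    · rw [indicator_of_mem (mem_Iic.2 hr)]
      refine (measure_mono (t := Icc 0 (a (-r))) fun y hy => ⟨hy.2.1, hy.2.2⟩).trans ?_
      simp
    · have : Prod.mk r ⁻¹' trawlSet a = ∅ := by
        ext y; simp [trawlSet, hr]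
      rw [this]; simp
  refine lt_of_le_of_lt (lintegral_mono hle) ?_
  rw [lintegral_indicator measurableSet_Iic]
  have h1 : IntegrableOn (fun r => a (-r)) (Iic 0) := by
    have := (Measure.measurePreserving_neg (volume : Measure ℝ)).integrableOn_comp_preimage
      (MeasurableEquiv.neg ℝ).measurableEmbedding (f := a) (s := Ici 0)
    have h2 := this.2 (by rwa [integrableOn_Ici_iff_integrableOn_Ioi])
    simpa [Function.comp_def] using h2
  exact h1.lintegral_lt_top

theorem volume_translate_lt_top (h : LongMemory a aprime κ) (hi : IntegrableOn a (Ioi 0)) (t : ℝ) :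
    volume ((fun p : ℝ × ℝ => p + (t, 0)) '' trawlSet a) < ∞ := by
  rw [image_add_right, measure_preimage_add_right]
  exact h.volume_trawlSet_lt_top hi

open IsHomogeneousLevyBasis in
/-- Integration of a functional of a sum of translated trawl indicators, disintegrated over the
length `u` of the horizontal sections. -/
theorem integral_translate_sum (h : LongMemory a aprime κ) (hi : IntegrableOn a (Ioi 0))
    {ι : Type*} [Fintype ι] (t θ : ι → ℝ) {ψ : ℝ → ℂ} (h0 : ψ 0 = 0) :
    ∫ p, ψ (∑ k, ((fun p : ℝ × ℝ => p + (t k, 0)) '' trawlSet a).indicator (fun _ => θ k) p)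
      = ∫ u in Ioi (0 : ℝ), aprime u •
        ∫ r, ψ (∑ k, if r ≤ t k ∧ t k ≤ r + u then θ k else 0) := by
  set A : ι → Set (ℝ × ℝ) := fun k => (fun p : ℝ × ℝ => p + (t k, 0)) '' trawlSet a with hA
  have hAm : ∀ k, MeasurableSet (A k) := fun k => h.measurableSet_translate (t k)
  have hAf : ∀ k, volume (A k) < ∞ := fun k => h.volume_translate_lt_top hi (t k)
  have hint : Integrable fun p => ψ (∑ k, (A k).indicator (fun _ => θ k) p) := by
    simp_rw [sum_indicator_eq A θ h0]
    exact integrable_finsetSum _ fun S _ => (integrable_indicator_iff (measurableSet_atom hAm S)).2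
      (integrableOn_const (volume_atom_lt_top hAf S).ne)
  change ∫ p, ψ (∑ k, (A k).indicator (fun _ => θ k) p) = _
  rw [Measure.volume_eq_prod] at hint ⊢
  rw [integral_prod_symm _ hint]
  set G : ℝ → ℂ := fun y => ∫ r, ψ (∑ k, (A k).indicator (fun _ => θ k) (r, y)) with hG
  change ∫ y, G y = _
  have hG0 : ∀ y, y ∉ Icc 0 (a 0) → G y = 0 := by
    intro y hy
    have h1 : ∀ r k, (r, y) ∉ A k := by
      intro r k hk
      obtain ⟨h2, h3, h4⟩ := mem_translate_iff.1 hk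
      refine hy ⟨h3, h4.trans ?_⟩
      exact h.strictAntiOn.antitoneOn self_mem_Ici (show (0 : ℝ) ≤ t k - r by simpa using h2)
        (by simpa using h2)
    simp only [hG]
    simp [indicator_of_notMem (h1 _ _), h0]
  -- Heights outside [0, a 0] meet no trawl, the end points are null, and y = a u has Jacobian
  -- `aprime u`.
  rw [← setIntegral_eq_integral_of_forall_compl_eq_zero hG0, integral_Icc_eq_integral_Ioo,
    ← h.image_Ioi, integral_image_eq_integral_abs_deriv_smul measurableSet_Ioi
      (fun u hu => (h.hasDerivAt hu).hasDerivWithinAt)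
      (h.strictAntiOn.injOn.mono Ioi_subset_Ici_self)]
  refine setIntegral_congr_fun measurableSet_Ioi fun u hu => ?_
  have hu' : 0 < u := hu
  simp only [hG]
  rw [abs_neg, abs_of_pos (h.pos u hu'.le)]
  congr 2
  funext r
  congr 1
  refine Finset.sum_congr rfl fun k _ => ?_
  classical
  rw [indicator_apply]
  exact if_congr (h.mem_translate_apply_iff hu') rfl rfl

end LongMemory

/-! ### Scaling limits against a power-law density -/

namespace PowerLongMemory

variable {a aprime : ℝ → ℝ} {κ ca : ℝ}

theorem tendsto_rpow_mul (h : PowerLongMemory a aprime κ ca) :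
    Tendsto (fun y => y ^ κ * aprime y) atTop (𝓝 ca) := by
  have h1 : Tendsto (aprime / fun y => ca * y ^ (-κ)) atTop (𝓝 1) :=
    (Asymptotics.isEquivalent_iff_tendsto_one (by
      filter_upwards [eventually_gt_atTop 0] with y hy
      exact mul_ne_zero h.ca_pos.ne' (Real.rpow_pos_of_pos hy _).ne')).1 h.equiv
  have h2 := h1.const_mul ca
  rw [mul_one] at h2
  refine h2.congr' ?_
  filter_upwards [eventually_gt_atTop 0] with y hy
  have := h.ca_pos.ne'
  have := (Real.rpow_pos_of_pos hy κ).ne'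
  simp only [Pi.div_apply]
  rw [Real.rpow_neg hy.le]
  field_simp

theorem tendsto_scaled (h : PowerLongMemory a aprime κ ca) {B : ℕ → ℝ} (hB : Tendsto B atTop atTop)
    {v : ℝ} (hv : 0 < v) :
    Tendsto (fun n => B n ^ κ * aprime (B n * v)) atTop (𝓝 (ca * v ^ (-κ))) := by
  have h1 := (h.tendsto_rpow_mul.comp (hB.atTop_mul_const hv)).mul_const (v ^ (-κ))
  refine h1.congr' ?_
  filter_upwards [hB.eventually_gt_atTop 0] with n hn
  have := (Real.rpow_pos_of_pos hv κ).ne'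
  simp only [Function.comp_apply]
  rw [Real.mul_rpow hn.le hv.le, Real.rpow_neg hv.le]
  field_simp

/-- Far out the bound comes from the asymptotics, on the remaining compact interval from continuity.
It cannot reach u = 0 in this form, which is why the scaling theorem treats u ≤ 1 separately. -/
theorem exists_le_rpow (h : PowerLongMemory a aprime κ ca) :
    ∃ C, 0 < C ∧ ∀ u, 1 ≤ u → aprime u ≤ C * u ^ (-κ) := by
  obtain ⟨M, hM⟩ := eventually_atTop.1
    (h.tendsto_rpow_mul.eventually (ge_mem_nhds (lt_add_one ca)))
  have hc : ContinuousOn (fun u : ℝ => u ^ κ * aprime u) (Icc 1 (max 1 M)) :=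
    (ContinuousOn.rpow_const continuousOn_id fun u hu => Or.inl (by
      have := hu.1; simp only [id]; linarith)).mul
      (h.cont.mono fun u hu => (zero_le_one.trans hu.1 : (0 : ℝ) ≤ u))
  obtain ⟨C, hC⟩ := isCompact_Icc.exists_bound_of_continuousOn hc
  refine ⟨max (ca + 1) C, lt_max_of_lt_left (by linarith [h.ca_pos]), fun u hu => ?_⟩
  have hu0 : 0 < u := by linarith
  have hb : u ^ κ * aprime u ≤ max (ca + 1) C := by
    rcases le_total M u with hMu | hMu
    · exact (hM u hMu).trans (le_max_left _ _)
    · exact ((le_abs_self _).trans (hC u ⟨hu, hMu.trans (le_max_right _ _)⟩)).trans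
        (le_max_right _ _)
  rw [Real.rpow_neg hu0.le, ← div_eq_mul_inv, le_div_iff₀ (Real.rpow_pos_of_pos hu0 κ), mul_comm]
  exact hb

/-- Rescaling limit for integrals against `a'`. -/
theorem tendsto_integral_scaled (h : PowerLongMemory a aprime κ ca) {B : ℕ → ℝ}
    (hB : Tendsto B atTop atTop) {H : ℕ → ℝ → ℂ} {g : ℝ → ℂ} {G : ℝ → ℝ} {ε : ℕ → ℝ}
    (hHm : ∀ n, AEStronglyMeasurable (H n) (volume.restrict (Ioi 0)))
    (hε : Tendsto ε atTop (𝓝 0)) (hH0 : ∀ᶠ n in atTop, ∀ u, 0 < u → u ≤ 1 → ‖H n u‖ ≤ ε n)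
    (hG : IntegrableOn (fun v => v ^ (-κ) * G v) (Ioi 0))
    (hHG : ∀ᶠ n in atTop, ∀ v, 0 < v → 1 < B n * v → ‖B n ^ (1 - κ) • H n (B n * v)‖ ≤ G v)
    (hHg : ∀ v, 0 < v → Tendsto (fun n => B n ^ (1 - κ) • H n (B n * v)) atTop (𝓝 (g v))) :
    Tendsto (fun n => ∫ u in Ioi (0 : ℝ), aprime u • H n u) atTop
      (𝓝 (∫ v in Ioi (0 : ℝ), (ca * v ^ (-κ)) • g v)) := by
  obtain ⟨C, hC0, hC⟩ := h.exists_le_rpow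
  have ham : AEStronglyMeasurable aprime (volume.restrict (Ioi 0)) := h.integrable.1
  -- The integrand cut to u > 1, where the power bound on `aprime` holds, and read at u = B n v.
  set F : ℕ → ℝ → ℂ := fun n v => (Ioi (1 : ℝ)).indicator
    (fun u => aprime u • H n u) (B n * v) with hF
  have hfm : ∀ n, AEStronglyMeasurable (fun u => aprime u • H n u) (volume.restrict (Ioi 0)) :=
    fun n => ham.smul (hHm n)
  have hFm : ∀ n, 0 < B n → AEStronglyMeasurable (F n) (volume.restrict (Ioi 0)) := by
    intro n hB0
    have h1 : AEStronglyMeasurable ((Ioi (1 : ℝ)).indicator (fun u => aprime u • H n u))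
        (volume.restrict (Ioi 0)) := (hfm n).indicator measurableSet_Ioi
    have hq : Measure.QuasiMeasurePreserving (fun v : ℝ => B n * v) (volume.restrict (Ioi 0))
        (volume.restrict (Ioi 0)) := by
      refine ⟨by fun_prop, Measure.AbsolutelyContinuous.mk fun s hs hs0 => ?_⟩
      rw [Measure.map_apply (by fun_prop) hs, Measure.restrict_apply (hs.preimage (by fun_prop))]
      rw [Measure.restrict_apply hs] at hs0
      have e : (fun v : ℝ => B n * v) ⁻¹' s ∩ Ioi 0 = (fun v : ℝ => B n * v) ⁻¹' (s ∩ Ioi 0) := by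
        ext v; simp [hB0]
      rw [e, Real.volume_preimage_mul_left hB0.ne', hs0, mul_zero]
    exact h1.comp_quasiMeasurePreserving hq
  -- The Jacobian B n is split as B^κ · B^(1-κ): one power stabilises `aprime` (B n v), the other H.
  have hFbound : ∀ᶠ n in atTop, ∀ v, 0 < v → ‖B n • F n v‖ ≤ C * (v ^ (-κ) * G v) := by
    filter_upwards [hHG, hB.eventually_gt_atTop 0] with n hn hB0 v hv
    have hGv : 1 < B n * v → 0 ≤ G v := fun h1 => (norm_nonneg _).trans (hn v hv h1)
    by_cases h1 : 1 < B n * v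
    · simp only [hF]
      rw [indicator_of_mem (mem_Ioi.2 h1)]
      have e : B n • aprime (B n * v) • H n (B n * v)
          = (B n ^ κ * aprime (B n * v)) • (B n ^ (1 - κ) • H n (B n * v)) := by
        rw [smul_smul, smul_smul]
        congr 1
        rw [mul_right_comm, ← Real.rpow_add hB0]
        simp
      rw [e, norm_smul, ← mul_assoc]
      refine mul_le_mul ?_ (hn v hv h1) (norm_nonneg _) (by positivity)
      rw [Real.norm_of_nonneg (mul_nonneg (by positivity) (h.pos _ (by positivity)).le)]
      have h2 := hC (B n * v) h1.le
      rw [Real.mul_rpow hB0.le hv.le] at h2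
      calc B n ^ κ * aprime (B n * v) ≤ B n ^ κ * (C * (B n ^ (-κ) * v ^ (-κ))) := by gcongr
        _ = (B n ^ κ * B n ^ (-κ)) * (C * v ^ (-κ)) := by ring
        _ = C * v ^ (-κ) := by rw [← Real.rpow_add hB0]; simp
    · simp only [hF]
      rw [indicator_of_notMem (notMem_Ioi.2 (not_lt.1 h1)), smul_zero, norm_zero]
      -- Here F vanishes, but the bound must still be nonnegative. The sign of G v is learnt at a
      -- later index m with B m · v > 1.
      have hev := hHG.and (hB.eventually_gt_atTop (1 / v))
      obtain ⟨m, hm1, hm2⟩ := hev.exists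
      have : 0 ≤ G v := (norm_nonneg _).trans (hm1 v hv (by rwa [div_lt_iff₀ hv] at hm2))
      positivity
  have hlim2 : Tendsto (fun n => ∫ v in Ioi (0 : ℝ), B n • F n v) atTop
      (𝓝 (∫ v in Ioi (0 : ℝ), (ca * v ^ (-κ)) • g v)) := by
    refine tendsto_integral_filter_of_dominated_convergence (fun v => C * (v ^ (-κ) * G v)) ?_ ?_
      (hG.const_mul C) ?_
    · filter_upwards [hB.eventually_gt_atTop 0] with n hB0
      exact (hFm n hB0).const_smul (B n)
    · filter_upwards [hFbound] with n hn
      exact (ae_restrict_iff' measurableSet_Ioi).2 (ae_of_all _ fun v hv => hn v hv)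
    · refine (ae_restrict_iff' measurableSet_Ioi).2 (ae_of_all _ fun v hv => ?_)
      have hv' : 0 < v := hv
      refine ((h.tendsto_scaled hB hv').smul (hHg v hv')).congr' ?_
      filter_upwards [hB.eventually_gt_atTop 0, hB.eventually_gt_atTop (1 / v)] with n hB0 hB1
      have h1 : 1 < B n * v := by rwa [div_lt_iff₀ hv'] at hB1
      simp only [hF]
      rw [indicator_of_mem (mem_Ioi.2 h1), smul_smul, smul_smul]
      congr 1
      rw [mul_right_comm, ← Real.rpow_add hB0]
      simp
  -- Near 0 there is no scaling: `aprime` is integrable on (0, 1] and H n is uniformly at most ε n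
  -- there.
  have hlim1 : Tendsto (fun n => ∫ u in Ioc (0 : ℝ) 1, aprime u • H n u) atTop (𝓝 0) := by
    refine squeeze_zero_norm' (a := fun n => ∫ u in Ioc (0 : ℝ) 1, aprime u * ε n) ?_ ?_
    · filter_upwards [hH0] with n hn
      refine norm_integral_le_of_norm_le
        ((h.integrable.mono_set Ioc_subset_Ioi_self).mul_const _)
        ((ae_restrict_iff' measurableSet_Ioc).2 (ae_of_all _ fun u hu => ?_))
      rw [norm_smul, Real.norm_of_nonneg (h.pos u hu.1.le).le]
      exact mul_le_mul_of_nonneg_left (hn u hu.1 hu.2) (h.pos u hu.1.le).le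
    · simp_rw [integral_mul_const]
      simpa using hε.const_mul _
  have hsum := hlim1.add hlim2
  rw [zero_add] at hsum
  refine hsum.congr' ?_
  filter_upwards [hH0, hFbound, hB.eventually_gt_atTop 0] with n hn hFn hB0
  have hcv : ∫ v in Ioi (0 : ℝ), B n • F n v = ∫ u in Ioi (1 : ℝ), aprime u • H n u := by
    rw [integral_smul, integral_comp_mul_left_Ioi _ _ hB0, mul_zero, smul_smul,
      mul_inv_cancel₀ hB0.ne', one_smul, setIntegral_indicator measurableSet_Ioi,
      inter_eq_right.2 (Ioi_subset_Ioi zero_le_one)]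
  have i1 : IntegrableOn (fun u => aprime u • H n u) (Ioc 0 1) := by
    refine ((h.integrable.mono_set Ioc_subset_Ioi_self).mul_const (ε n)).mono'
      ((hfm n).mono_measure (Measure.restrict_mono Ioc_subset_Ioi_self le_rfl))
      ((ae_restrict_iff' measurableSet_Ioc).2 (ae_of_all _ fun u hu => ?_))
    rw [norm_smul, Real.norm_of_nonneg (h.pos u hu.1.le).le]
    exact mul_le_mul_of_nonneg_left (hn u hu.1 hu.2) (h.pos u hu.1.le).le
  have i2 : IntegrableOn (fun u => aprime u • H n u) (Ioi 1) := by
    have h2 : IntegrableOn (fun v => F n v) (Ioi 0) := by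
      refine ((hG.const_mul C).const_mul (B n)⁻¹).mono' (hFm n hB0)
        ((ae_restrict_iff' measurableSet_Ioi).2 (ae_of_all _ fun v hv => ?_))
      have h1 := hFn v hv
      rw [norm_smul, Real.norm_of_nonneg hB0.le] at h1
      rwa [← div_eq_inv_mul, le_div_iff₀ hB0, mul_comm]
    have h3 := (integrableOn_Ioi_comp_mul_left_iff
      ((Ioi (1 : ℝ)).indicator (fun u => aprime u • H n u)) 0 hB0).1 h2
    rw [mul_zero, IntegrableOn, integrable_indicator_iff measurableSet_Ioi, IntegrableOn,
      Measure.restrict_restrict measurableSet_Ioi,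
      inter_eq_left.2 (Ioi_subset_Ioi zero_le_one)] at h3
    exact h3
  rw [hcv, ← Ioc_union_Ioi_eq_Ioi zero_le_one,
    setIntegral_union (Ioc_disjoint_Ioi le_rfl) measurableSet_Ioi i1 i2]

end PowerLongMemory


/-! ### Counting lattice times in a window -/

/-- The number of integers `0 ≤ k < M` in the interval `[x, y]`. -/
noncomputable def latticeCount (M : ℕ) (x y : ℝ) : ℝ :=
  ∑ k ∈ Finset.range M, if x ≤ k ∧ (k : ℝ) ≤ y then 1 else 0

section LatticeCount

theorem latticeCount_nonneg (M : ℕ) (x y : ℝ) : 0 ≤ latticeCount M x y :=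
  Finset.sum_nonneg fun k _ => by split_ifs <;> norm_num

theorem latticeCount_le (M : ℕ) (x y : ℝ) : latticeCount M x y ≤ M := by
  refine (Finset.sum_le_card_nsmul _ _ 1 fun k _ => by split_ifs <;> norm_num).trans ?_
  simp

theorem latticeCount_mono {M N : ℕ} (h : M ≤ N) (x y : ℝ) :
    latticeCount M x y ≤ latticeCount N x y :=
  Finset.sum_le_sum_of_subset_of_nonneg (Finset.range_mono h)
    fun k _ _ => by split_ifs <;> norm_num

theorem latticeCount_of_neg {M : ℕ} {x y : ℝ} (hy : y < 0) : latticeCount M x y = 0 :=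
  Finset.sum_eq_zero fun k _ => if_neg fun h => by
    have := h.2; have := (k.cast_nonneg : (0 : ℝ) ≤ k); linarith

theorem latticeCount_of_lt {M : ℕ} {x y : ℝ} (hx : (M : ℝ) < x) : latticeCount M x y = 0 :=
  Finset.sum_eq_zero fun k hk => if_neg fun h => by
    have h1 := h.1
    have : (k : ℝ) < M := by exact_mod_cast Finset.mem_range.1 hk
    linarith

theorem latticeCount_eq {M : ℕ} {x y : ℝ} (hy : 0 ≤ y) :
    latticeCount M x y = max 0 (min (M : ℝ) (⌊y⌋₊ + 1) - ⌈x⌉₊) := by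
  have h1 : (Finset.range M).filter (fun k : ℕ => x ≤ k ∧ (k : ℝ) ≤ y)
      = Finset.Ico ⌈x⌉₊ (min M (⌊y⌋₊ + 1)) := by
    ext k
    simp only [Finset.mem_filter, Finset.mem_range, Finset.mem_Ico, lt_min_iff, Nat.lt_add_one_iff,
      Nat.ceil_le, Nat.le_floor_iff hy]
    tauto
  rw [latticeCount, Finset.sum_boole, h1, Nat.card_Ico]
  rcases le_total ⌈x⌉₊ (min M (⌊y⌋₊ + 1)) with h | h
  · rw [Nat.cast_sub h, max_eq_right]
    · push_cast; rfl
    · have : ((⌈x⌉₊ : ℕ) : ℝ) ≤ ((min M (⌊y⌋₊ + 1) : ℕ) : ℝ) := by exact_mod_cast h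
      push_cast at this; linarith
  · rw [Nat.sub_eq_zero_of_le h, max_eq_left]
    · simp
    · have : ((min M (⌊y⌋₊ + 1) : ℕ) : ℝ) ≤ ((⌈x⌉₊ : ℕ) : ℝ) := by exact_mod_cast h
      push_cast at this; linarith

theorem latticeCount_le_sub_add_one {M : ℕ} {x y : ℝ} (hxy : x ≤ y) :
    latticeCount M x y ≤ y - x + 1 := by
  rcases lt_or_ge y 0 with hy | hy
  · rw [latticeCount_of_neg hy]; linarith
  · rw [latticeCount_eq hy]
    refine max_le (by linarith) ?_
    have h1 := Nat.floor_le hy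
    have h2 := Nat.le_ceil x
    linarith [min_le_right (M : ℝ) (⌊y⌋₊ + 1)]

/-- Each end point of the window contributes a rounding error of at most 1. -/
theorem abs_latticeCount_sub_le (M : ℕ) (x y : ℝ) :
    |latticeCount M x y - max 0 (min y M - max x 0)| ≤ 2 := by
  rcases lt_or_ge y 0 with hy | hy
  · rw [latticeCount_of_neg hy, max_eq_left]
    · simp
    · linarith [min_le_left y (M : ℝ), le_max_right x 0]
  · rw [latticeCount_eq hy]
    have h1 : |(⌈x⌉₊ : ℝ) - max x 0| ≤ 1 := by
      rcases le_total x 0 with hx | hx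
      · rw [Nat.ceil_eq_zero.2 hx, max_eq_right hx]; simp
      · rw [max_eq_left hx, abs_le]
        exact ⟨by linarith [Nat.le_ceil x], by linarith [Nat.ceil_lt_add_one hx]⟩
    have h2 : |min (M : ℝ) (⌊y⌋₊ + 1) - min y M| ≤ 1 := by
      rw [min_comm y]
      refine (abs_min_sub_min_le_max _ _ _ _).trans ?_
      rw [sub_self, abs_zero]
      refine max_le zero_le_one ?_
      rw [abs_le]
      exact ⟨by linarith [Nat.lt_floor_add_one y], by linarith [Nat.floor_le hy]⟩
    refine (abs_max_sub_max_le_max _ _ _ _).trans (max_le (by simp) ?_)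
    rw [abs_le] at *
    constructor <;> linarith [h1.1, h1.2, h2.1, h2.2]

theorem measurable_latticeCount (M : ℕ) : Measurable fun p : ℝ × ℝ => latticeCount M p.1 p.2 := by
  unfold latticeCount
  refine Finset.measurable_fun_sum _ fun k _ => Measurable.ite ?_ measurable_const measurable_const
  exact (measurableSet_le measurable_fst measurable_const).inter
    (measurableSet_le measurable_const measurable_snd)

/-- Each lattice point is seen by the values of r in an interval of length u. The total is exact
whatever the mesh, and all upper bounds on section integrals rest on it. -/
theorem integral_latticeCount {δ u : ℝ} (hδ : 0 < δ) (hu : 0 ≤ u) (M : ℕ) :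
    Integrable (fun r => latticeCount M (r / δ) ((r + u) / δ)) ∧
      ∫ r, latticeCount M (r / δ) ((r + u) / δ) = M * u := by
  have e : ∀ (k : ℕ) (r : ℝ), (if r / δ ≤ k ∧ (k : ℝ) ≤ (r + u) / δ then (1 : ℝ) else 0)
      = (Icc (δ * k - u) (δ * k)).indicator (fun _ => 1) r := by
    intro k r
    rw [indicator_apply]
    refine if_congr ?_ rfl rfl
    rw [div_le_iff₀ hδ, le_div_iff₀ hδ, mem_Icc]
    constructor <;> rintro ⟨h1, h2⟩ <;> constructor <;> linarith
  have hi : ∀ k : ℕ, Integrable ((Icc (δ * k - u) (δ * k)).indicator (fun _ => (1 : ℝ))) :=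
    fun k => (integrable_indicator_iff measurableSet_Icc).2 (integrableOn_const (by simp))
  unfold latticeCount
  simp_rw [e]
  refine ⟨integrable_finsetSum _ fun k _ => hi k, ?_⟩
  rw [integral_finsetSum _ fun k _ => hi k]
  simp_rw [integral_indicator measurableSet_Icc, setIntegral_const]
  simp [Measure.real, hu]

end LatticeCount

/-! ### Section integrals and the exponent of the partial sums -/

/-- The integral of `ψ` over the horizontal sections of length `u` of a weighted sum of trawls at
the lattice times `δk`, the `j`-th weight being carried by the times with `k < M j`. -/
noncomputable def sectionIntegral {ι : Type*} [Fintype ι] (ψ : ℝ → ℂ) (w : ℝ) (z : ι → ℝ)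
    (M : ι → ℕ) (δ u : ℝ) : ℂ :=
  ∫ r, ψ (w * ∑ j, z j * latticeCount (M j) (r / δ) ((r + u) / δ))

section SectionIntegral

variable {ι : Type*} [Fintype ι] {ψ : ℝ → ℂ} {w δ : ℝ} {z : ι → ℝ} {M : ι → ℕ}

theorem abs_sum_latticeCount_le {N : ℕ} (hM : ∀ j, M j ≤ N) (x y : ℝ) :
    |w * ∑ j, z j * latticeCount (M j) x y| ≤ |w| * (∑ j, |z j|) * latticeCount N x y := by
  rw [abs_mul, mul_assoc]
  refine mul_le_mul_of_nonneg_left ?_ (abs_nonneg w)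
  refine (Finset.abs_sum_le_sum_abs _ _).trans ?_
  rw [Finset.sum_mul]
  refine Finset.sum_le_sum fun j _ => ?_
  rw [abs_mul, abs_of_nonneg (latticeCount_nonneg _ _ _)]
  exact mul_le_mul_of_nonneg_left (latticeCount_mono (hM j) _ _) (abs_nonneg _)

/-- Write c^p = c^(p-1) · c for the count c: the first factor is bounded uniformly by K^(p-1), the
second is integrated exactly. -/
theorem norm_sectionIntegral_le {C p K : ℝ} (hC : 0 ≤ C) (hp : 1 ≤ p)
    (hψ : ∀ y, ‖ψ y‖ ≤ C * |y| ^ p) (hδ : 0 < δ) {u : ℝ} (hu : 0 ≤ u) {N : ℕ} (hM : ∀ j, M j ≤ N)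
    (hK : ∀ r, latticeCount N (r / δ) ((r + u) / δ) ≤ K) :
    ‖sectionIntegral ψ w z M δ u‖ ≤ C * (|w| * ∑ j, |z j|) ^ p * K ^ (p - 1) * (N * u) := by
  obtain ⟨hi, hI⟩ := integral_latticeCount hδ hu N
  rw [← hI, ← integral_const_mul]
  refine norm_integral_le_of_norm_le (hi.const_mul _) (ae_of_all _ fun r => ?_)
  set c := latticeCount N (r / δ) ((r + u) / δ)
  have hc : 0 ≤ c := latticeCount_nonneg _ _ _
  have hZ : 0 ≤ |w| * ∑ j, |z j| := by positivity
  refine (hψ _).trans ?_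
  rw [mul_assoc C, mul_assoc C]
  refine mul_le_mul_of_nonneg_left ?_ hC
  calc |w * ∑ j, z j * latticeCount (M j) (r / δ) ((r + u) / δ)| ^ p
      ≤ ((|w| * ∑ j, |z j|) * c) ^ p :=
        Real.rpow_le_rpow (abs_nonneg _) (abs_sum_latticeCount_le hM _ _) (by linarith)
    _ = (|w| * ∑ j, |z j|) ^ p * (c ^ (p - 1) * c) := by
        rw [Real.mul_rpow hZ hc]
        congr 1
        rcases hc.eq_or_lt with h | h
        · rw [← h, Real.zero_rpow (by linarith), mul_zero]
        · rw [← Real.rpow_add_one h.ne']; simp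
    _ ≤ (|w| * ∑ j, |z j|) ^ p * (K ^ (p - 1) * c) := by
        refine mul_le_mul_of_nonneg_left (mul_le_mul_of_nonneg_right
          (Real.rpow_le_rpow hc (hK r) (by linarith)) hc) (Real.rpow_nonneg hZ _)
    _ = _ := by ring

theorem latticeCount_section_le (hδ : 0 < δ) {u : ℝ} (hu : 0 ≤ u) (N : ℕ) (r : ℝ) :
    latticeCount N (r / δ) ((r + u) / δ) ≤ u / δ + 1 := by
  refine (latticeCount_le_sub_add_one (div_le_div_of_nonneg_right (by linarith) hδ.le)).trans ?_
  rw [← sub_div, add_sub_cancel_left]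

theorem measurable_section_sum (w : ℝ) (z : ι → ℝ) (M : ι → ℕ) (δ : ℝ) :
    Measurable fun p : ℝ × ℝ =>
      w * ∑ j, z j * latticeCount (M j) (p.2 / δ) ((p.2 + p.1) / δ) := by
  refine Measurable.const_mul (Finset.measurable_fun_sum _ fun j _ => Measurable.const_mul ?_ _) _
  exact (measurable_latticeCount (M j)).comp
    ((measurable_snd.div_const δ).prodMk ((measurable_snd.add measurable_fst).div_const δ))

theorem aestronglyMeasurable_sectionIntegral (hψ : Continuous ψ) (w : ℝ) (z : ι → ℝ) (M : ι → ℕ)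
    (δ : ℝ) (μ : Measure ℝ) : AEStronglyMeasurable (sectionIntegral ψ w z M δ) μ := by
  have h : StronglyMeasurable fun p : ℝ × ℝ =>
      ψ (w * ∑ j, z j * latticeCount (M j) (p.2 / δ) ((p.2 + p.1) / δ)) :=
    (hψ.measurable.comp (measurable_section_sum w z M δ)).stronglyMeasurable
  exact h.integral_prod_right'.aestronglyMeasurable

end SectionIntegral

namespace PowerLongMemory

variable {a aprime : ℝ → ℝ} {κ ca : ℝ}

/-- The scaling theorem applied to B^(κ-1) times the indicator of u > B, which turns the asymptotics
of `aprime` into those of its tail integral a. -/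
theorem tendsto_mul_rpow (h : PowerLongMemory a aprime κ ca) {B : ℕ → ℝ}
    (hB : Tendsto B atTop atTop) :
    Tendsto (fun n => a (B n) * B n ^ (κ - 1)) atTop (𝓝 (ca / (κ - 1))) := by
  have hκ := h.two_lt
  have hi : IntegrableOn (fun v : ℝ => v ^ (-κ)) (Ioi 1) :=
    integrableOn_Ioi_rpow_of_lt (by linarith) one_pos
  have hsplit : ∀ c : ℝ, ∫ v in Ioi (0 : ℝ), (Ioi (1 : ℝ)).indicator (fun v => c * v ^ (-κ)) v
      = c * (1 / (κ - 1)) := by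
    intro c
    rw [setIntegral_indicator measurableSet_Ioi, inter_eq_right.2 (Ioi_subset_Ioi zero_le_one),
      integral_const_mul, integral_Ioi_rpow_of_lt (by linarith) one_pos, Real.one_rpow,
      show -κ + 1 = -(κ - 1) by ring, neg_div_neg_eq]
  set H : ℕ → ℝ → ℂ := fun n => (Ioi (B n)).indicator fun _ => ((B n ^ (κ - 1) : ℝ) : ℂ) with hH
  have hval : ∀ᶠ n in atTop, ∀ v, 0 < v →
      B n ^ (1 - κ) • H n (B n * v) = (Ioi (1 : ℝ)).indicator (fun _ => (1 : ℂ)) v := by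
    filter_upwards [hB.eventually_gt_atTop 0] with n hn v hv
    simp only [hH]
    by_cases h1 : 1 < v
    · rw [indicator_of_mem (mem_Ioi.2 (by nlinarith)), indicator_of_mem (mem_Ioi.2 h1),
        Complex.real_smul, ← Complex.ofReal_mul, ← Real.rpow_add hn]
      simp
    · rw [indicator_of_notMem (notMem_Ioi.2 (by nlinarith)),
        indicator_of_notMem (notMem_Ioi.2 (not_lt.1 h1)), smul_zero]
  have key := h.tendsto_integral_scaled hB (H := H)
    (g := (Ioi (1 : ℝ)).indicator (fun _ => (1 : ℂ)))
    (G := (Ioi (1 : ℝ)).indicator (fun _ => (1 : ℝ))) (ε := fun _ => 0)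
    (fun n => (measurable_const.indicator measurableSet_Ioi).aestronglyMeasurable)
    tendsto_const_nhds ?_ ?_ ?_ ?_
  · have e1 : ∫ v in Ioi (0 : ℝ), (ca * v ^ (-κ)) • (Ioi (1 : ℝ)).indicator (fun _ => (1 : ℂ)) v
        = ((ca / (κ - 1) : ℝ) : ℂ) := by
      have : ∀ v : ℝ, (ca * v ^ (-κ)) • (Ioi (1 : ℝ)).indicator (fun _ => (1 : ℂ)) v
          = (((Ioi (1 : ℝ)).indicator (fun v => ca * v ^ (-κ)) v : ℝ) : ℂ) := by
        intro v
        by_cases h1 : v ∈ Ioi (1 : ℝ) <;> simp [h1]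
      simp_rw [this]
      rw [integral_complex_ofReal, hsplit, mul_one_div]
    rw [e1] at key
    have key2 := (Complex.continuous_re.tendsto _).comp key
    rw [Complex.ofReal_re] at key2
    refine key2.congr' ?_
    filter_upwards [hB.eventually_gt_atTop 0] with n hn
    have : ∀ u : ℝ, aprime u • H n u
        = (((Ioi (B n)).indicator (fun u => aprime u * B n ^ (κ - 1)) u : ℝ) : ℂ) := by
      intro u
      simp only [hH]
      by_cases h1 : u ∈ Ioi (B n) <;> simp [h1]
    simp only [Function.comp_apply, this]
    rw [integral_complex_ofReal, Complex.ofReal_re, setIntegral_indicator measurableSet_Ioi,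
      inter_eq_right.2 (Ioi_subset_Ioi hn.le), integral_mul_const, h.eq_integral _ hn.le]
  · filter_upwards [hB.eventually_ge_atTop 1] with n hn u _ hu1
    simp only [hH]
    rw [indicator_of_notMem (notMem_Ioi.2 (hu1.trans hn)), norm_zero]
  · have : (fun v : ℝ => v ^ (-κ) * (Ioi (1 : ℝ)).indicator (fun _ => (1 : ℝ)) v)
        = (Ioi (1 : ℝ)).indicator (fun v => v ^ (-κ)) := by
      funext v
      by_cases h1 : v ∈ Ioi (1 : ℝ) <;> simp [h1]
    rw [this]
    exact ((integrable_indicator_iff measurableSet_Ioi).2 hi).integrableOn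
  · filter_upwards [hval] with n hn v hv _
    rw [hn v hv]
    by_cases h1 : v ∈ Ioi (1 : ℝ) <;> simp [h1]
  · intro v hv
    refine tendsto_const_nhds.congr' ?_
    filter_upwards [hval] with n hn
    exact (hn v hv).symm

theorem integrableOn (h : PowerLongMemory a aprime κ ca) : IntegrableOn a (Ioi 0) := by
  have hκ := h.two_lt
  obtain ⟨C, hC0, hC⟩ := h.exists_le_rpow
  have h1 : IntegrableOn a (Ioc 0 1) :=
    (h.continuousOn.mono Icc_subset_Ici_self).integrableOn_Icc.mono_set Ioc_subset_Icc_self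
  have h2 : IntegrableOn a (Ioi 1) := by
    refine ((integrableOn_Ioi_rpow_of_lt (a := 1 - κ) (by linarith) one_pos).const_mul
      (C / (κ - 1))).mono' ((h.continuousOn.mono (Ioi_subset_Ici zero_le_one)).aestronglyMeasurable
        measurableSet_Ioi) ((ae_restrict_iff' measurableSet_Ioi).2 (ae_of_all _ fun s hs => ?_))
    have hs1 : 1 < s := hs
    have hs0 : 0 < s := by linarith
    rw [Real.norm_of_nonneg (h.apply_pos hs0.le).le, h.eq_integral s hs0.le]
    have : C / (κ - 1) * s ^ (1 - κ) = ∫ y in Ioi s, C * y ^ (-κ) := by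
      rw [integral_const_mul, integral_Ioi_rpow_of_lt (by linarith) hs0,
        show -κ + 1 = -(κ - 1) by ring, neg_div_neg_eq, neg_sub]
      ring
    rw [this]
    refine setIntegral_mono_on (h.integrable.mono_set (Ioi_subset_Ioi hs0.le))
      ((integrableOn_Ioi_rpow_of_lt (by linarith) hs0).const_mul C) measurableSet_Ioi
      fun y hy => hC y ?_
    have : s < y := hy
    linarith
  rw [← Ioc_union_Ioi_eq_Ioi zero_le_one]
  exact h1.union h2

/-- The joint characteristic function of the centred partial sums of a trawl process. -/
theorem charFun_trawlSum (h : PowerLongMemory a aprime κ ca) {Ω : Type*} [MeasurableSpace Ω]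
    {P : Measure Ω} [IsProbabilityMeasure P] {L : Set (ℝ × ℝ) → Ω → ℝ} {T : LevyTriplet}
    (hL : IsHomogeneousLevyBasis P L T) (hb : T.b = 0)
    (hν : Integrable (fun x : ℝ => x ^ 2) T.ν) {ι : Type*} [Fintype ι] (w : ℝ) (z : ι → ℝ)
    (M : ι → ℕ) {δ : ℝ} (hδ : 0 < δ) :
    ∫ ω, Complex.exp (Complex.I * ((∑ j, z j * (w * trawlSum P L a δ (M j) ω) : ℝ) : ℂ)) ∂P
      = Complex.exp (∫ u in Ioi (0 : ℝ), aprime u •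
          sectionIntegral (compExponent T.ν) w z M δ u) := by
  set N := ∑ j, M j with hN
  have hMN : ∀ j, M j ≤ N := fun j =>
    Finset.single_le_sum (f := M) (fun _ _ => Nat.zero_le _) (Finset.mem_univ j)
  -- The weight of the k-th trawl collects all sums that reach it. N only has to dominate every M j;
  -- trawls beyond all of them get weight 0.
  set θ : Fin N → ℝ := fun k => w * ∑ j, z j * if (k : ℕ) < M j then 1 else 0 with hθ
  have hrange : ∀ (j : ι) (f : ℕ → ℝ), ∑ k ∈ Finset.range (M j), f k
      = ∑ k : Fin N, (if (k : ℕ) < M j then 1 else 0) * f k := by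
    intro j f
    rw [← Finset.sum_range (fun k => (if k < M j then (1 : ℝ) else 0) * f k),
      ← Finset.sum_subset (Finset.range_mono (hMN j)) (fun k _ hk => by
        rw [if_neg (by simpa using hk), zero_mul])]
    exact Finset.sum_congr rfl fun k hk => by rw [if_pos (Finset.mem_range.1 hk), one_mul]
  have hcomb : ∀ f : ℕ → ℝ, ∑ j, z j * (w * ∑ k ∈ Finset.range (M j), f k)
      = ∑ k : Fin N, θ k * f k := by
    intro f
    simp_rw [hrange, hθ, Finset.mul_sum, Finset.sum_mul]
    rw [Finset.sum_comm]
    exact Finset.sum_congr rfl fun k _ => Finset.sum_congr rfl fun j _ => by ring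
  have h1 := hL.charFun_centered hb hν (fun k : Fin N => h.measurableSet_translate (δ * (k : ℕ)))
    (fun k => h.volume_translate_lt_top h.integrableOn _) θ
  have h2 := h.integral_translate_sum h.integrableOn (fun k : Fin N => δ * (k : ℕ)) θ
    (compExponent_zero T.ν)
  rw [h2] at h1
  have e1 : ∀ ω, ∑ j, z j * (w * trawlSum P L a δ (M j) ω)
      = ∑ k : Fin N, θ k * (trawlProcess L a (δ * (k : ℕ)) ω
        - ∫ ω', trawlProcess L a (δ * (k : ℕ)) ω' ∂P) := fun ω =>
    hcomb fun k => trawlProcess L a (δ * k) ω - ∫ ω', trawlProcess L a (δ * k) ω' ∂P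
  simp_rw [e1]
  refine h1.trans ?_
  congr 1
  refine setIntegral_congr_fun measurableSet_Ioi fun u _ => ?_
  simp only [sectionIntegral]
  congr 2
  funext r
  congr 1
  have h3 := hcomb fun k => if r / δ ≤ k ∧ (k : ℝ) ≤ (r + u) / δ then 1 else 0
  have h4 : w * ∑ j, z j * latticeCount (M j) (r / δ) ((r + u) / δ)
      = ∑ j, z j * (w * latticeCount (M j) (r / δ) ((r + u) / δ)) := by
    rw [Finset.mul_sum]
    exact Finset.sum_congr rfl fun j _ => by ring
  rw [h4]
  refine Eq.trans ?_ h3.symm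
  refine Finset.sum_congr rfl fun k _ => ?_
  rw [mul_ite, mul_one, mul_zero]
  refine if_congr ?_ rfl rfl
  rw [div_le_iff₀ hδ, le_div_iff₀ hδ, mul_comm δ]

end PowerLongMemory


/-! ### Bounds and limits of rescaled section integrals -/

section Rescaling

variable {ι : Type*} [Fintype ι] {ψ : ℝ → ℂ} {z : ι → ℝ} {M : ι → ℕ}

theorem sectionIntegral_eq_smul {R : ℝ} (hR : 0 < R) (ψ : ℝ → ℂ) (w : ℝ) (z : ι → ℝ) (M : ι → ℕ)
    (δ u : ℝ) : sectionIntegral ψ w z M δ u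
      = R • ∫ s, ψ (w * ∑ j, z j * latticeCount (M j) (R * s / δ) ((R * s + u) / δ)) := by
  rw [Measure.integral_comp_mul_left
    (fun r => ψ (w * ∑ j, z j * latticeCount (M j) (r / δ) ((r + u) / δ))) R, abs_inv,
    abs_of_pos hR, smul_smul, mul_inv_cancel₀ hR.ne', one_smul, sectionIntegral]

/-- With u = bv the count is at most 2vb/δ, the hypothesis δ ≤ bv absorbing the +1. The powers of
δ/b then collapse, and only Nδ and v^p survive. -/
theorem norm_sectionIntegral_scaled_le {C p : ℝ} (hC : 0 ≤ C) (hp : 1 ≤ p)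
    (hψ : ∀ y, ‖ψ y‖ ≤ C * |y| ^ p) {δ b v D : ℝ} (hδ : 0 < δ) (hb : 0 < b) (hv : 0 < v)
    (hδv : δ ≤ b * v) {N : ℕ} (hM : ∀ j, M j ≤ N) (hD : N * δ ≤ D) :
    ‖sectionIntegral ψ (δ / b) z M δ (b * v)‖
      ≤ C * (∑ j, |z j|) ^ p * 2 ^ (p - 1) * D * v ^ p := by
  set Z := ∑ j, |z j|
  have hZ : 0 ≤ Z := by positivity
  have hw : 0 < δ / b := by positivity
  have hK : ∀ r, latticeCount N (r / δ) ((r + b * v) / δ) ≤ 2 * v * (b / δ) := fun r => by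
    refine (latticeCount_section_le hδ (by positivity) N r).trans ?_
    have : 1 ≤ b * v / δ := by rwa [one_le_div hδ]
    calc b * v / δ + 1 ≤ b * v / δ + b * v / δ := by linarith
      _ = 2 * v * (b / δ) := by ring
  refine (norm_sectionIntegral_le hC hp hψ hδ (by positivity) hM hK).trans ?_
  rw [abs_of_pos hw, Real.mul_rpow hw.le hZ, Real.mul_rpow (by positivity) (by positivity),
    Real.mul_rpow two_pos.le hv.le]
  have e1 : (δ / b) ^ p * (b / δ) ^ (p - 1) = δ / b := by
    rw [← inv_div δ b, Real.inv_rpow hw.le, ← Real.rpow_neg hw.le, ← Real.rpow_add hw]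
    simp
  have e2 : v ^ p = v ^ (p - 1) * v := by rw [← Real.rpow_add_one hv.ne']; simp
  calc C * ((δ / b) ^ p * Z ^ p) * (2 ^ (p - 1) * v ^ (p - 1) * (b / δ) ^ (p - 1)) * (N * (b * v))
      = C * Z ^ p * 2 ^ (p - 1) * (((δ / b) ^ p * (b / δ) ^ (p - 1)) * b * N)
        * (v ^ (p - 1) * v) := by ring
    _ = C * Z ^ p * 2 ^ (p - 1) * (N * δ) * v ^ p := by
        rw [e1, ← e2, div_mul_cancel₀ _ hb.ne', mul_comm δ]
    _ ≤ _ := by gcongr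

/-- Sections with u ≤ 1 hold at most 2/δ lattice points; the quadratic bound on ψ then gives D/b²,
negligible because the horizon is much smaller than b². -/
theorem norm_sectionIntegral_small_le {C : ℝ} (hC : 0 ≤ C)
    (hψ : ∀ y, ‖ψ y‖ ≤ C * |y| ^ (2 : ℝ)) {δ b u D : ℝ} (hδ : 0 < δ) (hδ1 : δ ≤ 1) (hb : 0 < b)
    (hu : 0 < u) (hu1 : u ≤ 1) {N : ℕ} (hM : ∀ j, M j ≤ N) (hD : N * δ ≤ D) :
    ‖sectionIntegral ψ (δ / b) z M δ u‖ ≤ 2 * C * (∑ j, |z j|) ^ 2 * (D / b ^ 2) := by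
  set Z := ∑ j, |z j|
  have hZ : 0 ≤ Z := by positivity
  have hw : 0 < δ / b := by positivity
  have hD0 : 0 ≤ D := le_trans (by positivity) hD
  have hK : ∀ r, latticeCount N (r / δ) ((r + u) / δ) ≤ 2 / δ := fun r => by
    refine (latticeCount_section_le hδ hu.le N r).trans ?_
    rw [div_add_one hδ.ne']
    gcongr
    linarith
  refine (norm_sectionIntegral_le hC one_le_two hψ hδ hu.le hM hK).trans ?_
  rw [abs_of_pos hw, show (2 : ℝ) - 1 = 1 by norm_num, Real.rpow_one, Real.rpow_two]
  calc C * (δ / b * Z) ^ 2 * (2 / δ) * (N * u) = 2 * C * Z ^ 2 * (N * δ / b ^ 2) * u := by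
        field_simp
    _ ≤ 2 * C * Z ^ 2 * (D / b ^ 2) * 1 := by gcongr
    _ = _ := mul_one _

/-- After division by the mesh the window starts at ns and has length bv/Δ, much smaller than n. For
0 < s < t it ends up inside [0, M n], so the count is bv/Δ up to 2. For other s it misses the range;
s = 0 and s = t are the ambiguous positions. -/
theorem tendsto_latticeCount_scaled {Δ b : ℕ → ℝ} {M : ℕ → ℕ} {t v s : ℝ} (hv : 0 ≤ v) (hΔ : ∀ n, 0 < Δ n)
    (hb : ∀ᶠ n in atTop, 0 < b n) (hΔb : Tendsto (fun n => Δ n / b n) atTop (𝓝 0))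
    (hbT : Tendsto (fun n : ℕ => b n / (n * Δ n)) atTop (𝓝 0))
    (hM1 : ∀ n : ℕ, (M n : ℝ) ≤ n * t) (hM2 : ∀ n : ℕ, n * t - 1 ≤ M n) (hs0 : s ≠ 0)
    (hst : s ≠ t) :
    Tendsto (fun n : ℕ => Δ n / b n * latticeCount (M n) (n * Δ n * s / Δ n)
      ((n * Δ n * s + b n * v) / Δ n)) atTop (𝓝 (if 0 < s ∧ s < t then v else 0)) := by
  have hbTv : Tendsto (fun n : ℕ => b n / (n * Δ n) * v) atTop (𝓝 0) := by
    simpa using hbT.mul_const v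
  have hy : ∀ᶠ n : ℕ in atTop, (n * Δ n * s + b n * v) / Δ n = n * (s + b n / (n * Δ n) * v) := by
    filter_upwards [eventually_gt_atTop 0] with n hn
    have h1 := (hΔ n).ne'
    have h2 : (n : ℝ) ≠ 0 := by exact_mod_cast hn.ne'
    field_simp
  have hx : ∀ n : ℕ, n * Δ n * s / Δ n = n * s := fun n => by
    have h1 := (hΔ n).ne'
    field_simp
  rcases lt_or_gt_of_ne hs0 with hs | hs
  · rw [if_neg (fun h => absurd h.1 (not_lt.2 hs.le))]
    refine tendsto_const_nhds.congr' ?_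
    filter_upwards [hy, hbTv.eventually (gt_mem_nhds (neg_pos.2 hs)), eventually_gt_atTop 0]
      with n h1 h2 hn
    have hn' : (0 : ℝ) < n := by exact_mod_cast hn
    rw [h1, latticeCount_of_neg (mul_neg_of_pos_of_neg hn' (by linarith)), mul_zero]
  rcases lt_or_gt_of_ne hst with ht | ht
  · rw [if_pos ⟨hs, ht⟩, tendsto_iff_norm_sub_tendsto_zero]
    refine squeeze_zero' (Eventually.of_forall fun n => norm_nonneg _) (g := fun n =>
      2 * (Δ n / b n)) ?_ (by simpa using hΔb.const_mul 2)
    -- Half of the gap t - s absorbs the rounding in M n, the other half the relative length of the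
    -- window.
    have hlarge : ∀ᶠ n : ℕ in atTop, 1 ≤ (n : ℝ) * ((t - s) / 2) :=
      (tendsto_natCast_atTop_atTop.atTop_mul_const (by linarith)).eventually_ge_atTop 1
    have hp : ∀ᶠ n : ℕ in atTop, b n / (n * Δ n) * v < (t - s) / 2 :=
      hbTv.eventually (gt_mem_nhds (by linarith))
    filter_upwards [hy, hlarge, hp, hb, eventually_gt_atTop 0] with n h1 h2 h3 h4 hn
    have hn' : (0 : ℝ) < n := by exact_mod_cast hn
    have h0 : 0 ≤ b n / (n * Δ n) * v := by have := hΔ n; positivity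
    have h5 := abs_latticeCount_sub_le (M n) (n * Δ n * s / Δ n) ((n * Δ n * s + b n * v) / Δ n)
    have hlen : max 0 (min ((n * Δ n * s + b n * v) / Δ n) (M n : ℝ)
        - max (n * Δ n * s / Δ n) 0) = b n * v / Δ n := by
      have hΔn := hΔ n
      have h6 : (n * Δ n * s + b n * v) / Δ n ≤ M n := by
        rw [h1]
        refine le_trans ?_ (hM2 n)
        nlinarith
      have h7 : 0 ≤ n * Δ n * s / Δ n := by positivity
      have h8 : (n * Δ n * s + b n * v) / Δ n - n * Δ n * s / Δ n = b n * v / Δ n := by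
        rw [← sub_div, add_sub_cancel_left]
      rw [min_eq_left h6, max_eq_left h7, h8, max_eq_right (by positivity)]
    rw [hlen] at h5
    have hw : 0 < Δ n / b n := div_pos (hΔ n) h4
    have e : v = Δ n / b n * (b n * v / Δ n) := by
      have h1 := (hΔ n).ne'
      field_simp
    calc ‖Δ n / b n * latticeCount (M n) (n * Δ n * s / Δ n) ((n * Δ n * s + b n * v) / Δ n) - v‖
        = Δ n / b n * |latticeCount (M n) (n * Δ n * s / Δ n) ((n * Δ n * s + b n * v) / Δ n)
          - b n * v / Δ n| := by
          rw [← abs_of_pos hw, ← abs_mul, abs_of_pos hw, mul_sub, ← e, Real.norm_eq_abs]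
      _ ≤ Δ n / b n * 2 := by gcongr
      _ = 2 * (Δ n / b n) := mul_comm _ _
  · rw [if_neg (fun h => absurd h.2 (not_lt.2 ht.le))]
    refine tendsto_const_nhds.congr' ?_
    filter_upwards [eventually_gt_atTop 0] with n hn
    have hn' : (0 : ℝ) < n := by exact_mod_cast hn
    rw [latticeCount_of_lt, mul_zero]
    rw [hx]
    exact (hM1 n).trans_lt (by nlinarith)

end Rescaling


/-! ### Convergence of exponents in part (i) -/

section StableRegime

/-- The exponent 1/(κ-1) lies strictly between 1/2 and 1, so the norming b satisfies b ≪ T ≪ b². -/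
theorem norming_facts {κ ca : ℝ} (hκ2 : 2 < κ) (hκ3 : κ < 3) (hca : 0 < ca) {T : ℕ → ℝ}
    (hT : Tendsto T atTop atTop) :
    Tendsto (fun n => (ca * T n) ^ (1 / (κ - 1))) atTop atTop ∧
    (∀ᶠ n in atTop, ((ca * T n) ^ (1 / (κ - 1))) ^ (1 - κ) = (ca * T n)⁻¹) ∧
    Tendsto (fun n => (ca * T n) ^ (1 / (κ - 1)) / T n) atTop (𝓝 0) ∧
    Tendsto (fun n => T n / ((ca * T n) ^ (1 / (κ - 1))) ^ 2) atTop (𝓝 0) := by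
  have hκ1 : 0 < κ - 1 := by linarith
  have hX : Tendsto (fun n => ca * T n) atTop atTop := hT.const_mul_atTop hca
  set q := 1 / (κ - 1) with hq
  have hq1 : q < 1 := by rw [hq, div_lt_one hκ1]; linarith
  have hq2 : 1 < 2 * q := by rw [hq, ← mul_div_assoc, lt_div_iff₀ hκ1]; linarith
  refine ⟨(tendsto_rpow_atTop (by linarith)).comp hX, ?_, ?_, ?_⟩
  · filter_upwards [hX.eventually_gt_atTop 0] with n hn
    rw [← Real.rpow_mul hn.le, ← Real.rpow_neg_one]
    congr 1
    rw [hq, div_mul_eq_mul_div, one_mul, div_eq_iff hκ1.ne']; ring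
  · have h := ((tendsto_rpow_neg_atTop (y := 1 - q) (by linarith)).comp hX).const_mul ca
    rw [mul_zero] at h
    refine h.congr' ?_
    filter_upwards [hX.eventually_gt_atTop 0, hT.eventually_gt_atTop 0] with n hn hn'
    simp only [Function.comp_apply]
    rw [neg_sub, Real.rpow_sub_one hn.ne']
    field_simp
  · have h := ((tendsto_rpow_neg_atTop (y := 2 * q - 1) (by linarith)).comp hX).const_mul ca⁻¹
    rw [mul_zero] at h
    refine h.congr' ?_
    filter_upwards [hX.eventually_gt_atTop 0, hT.eventually_gt_atTop 0] with n hn hn'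
    simp only [Function.comp_apply]
    rw [neg_sub, Real.rpow_sub hn, Real.rpow_one, mul_comm 2 q, Real.rpow_mul hn.le, Real.rpow_two]
    field_simp

variable {a aprime : ℝ → ℝ} {κ ca : ℝ}

/-- The scaling theorem at the scale b. The identity b^(1-κ) = (ca · nΔ)⁻¹ cancels the factor nΔ
from r = nΔ s and leaves ca⁻¹, which cancels the ca of `aprime`. -/
theorem PowerLongMemory.tendsto_integral_sectionIntegral (h : PowerLongMemory a aprime κ ca)
    {ψ : ℝ → ℂ} (hψc : Continuous ψ) {C p : ℝ} (hC : 0 ≤ C) (hp1 : 1 ≤ p)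
    (hpκ : p < κ - 1) (hψp : ∀ y, ‖ψ y‖ ≤ C * |y| ^ p) (hψ2 : ∀ y, ‖ψ y‖ ≤ C * |y| ^ (2 : ℝ))
    {Δ : ℕ → ℝ} (hΔ_pos : ∀ n, 0 < Δ n) (hΔ : Tendsto Δ atTop (𝓝 0))
    (hnΔ : Tendsto (fun n : ℕ => (n : ℝ) * Δ n) atTop atTop) {ι : Type*} [Fintype ι]
    (t z : ι → ℝ) (ht : ∀ j, 0 ≤ t j) (M : ι → ℕ → ℕ) (hM1 : ∀ j (n : ℕ), (M j n : ℝ) ≤ n * t j)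
    (hM2 : ∀ j (n : ℕ), n * t j - 1 ≤ M j n) :
    Tendsto (fun n : ℕ => ∫ u in Ioi (0 : ℝ), aprime u •
      sectionIntegral ψ (Δ n / (ca * (n * Δ n)) ^ (1 / (κ - 1))) z (fun j => M j n) (Δ n) u) atTop
      (𝓝 (∫ v in Ioi (0 : ℝ), v ^ (-κ) •
        ∫ s, ψ (v * ∑ j, if 0 < s ∧ s < t j then z j else 0))) := by
  have hκ2 := h.two_lt
  have hκ3 := h.lt_three
  have hca := h.ca_pos
  obtain ⟨hb, hbκ, hbT, hTb⟩ := norming_facts hκ2 hκ3 hca hnΔ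
  set b : ℕ → ℝ := fun n => (ca * (n * Δ n)) ^ (1 / (κ - 1)) with hbdef
  have hψ0 : ψ 0 = 0 := norm_le_zero_iff.1 (by simpa using hψ2 0)
  have hb0 : ∀ᶠ n in atTop, 0 < b n := hb.eventually_gt_atTop 0
  have hΔ1 : ∀ᶠ n in atTop, Δ n ≤ 1 := hΔ.eventually (ge_mem_nhds one_pos)
  have hw : Tendsto (fun n => Δ n / b n) atTop (𝓝 0) := hΔ.div_atTop hb
  set tm := ∑ j, t j with htm
  have htm0 : 0 ≤ tm := Finset.sum_nonneg fun j _ => ht j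
  have hjm : ∀ j, t j ≤ tm := fun j => Finset.single_le_sum (fun j _ => ht j) (Finset.mem_univ j)
  set N : ℕ → ℕ := fun n => ⌊n * tm⌋₊ with hN
  have hMN : ∀ n j, M j n ≤ N n := fun n j =>
    Nat.le_floor ((hM1 j n).trans (mul_le_mul_of_nonneg_left (hjm j) (Nat.cast_nonneg _)))
  have hNn : ∀ n : ℕ, (N n : ℝ) ≤ n * tm := fun n => Nat.floor_le (by positivity)
  have hD : ∀ n : ℕ, N n * Δ n ≤ n * Δ n * tm := fun n => by
    have := mul_le_mul_of_nonneg_right (hNn n) (hΔ_pos n).le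
    linarith
  set Z := ∑ j, |z j| with hZdef
  have hZ : 0 ≤ Z := by positivity
  set A : ℝ → ℝ := fun p => C * Z ^ p * 2 ^ (p - 1) * (tm / ca) with hA
  have hA0 : ∀ p, 0 ≤ A p := fun p => by positivity
  have hcal : ∀ p : ℝ, 1 ≤ p → (∀ y, ‖ψ y‖ ≤ C * |y| ^ p) → ∀ᶠ n in atTop, ∀ v, 0 < v →
      1 < b n * v → ‖b n ^ (1 - κ) • sectionIntegral ψ (Δ n / b n) z (fun j => M j n) (Δ n)
        (b n * v)‖ ≤ A p * v ^ p := by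
    intro p hp hψp
    filter_upwards [hb0, hΔ1, hbκ, hnΔ.eventually_gt_atTop 0] with n h1 h2 h3 h4 v hv hbv
    rw [norm_smul, Real.norm_of_nonneg (by positivity), h3]
    have h5 := norm_sectionIntegral_scaled_le (z := z) hC hp hψp (hΔ_pos n) h1 hv (h2.trans hbv.le)
      (hMN n) (hD n)
    calc (ca * (n * Δ n))⁻¹ * ‖sectionIntegral ψ (Δ n / b n) z (fun j => M j n) (Δ n) (b n * v)‖
        ≤ (ca * (n * Δ n))⁻¹ * (C * Z ^ p * 2 ^ (p - 1) * (n * Δ n * tm) * v ^ p) := by gcongr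
      _ = A p * v ^ p := by
        simp only [hA]
        have := hca.ne'
        have := h4.ne'
        have h6 : (n : ℝ) ≠ 0 := fun h => by simp [h] at h4
        have := (hΔ_pos n).ne'
        field_simp
  -- The minimum in G is needed at both ends: against v^(-κ), the quadratic bound is integrable at 0
  -- since κ < 3, and the bound of order p at infinity since p < κ - 1.
  have key := h.tendsto_integral_scaled hb
    (H := fun n u => sectionIntegral ψ (Δ n / b n) z (fun j => M j n) (Δ n) u)
    (g := fun v => ca⁻¹ • ∫ s, ψ (v * ∑ j, if 0 < s ∧ s < t j then z j else 0))
    (G := fun v => min (A p * v ^ p) (A 2 * v ^ (2 : ℝ)))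
    (ε := fun n => 2 * C * Z ^ 2 * (n * Δ n * tm / b n ^ 2))
    (fun n => aestronglyMeasurable_sectionIntegral hψc _ _ _ _ _) ?_ ?_ ?_ ?_ ?_
  · refine key.trans (le_of_eq ?_)
    congr 1
    refine setIntegral_congr_fun measurableSet_Ioi fun v _ => ?_
    rw [smul_smul]
    congr 1
    field_simp
  · have := (hTb.mul_const tm).const_mul (2 * C * Z ^ 2)
    rw [zero_mul, mul_zero] at this
    exact this.congr fun n => by ring
  · filter_upwards [hb0, hΔ1] with n h1 h2 u hu hu1
    exact norm_sectionIntegral_small_le hC hψ2 (hΔ_pos n) h2 h1 hu hu1 (hMN n) (hD n)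
  · refine integrableOn_Ioi_of_norm_le_rpow (a := 2 - κ) (b := p - κ) (C := max (A p) (A 2))
      (Measurable.aestronglyMeasurable (by fun_prop)) (by linarith) (by linarith) ?_ ?_
    · intro v hv _
      have hm : 0 ≤ min (A p * v ^ p) (A 2 * v ^ (2 : ℝ)) :=
        le_min (mul_nonneg (hA0 _) (by positivity)) (mul_nonneg (hA0 _) (by positivity))
      rw [Real.norm_of_nonneg (by positivity), sub_eq_neg_add, Real.rpow_add hv]
      calc v ^ (-κ) * min (A p * v ^ p) (A 2 * v ^ (2 : ℝ))
          ≤ v ^ (-κ) * (max (A p) (A 2) * v ^ (2 : ℝ)) := by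
            gcongr
            exact (min_le_right _ _).trans (by gcongr; exact le_max_right _ _)
        _ = _ := by ring
    · intro v hv1
      have hv : 0 < v := one_pos.trans hv1
      have hm : 0 ≤ min (A p * v ^ p) (A 2 * v ^ (2 : ℝ)) :=
        le_min (mul_nonneg (hA0 _) (by positivity)) (mul_nonneg (hA0 _) (by positivity))
      rw [Real.norm_of_nonneg (by positivity), sub_eq_neg_add, Real.rpow_add hv]
      calc v ^ (-κ) * min (A p * v ^ p) (A 2 * v ^ (2 : ℝ))
          ≤ v ^ (-κ) * (max (A p) (A 2) * v ^ p) := by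
            gcongr
            exact (min_le_left _ _).trans (by gcongr; exact le_max_left _ _)
        _ = _ := by ring
  · filter_upwards [hcal p hp1 hψp, hcal 2 one_le_two hψ2] with n h1 h2 v hv hbv
    exact le_min (h1 v hv hbv) (h2 v hv hbv)
  · intro v hv
    set F : ℕ → ℝ → ℂ := fun n s => ψ (Δ n / b n * ∑ j, z j *
      latticeCount (M j n) (n * Δ n * s / Δ n) ((n * Δ n * s + b n * v) / Δ n)) with hF
    have hlim : Tendsto (fun n => ∫ s, F n s) atTop
        (𝓝 (∫ s, ψ (v * ∑ j, if 0 < s ∧ s < t j then z j else 0))) := by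
      -- Once b < nΔ, the window is empty of lattice times for s outside [-v, tm]; inside, the
      -- scaled count is at most v + 1.
      refine tendsto_integral_filter_of_dominated_convergence
        ((Icc (-v) tm).indicator fun _ => C * (Z * (v + 1)) ^ (2 : ℝ)) ?_ ?_
        ((integrable_indicator_iff measurableSet_Icc).2 (integrableOn_const (by simp))) ?_
      · refine Eventually.of_forall fun n => Measurable.aestronglyMeasurable ?_
        refine hψc.measurable.comp (Measurable.const_mul (Finset.measurable_fun_sum _ fun j _ =>
          Measurable.const_mul ?_ _) _)
        have hm : Measurable fun s : ℝ =>
          ((n * Δ n * s / Δ n, (n * Δ n * s + b n * v) / Δ n) : ℝ × ℝ) := by fun_prop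
        exact (measurable_latticeCount (M j n)).comp hm
      · filter_upwards [hb0, hbT.eventually (gt_mem_nhds one_pos), hw.eventually
          (ge_mem_nhds one_pos), hnΔ.eventually_gt_atTop 0, eventually_gt_atTop 0]
          with n h1 h2 h3 h4 hn
        refine ae_of_all _ fun s => ?_
        have hn' : (0 : ℝ) < n := by exact_mod_cast hn
        have hΔn := hΔ_pos n
        by_cases hs : s ∈ Icc (-v) tm
        · rw [indicator_of_mem hs]
          refine (hψ2 _).trans ?_
          refine mul_le_mul_of_nonneg_left (Real.rpow_le_rpow (abs_nonneg _) ?_ two_pos.le) hC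
          refine (abs_sum_latticeCount_le (hMN n) _ _).trans ?_
          have hwp : 0 < Δ n / b n := by positivity
          rw [abs_of_pos hwp]
          calc Δ n / b n * Z * latticeCount (N n) (n * Δ n * s / Δ n)
                ((n * Δ n * s + b n * v) / Δ n)
              ≤ Δ n / b n * Z * (b n * v / Δ n + 1) := by
                gcongr
                exact latticeCount_section_le hΔn (by positivity) _ _
            _ = Z * (v + Δ n / b n) := by field_simp
            _ ≤ Z * (v + 1) := by gcongr
        · rw [indicator_of_notMem hs]
          have hz : ∀ j, latticeCount (M j n) (n * Δ n * s / Δ n)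
              ((n * Δ n * s + b n * v) / Δ n) = 0 := by
            intro j
            rw [mem_Icc, not_and_or, not_le, not_le] at hs
            rcases hs with hs | hs
            · refine latticeCount_of_neg (div_neg_of_neg_of_pos ?_ hΔn)
              rw [div_lt_one h4] at h2
              nlinarith
            · refine latticeCount_of_lt ?_
              have e : n * Δ n * s / Δ n = n * s := by field_simp
              rw [e]
              refine (hM1 j n).trans_lt ?_
              have := hjm j
              nlinarith
          simp [hF, hz, hψ0]
      · have hfin : ∀ᵐ s : ℝ, s ≠ 0 ∧ ∀ j, s ≠ t j := by
          have h1 : ∀ c : ℝ, ∀ᵐ s : ℝ, s ≠ c := fun c => by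
            simp [ae_iff]
          exact (h1 0).and (ae_all_iff.2 fun j => h1 (t j))
        filter_upwards [hfin] with s hs
        refine (hψc.tendsto _).comp ?_
        simp_rw [Finset.mul_sum]
        refine tendsto_finsetSum _ fun j _ => ?_
        have h1 := (tendsto_latticeCount_scaled (v := v) hv.le hΔ_pos hb0 hw hbT (hM1 j) (hM2 j)
          hs.1 (hs.2 j)).const_mul (z j)
        have e : z j * (if 0 < s ∧ s < t j then v else 0)
            = v * if 0 < s ∧ s < t j then z j else 0 := by
          split_ifs <;> ring
        rw [e] at h1
        exact h1.congr fun n => by ring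
    refine (hlim.const_smul ca⁻¹).congr' ?_
    filter_upwards [hbκ, hnΔ.eventually_gt_atTop 0] with n h1 h2
    rw [sectionIntegral_eq_smul h2, smul_smul, h1, mul_inv, inv_mul_cancel_right₀ h2.ne']

end StableRegime


/-! ### Moments of ν and identification of the limit exponent -/

section LevyMeasure

/-- x² ν(dx) is finite and, as ν has no mass at 0, ν is recovered from it by the density x⁻².
Fubini's theorem needs this. -/
theorem sFinite_of_integrable_sq {ν : Measure ℝ} (h0 : ν {0} = 0)
    (h : Integrable (fun x : ℝ => x ^ 2) ν) : SFinite ν := by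
  have hf : Measurable fun x : ℝ => ENNReal.ofReal (x ^ 2) := by fun_prop
  have hfin : IsFiniteMeasure (ν.withDensity fun x => ENNReal.ofReal (x ^ 2)) :=
    isFiniteMeasure_withDensity_ofReal h.2
  have hne : ∀ᵐ x ∂ν, ENNReal.ofReal (x ^ 2) ≠ 0 := by
    have : ∀ᵐ x ∂ν, x ≠ 0 := by simpa [ae_iff] using h0
    filter_upwards [this] with x hx
    have : 0 < x ^ 2 := by positivity
    simpa using hx
  rw [← withDensity_inv_same hf hne (ae_of_all _ fun x => ENNReal.ofReal_ne_top)]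
  infer_instance

theorem integrable_abs_rpow_of_blumenthalGetoor_lt {ν : Measure ℝ}
    (h2 : Integrable (fun x : ℝ => x ^ 2) ν) {q : ℝ} (hq : blumenthalGetoor ν < q) (hq2 : q ≤ 2) :
    Integrable (fun x : ℝ => |x| ^ q) ν := by
  have hm : MeasurableSet {x : ℝ | |x| ≤ 1} := measurableSet_le measurable_id.abs measurable_const
  -- The value 2 belongs to the set, so the infimum is a genuine one and not the default value of
  -- `sInf ∅`.
  have hne : {β : ℝ | 0 < β ∧ ∫⁻ x in {x : ℝ | |x| ≤ 1}, ENNReal.ofReal (|x| ^ β) ∂ν < ∞}.Nonempty := by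
    refine ⟨2, two_pos, ?_⟩
    have := h2.lintegral_lt_top
    simp only [Real.rpow_two, sq_abs]
    exact (setLIntegral_le_lintegral _ _).trans_lt this
  obtain ⟨β, ⟨hβ0, hβ⟩, hβq⟩ := exists_lt_of_csInf_lt hne hq
  have hmeas : ∀ r : ℝ, AEStronglyMeasurable (fun x : ℝ => |x| ^ r) ν := fun r =>
    Measurable.aestronglyMeasurable (by fun_prop)
  have h1 : IntegrableOn (fun x : ℝ => |x| ^ β) {x : ℝ | |x| ≤ 1} ν :=
    ⟨(hmeas β).restrict, by
      rwa [hasFiniteIntegral_iff_ofReal (ae_of_all _ fun x => by positivity)]⟩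
  have h1' := (integrable_indicator_iff hm).2 h1
  refine (h1'.add h2).mono' (hmeas q) (ae_of_all _ fun x => ?_)
  rw [Real.norm_of_nonneg (by positivity)]
  simp only [Pi.add_apply]
  by_cases hx : |x| ≤ 1
  · rw [indicator_of_mem (by exact hx)]
    rcases eq_or_ne x 0 with rfl | hx0
    · simp [Real.zero_rpow (by linarith : q ≠ 0), Real.zero_rpow hβ0.ne']
    · have := Real.rpow_le_rpow_of_exponent_ge (abs_pos.2 hx0) hx hβq.le
      linarith [sq_nonneg x]
  · rw [indicator_of_notMem (by exact hx), zero_add, ← sq_abs, ← Real.rpow_two]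
    exact Real.rpow_le_rpow_of_exponent_le (not_le.1 hx).le hq2

theorem norm_compExponent_le_rpow {ν : Measure ℝ} {p : ℝ} (hp1 : 1 ≤ p) (hp2 : p ≤ 2)
    (h : Integrable (fun x : ℝ => |x| ^ p) ν) (y : ℝ) :
    ‖compExponent ν y‖ ≤ 3 * (∫ x, |x| ^ p ∂ν) * |y| ^ p := by
  rw [compExponent, show 3 * (∫ x, |x| ^ p ∂ν) * |y| ^ p = ∫ x, (3 * |y| ^ p) * |x| ^ p ∂ν by
    rw [integral_const_mul]; ring]
  refine norm_integral_le_of_norm_le (h.const_mul _) (ae_of_all _ fun x => ?_)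
  have := norm_compExp_le_rpow hp1 hp2 (y * x)
  rwa [abs_mul, Real.mul_rpow (abs_nonneg _) (abs_nonneg _), ← mul_assoc] at this

theorem integrableOn_rpow_mul_min_rpow {β p : ℝ} (hp : p < β) (hβ2 : β < 2) :
    IntegrableOn (fun v : ℝ => v ^ (-1 - β) * min (v ^ p) (v ^ (2 : ℝ))) (Ioi 0) := by
  refine integrableOn_Ioi_of_norm_le_rpow (a := 1 - β) (b := p - β - 1) (C := 1)
    (Measurable.aestronglyMeasurable (by fun_prop)) (by linarith) (by linarith) ?_ ?_
  · intro v hv _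
    rw [Real.norm_of_nonneg (by positivity), one_mul, show 1 - β = (-1 - β) + 2 by ring,
      Real.rpow_add hv]
    gcongr
    exact min_le_right _ _
  · intro v hv1
    have hv : 0 < v := one_pos.trans hv1
    rw [Real.norm_of_nonneg (by positivity), one_mul, show p - β - 1 = (-1 - β) + p by ring,
      Real.rpow_add hv]
    gcongr
    exact min_le_left _ _

/-- Separates the variables: the min of two powers of the product vx is bounded by a function of v
times a function of x, as a product-measure domination requires. -/
theorem le_min_rpow_mul {p f C x v : ℝ} (hp2 : p ≤ 2) (hC : 0 ≤ C) (hv : 0 < v)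
    (h1 : f ≤ C * |v * x| ^ p) (h2 : f ≤ C * |v * x| ^ (2 : ℝ)) :
    f ≤ min (v ^ p) (v ^ (2 : ℝ)) * (C * (|x| ^ p + |x| ^ (2 : ℝ))) := by
  rw [abs_mul, abs_of_pos hv, Real.mul_rpow hv.le (abs_nonneg _)] at h1 h2
  have hx1 : 0 ≤ |x| ^ p := by positivity
  have hx2 : 0 ≤ |x| ^ (2 : ℝ) := by positivity
  rcases le_total v 1 with h | h
  · rw [min_eq_right (Real.rpow_le_rpow_of_exponent_ge hv h hp2)]
    refine h2.trans ?_
    rw [mul_left_comm]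
    gcongr
    linarith
  · rw [min_eq_left (Real.rpow_le_rpow_of_exponent_le h hp2)]
    refine h1.trans ?_
    rw [mul_left_comm]
    gcongr
    linarith

/-- Fubini: for a fixed jump x the v-integral is a one-sided stable exponent at xy, and homogeneity
pulls out |x|^β. Integrating over ν leaves the moments of the two half-lines. -/
theorem integral_rpow_smul_compExponent {ν : Measure ℝ} (h0 : ν {0} = 0)
    (h2 : Integrable (fun x : ℝ => x ^ 2) ν) {β p : ℝ} (hp1 : 1 ≤ p) (hpβ : p < β) (hβ2 : β < 2)
    (hp : Integrable (fun x : ℝ => |x| ^ p) ν) (hβ : Integrable (fun x : ℝ => |x| ^ β) ν) (y : ℝ) :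
    ∫ v in Ioi (0 : ℝ), v ^ (-1 - β) • compExponent ν (v * y)
      = stableSymbol β (∫ x in Ioi (0 : ℝ), x ^ β ∂ν) (∫ x in Iio (0 : ℝ), |x| ^ β ∂ν) y := by
  have hsf : SFinite ν := sFinite_of_integrable_sq h0 h2
  have hβ1 : 1 < β := by linarith
  have hβ0 : β ≠ 0 := by linarith
  have hswap : ∫ v in Ioi (0 : ℝ), ∫ x, v ^ (-1 - β) • compExp (v * y * x) ∂ν
      = ∫ x, (∫ v in Ioi (0 : ℝ), v ^ (-1 - β) • compExp (v * y * x)) ∂ν := by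
    refine integral_integral_swap ?_
    have hbd := (integrableOn_rpow_mul_min_rpow hpβ hβ2).mul_prod
      (((hp.const_mul (|y| ^ p)).add ((h2.const_mul (y ^ 2)))).const_mul 3)
    refine hbd.mono' (Measurable.aestronglyMeasurable ?_) ?_
    · unfold Function.uncurry
      have hc := continuous_compExp.measurable
      exact Measurable.smul (f := fun q : ℝ × ℝ => q.1 ^ (-1 - β)) (by fun_prop) (hc.comp (by fun_prop))
    · have hae : ∀ᵐ q ∂((volume.restrict (Ioi (0 : ℝ))).prod ν), q.1 ∈ Ioi (0 : ℝ) :=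
        Measure.quasiMeasurePreserving_fst.ae (ae_restrict_mem measurableSet_Ioi)
      filter_upwards [hae] with q hq
      have hq' : 0 < q.1 := hq
      simp only [Function.uncurry, Pi.add_apply]
      rw [norm_smul, Real.norm_of_nonneg (Real.rpow_nonneg hq'.le _), mul_assoc (q.1 ^ (-1 - β))]
      refine mul_le_mul_of_nonneg_left ?_ (by positivity)
      have h4 := norm_compExp_le_rpow hp1 (hpβ.trans hβ2).le (q.1 * y * q.2)
      have h5 := norm_compExp_le_rpow one_le_two le_rfl (q.1 * y * q.2)
      rw [mul_assoc] at h4 h5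
      have h3 := le_min_rpow_mul (hpβ.trans hβ2).le zero_le_three hq' h4 h5
      rw [mul_assoc]
      refine h3.trans (le_of_eq ?_)
      rw [abs_mul, Real.mul_rpow (abs_nonneg _) (abs_nonneg _),
        Real.mul_rpow (abs_nonneg _) (abs_nonneg _)]
      simp only [Real.rpow_two, sq_abs]
  have e1 : ∀ v : ℝ, v ^ (-1 - β) • compExponent ν (v * y)
      = ∫ x, v ^ (-1 - β) • compExp (v * y * x) ∂ν := fun v => by
    rw [integral_smul, compExponent]
  simp_rw [e1]
  rw [hswap]
  have e2 : ∀ x : ℝ, ∫ v in Ioi (0 : ℝ), v ^ (-1 - β) • compExp (v * y * x)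
      = (((Ioi (0 : ℝ)).indicator (fun x => x ^ β) x : ℝ) : ℂ) * stableSymbol β 1 0 y
        + (((Iio (0 : ℝ)).indicator (fun x => |x| ^ β) x : ℝ) : ℂ) * stableSymbol β 1 0 (-y) := by
    intro x
    have e3 : ∫ v in Ioi (0 : ℝ), v ^ (-1 - β) • compExp (v * y * x) = stableSymbol β 1 0 (x * y) := by
      rw [← integral_compExp_mul_rpow hβ1]
      refine setIntegral_congr_fun measurableSet_Ioi fun v _ => ?_
      rw [Complex.real_smul, mul_comm, show v * y * x = x * y * v by ring]
    rw [e3]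
    rcases lt_trichotomy x 0 with hx | rfl | hx
    · rw [indicator_of_notMem (notMem_Ioi.2 hx.le), indicator_of_mem (mem_Iio.2 hx),
        show x * y = (-x) * (-y) by ring, stableSymbol_mul_left (by linarith), abs_of_neg hx]
      simp
    · simp [stableSymbol_zero hβ0]
    · rw [indicator_of_mem (mem_Ioi.2 hx), indicator_of_notMem (notMem_Iio.2 hx.le),
        stableSymbol_mul_left hx]
      simp
  simp_rw [e2]
  have i1 : Integrable ((Ioi (0 : ℝ)).indicator (fun x : ℝ => x ^ β)) ν := by
    rw [integrable_indicator_iff measurableSet_Ioi]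
    exact hβ.integrableOn.congr_fun (fun x hx => by
      beta_reduce
      rw [abs_of_pos (mem_Ioi.1 hx)]) measurableSet_Ioi
  have i2 : Integrable ((Iio (0 : ℝ)).indicator (fun x : ℝ => |x| ^ β)) ν :=
    (integrable_indicator_iff measurableSet_Iio).2 hβ.integrableOn
  rw [integral_add (i1.ofReal.mul_const _) (i2.ofReal.mul_const _), integral_mul_const,
    integral_mul_const]
  have e4 : ∀ f : ℝ → ℝ, ∫ x, ((f x : ℝ) : ℂ) ∂ν = ((∫ x, f x ∂ν : ℝ) : ℂ) := fun f =>
    integral_complex_ofReal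
  refine Eq.trans ?_ (stableSymbol_combine hβ0 y)
  rw [← integral_indicator measurableSet_Ioi, ← integral_indicator measurableSet_Iio, ← e4, ← e4]

theorem moments_pos {ν : Measure ℝ} (h0 : ν {0} = 0) (hν : ν ≠ 0) {β : ℝ}
    (hβ : Integrable (fun x : ℝ => |x| ^ β) ν) :
    0 < (∫ x in Ioi (0 : ℝ), x ^ β ∂ν) + ∫ x in Iio (0 : ℝ), |x| ^ β ∂ν := by
  have h1 : ∫ x in Ioi (0 : ℝ), x ^ β ∂ν = ∫ x in Ioi (0 : ℝ), |x| ^ β ∂ν :=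
    setIntegral_congr_fun measurableSet_Ioi fun x hx => by
      simp only [abs_of_pos (mem_Ioi.1 hx)]
  have h2 : ∫ x in Iio (0 : ℝ), |x| ^ β ∂ν = ∫ x in Iic (0 : ℝ), |x| ^ β ∂ν :=
    setIntegral_congr_set (Iio_ae_eq_Iic' h0)
  rw [h1, h2, add_comm, intervalIntegral.integral_Iic_add_Ioi hβ.integrableOn hβ.integrableOn,
    integral_pos_iff_support_of_nonneg (fun x => by positivity) hβ, pos_iff_ne_zero]
  intro h3
  refine hν (Measure.measure_univ_eq_zero.1 ?_)
  have h4 : (univ : Set ℝ) ⊆ Function.support (fun x : ℝ => |x| ^ β) ∪ {0} := by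
    intro x _
    by_cases hx : x = 0
    · exact Or.inr hx
    · exact Or.inl (Real.rpow_pos_of_pos (abs_pos.2 hx) _).ne'
  exact measure_mono_null h4 (measure_union_null h3 h0)

/-- Fubini in v and s: with s fixed, the v-integral is φ at the step function of s, and what remains
is by definition the joint exponent. -/
theorem integral_rpow_smul_integral_eq_levyJointExponent {ψ : ℝ → ℂ} (hψc : Continuous ψ)
    {C p β : ℝ} (hC : 0 ≤ C) (hpβ : p < β) (hβ2 : β < 2) (hβ0 : 0 < p)
    (hψp : ∀ y, ‖ψ y‖ ≤ C * |y| ^ p) (hψ2 : ∀ y, ‖ψ y‖ ≤ C * |y| ^ (2 : ℝ))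
    {φ : ℝ → ℂ} (hφ : ∀ y, ∫ v in Ioi (0 : ℝ), v ^ (-1 - β) • ψ (v * y) = φ y)
    {ι : Type*} [Fintype ι] (t : ι → ℝ≥0) (z : ι → ℝ) :
    ∫ v in Ioi (0 : ℝ), v ^ (-1 - β) • ∫ s : ℝ, ψ (v * ∑ j, if 0 < s ∧ s < (t j : ℝ) then z j else 0)
      = levyJointExponent φ t z := by
  have hψ0 : ψ 0 = 0 := norm_le_zero_iff.1 (by simpa using hψ2 0)
  set Θ : ℝ → ℝ := fun s => ∑ j, if s < (t j : ℝ) then z j else 0 with hΘ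
  have hΘm : Measurable Θ := Finset.measurable_fun_sum _ fun j _ =>
    Measurable.ite measurableSet_Iio measurable_const measurable_const
  have hinner : ∀ v : ℝ, ∫ s : ℝ, ψ (v * ∑ j, if 0 < s ∧ s < (t j : ℝ) then z j else 0)
      = ∫ s in Ioi (0 : ℝ), ψ (v * Θ s) := by
    intro v
    rw [← integral_indicator measurableSet_Ioi]
    congr 1
    funext s
    by_cases hs : 0 < s
    · rw [indicator_of_mem (mem_Ioi.2 hs)]
      simp [hΘ, hs]
    · rw [indicator_of_notMem (notMem_Ioi.2 (not_lt.1 hs))]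
      simp [hs, hψ0]
  simp_rw [hinner, ← integral_smul]
  have hΘb : ∀ r : ℝ, 0 < r → IntegrableOn (fun s => |Θ s| ^ r) (Ioi 0) := by
    intro r hr
    set tm : ℝ := ∑ j, (t j : ℝ)
    have hjm : ∀ j, (t j : ℝ) ≤ tm := fun j =>
      Finset.single_le_sum (fun j _ => NNReal.coe_nonneg (t j)) (Finset.mem_univ j)
    refine Integrable.mono' (g := (Ioc (0 : ℝ) tm).indicator fun _ => (∑ j, |z j|) ^ r)
      ((integrable_indicator_iff measurableSet_Ioc).2
        (integrableOn_const (((Measure.restrict_apply_le _ _).trans_lt (by simp)).ne)))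
      (Measurable.aestronglyMeasurable (by fun_prop))
      ((ae_restrict_iff' measurableSet_Ioi).2 (ae_of_all _ fun s hs => ?_))
    rw [Real.norm_of_nonneg (by positivity)]
    by_cases h : s ≤ tm
    · rw [indicator_of_mem (show s ∈ Ioc 0 tm from ⟨hs, h⟩)]
      refine Real.rpow_le_rpow (abs_nonneg _) ((Finset.abs_sum_le_sum_abs _ _).trans
        (Finset.sum_le_sum fun j _ => ?_)) hr.le
      split_ifs <;> simp
    · have : Θ s = 0 := Finset.sum_eq_zero fun j _ => if_neg (by
        have := hjm j; linarith [not_le.1 h])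
      rw [this, abs_zero, Real.zero_rpow hr.ne']
      exact indicator_nonneg (fun _ _ => by positivity) _
  rw [integral_integral_swap]
  · simp_rw [hφ]
    rfl
  · have hbd := (integrableOn_rpow_mul_min_rpow hpβ hβ2).mul_prod
      (((hΘb p hβ0).add (hΘb 2 two_pos)).const_mul C)
    refine hbd.mono' (Measurable.aestronglyMeasurable ?_) ?_
    · unfold Function.uncurry
      have hc := hψc.measurable
      exact Measurable.smul (f := fun q : ℝ × ℝ => q.1 ^ (-1 - β)) (by fun_prop) (hc.comp (by fun_prop))
    · have hae : ∀ᵐ q ∂((volume.restrict (Ioi (0 : ℝ))).prod (volume.restrict (Ioi (0 : ℝ)))),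
          q.1 ∈ Ioi (0 : ℝ) :=
        Measure.quasiMeasurePreserving_fst.ae (ae_restrict_mem measurableSet_Ioi)
      filter_upwards [hae] with q hq
      have hq' : 0 < q.1 := hq
      simp only [Function.uncurry, Pi.add_apply]
      rw [norm_smul, Real.norm_of_nonneg (by positivity), mul_assoc]
      exact mul_le_mul_of_nonneg_left (le_min_rpow_mul (by linarith) hC hq' (hψp _) (hψ2 _))
        (by positivity)

end LevyMeasure


/-! ### Assembly of part (i) -/

section StableRegime

variable {Ω : Type*} [MeasurableSpace Ω] {P : Measure Ω} {T : LevyTriplet}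
  {L : Set (ℝ × ℝ) → Ω → ℝ} {a aprime : ℝ → ℝ} {κ ca : ℝ}

theorem PowerLongMemory.measurable_trawlSum (h : PowerLongMemory a aprime κ ca)
    (hL : IsHomogeneousLevyBasis P L T) (δ : ℝ) (m : ℕ) : Measurable (trawlSum P L a δ m) := by
  unfold trawlSum
  refine Finset.measurable_fun_sum _ fun k _ => Measurable.sub_const ?_ _
  exact hL.measurable _ (h.measurableSet_translate _) (h.volume_translate_lt_top h.integrableOn _)

/-- Convergence of the partial sums of a trawl process to a stable Lévy process, when the small
jumps are not too active. -/
theorem PowerLongMemory.exists_tendstoFDD_stable [IsProbabilityMeasure P]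
    (hL : IsHomogeneousLevyBasis P L T) (hb : T.b = 0)
    (hν2 : Integrable (fun x : ℝ => x ^ 2) T.ν) (ha : PowerLongMemory a aprime κ ca)
    {Δ : ℕ → ℝ} (hΔ_pos : ∀ n, 0 < Δ n) (hΔ : Tendsto Δ atTop (𝓝 0))
    (hnΔ : Tendsto (fun n : ℕ => (n : ℝ) * Δ n) atTop atTop) (hν : T.ν ≠ 0)
    (hBG : blumenthalGetoor T.ν < κ - 1) :
    Integrable (fun x : ℝ => |x| ^ (κ - 1)) T.ν ∧
      ∃ Kp Km γ : ℝ,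
        Kp = ∫ x in Ioi (0 : ℝ), x ^ (κ - 1) ∂T.ν ∧
        Km = ∫ x in Iio (0 : ℝ), |x| ^ (κ - 1) ∂T.ν ∧
        ∃ (Ω' : Type) (_ : MeasurableSpace Ω') (P' : Measure Ω') (_ : IsProbabilityMeasure P')
          (Y : ℝ≥0 → Ω' → ℝ),
          IsLevyProcess P' Y ∧
          IsStrictlyStableLaw (κ - 1) Kp Km γ (P'.map (Y 1)) ∧
          (∀ z : ℝ, charFun (P'.map (Y 1)) z = Complex.exp (stableExponent (κ - 1) Kp Km γ z)) ∧
          TendstoFDD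
            (fun n t ω => Δ n / (ca * (n * Δ n)) ^ (1 / (κ - 1)) * trawlSumProcess P L a Δ n t ω)
            P Y P' := by
  have hκ2 := ha.two_lt
  have hκ3 := ha.lt_three
  set β := κ - 1 with hβ
  have hβ1 : 1 < β := by linarith
  have hβ2 : β < 2 := by linarith
  have hβ0 : 0 < β := by linarith
  have hint : Integrable (fun x : ℝ => |x| ^ β) T.ν :=
    integrable_abs_rpow_of_blumenthalGetoor_lt hν2 hBG hβ2.le
  refine ⟨hint, ?_⟩
  -- The midpoint leaves room on both sides: p ≥ 1 for the interpolation bound, p above the index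
  -- for the moment, p < κ - 1 for integrability at infinity.
  set p := (max 1 (blumenthalGetoor T.ν) + β) / 2 with hp
  have hmax : max 1 (blumenthalGetoor T.ν) < β := max_lt hβ1 hBG
  have hp1 : 1 ≤ p := by linarith [le_max_left 1 (blumenthalGetoor T.ν)]
  have hpBG : blumenthalGetoor T.ν < p := by linarith [le_max_right 1 (blumenthalGetoor T.ν)]
  have hpβ : p < β := by linarith
  have hintp : Integrable (fun x : ℝ => |x| ^ p) T.ν :=
    integrable_abs_rpow_of_blumenthalGetoor_lt hν2 hpBG (by linarith)
  set Kp := ∫ x in Ioi (0 : ℝ), x ^ β ∂T.ν with hKp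
  set Km := ∫ x in Iio (0 : ℝ), |x| ^ β ∂T.ν with hKm
  have hKp0 : 0 ≤ Kp := setIntegral_nonneg measurableSet_Ioi fun x hx =>
    Real.rpow_nonneg (le_of_lt hx) _
  have hKm0 : 0 ≤ Km := setIntegral_nonneg measurableSet_Iio fun x _ => by positivity
  have hK : 0 < Kp + Km := moments_pos T.ν_zero hν hint
  set ψ := compExponent T.ν with hψ
  set C := max (3 * ∫ x, |x| ^ p ∂T.ν) (3 * ∫ x, x ^ 2 ∂T.ν) with hC
  have hC0 : 0 ≤ C := le_max_of_le_right
    (mul_nonneg (by norm_num) (integral_nonneg fun x => sq_nonneg x))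
  have hψc : Continuous ψ := continuous_compExponent hν2
  have hψp : ∀ y, ‖ψ y‖ ≤ C * |y| ^ p := fun y =>
    (norm_compExponent_le_rpow hp1 (by linarith) hintp y).trans
      (mul_le_mul_of_nonneg_right (le_max_left _ _) (by positivity))
  have hψ2 : ∀ y, ‖ψ y‖ ≤ C * |y| ^ (2 : ℝ) := fun y => by
    rw [Real.rpow_two, sq_abs]
    exact (norm_compExponent_le_sq hν2 y).trans
      (mul_le_mul_of_nonneg_right (le_max_right _ _) (by positivity))
  obtain ⟨Ω', mΩ', P', hP', Y, hY, hYc, hFDD⟩ := exists_isLevyProcess_tendstoFDD P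
    (fun n t ω => Δ n / (ca * (n * Δ n)) ^ (1 / β) * trawlSumProcess P L a Δ n t ω)
    (fun n t => (ha.measurable_trawlSum hL _ _).const_mul _)
    (continuous_stableSymbol hβ0 Kp Km) (stableSymbol_zero hβ0.ne' Kp Km)
    (fun ι _ t z => by
      have h1 := ha.tendsto_integral_sectionIntegral hψc hC0 hp1 hpβ hψp hψ2 hΔ_pos hΔ hnΔ
        (fun j => (t j : ℝ)) z (fun j => NNReal.coe_nonneg _) (fun j n => ⌊(n : ℝ≥0) * t j⌋₊)
        (fun j n => by
          have : ((⌊(n : ℝ≥0) * t j⌋₊ : ℕ) : ℝ≥0) ≤ n * t j := Nat.floor_le (by positivity)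
          exact_mod_cast this)
        (fun j n => by
          have := (Nat.lt_floor_add_one ((n : ℝ≥0) * t j)).le
          have h2 : (n : ℝ) * t j ≤ ⌊(n : ℝ≥0) * t j⌋₊ + 1 := by exact_mod_cast this
          linarith)
      have h2 := integral_rpow_smul_integral_eq_levyJointExponent hψc hC0 hpβ hβ2 (by linarith)
        hψp hψ2 (integral_rpow_smul_compExponent T.ν_zero hν2 hp1 hpβ hβ2 hintp hint) t z
      rw [show -1 - β = -κ by rw [hβ]; ring] at h2
      rw [h2] at h1
      have h3 := (Complex.continuous_exp.tendsto _).comp h1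
      refine h3.congr fun n => ?_
      exact (ha.charFun_trawlSum hL hb hν2 _ z (fun j => ⌊(n : ℝ≥0) * t j⌋₊) (hΔ_pos n)).symm)
  have hm : IsProbabilityMeasure (P'.map (Y 1)) :=
    Measure.isProbabilityMeasure_map (hY.measurable 1).aemeasurable
  obtain ⟨hs1, hs2⟩ := isStrictlyStableLaw_of_charFun (μ := P'.map (Y 1)) hβ1 hβ2 hKp0 hKm0 hK
    (fun z => by rw [hYc]; simp)
  exact ⟨Kp, Km, (Kp - Km) / (1 - β), rfl, rfl, Ω', mΩ', P', hP', Y, hY, hs1, hs2, hFDD⟩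

end StableRegime


/-! ### Behaviour of ψ at infinity from the tails of ν at 0 -/

section Tail

variable {ν : Measure ℝ} {β : ℝ}

theorem norm_I_mul_exp_sub_one_le (z w : ℝ) :
    ‖Complex.I * z * (Complex.exp (Complex.I * z * w) - 1)‖ ≤ 2 * z ^ 2 * |w| := by
  have h := (norm_one_sub_exp_neg_le (z := -(Complex.I * z * w)) (by simp)).2
  rw [neg_neg, norm_sub_rev] at h
  rw [norm_mul]
  have e1 : ‖Complex.I * (z : ℂ)‖ = |z| := by simp
  have e2 : ‖-(Complex.I * z * w : ℂ)‖ = |z| * |w| := by simp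
  rw [e2] at h
  rw [e1, ← sq_abs]
  calc |z| * ‖Complex.exp (Complex.I * z * w) - 1‖ ≤ |z| * (2 * (|z| * |w|)) := by gcongr
    _ = _ := by ring

/-- Near 0 this is the convergence hypothesis; for w ≥ ε, Chebyshev gives w² ν(w, ∞) ≤ M, and
w^(β-2) is decreasing because β < 2. -/
theorem rpow_mul_tail_le (h2 : Integrable (fun x : ℝ => x ^ 2) ν) (hβ2 : β < 2) {K : ℝ}
    (hK : Tendsto (fun x : ℝ => x ^ β * ν.real (Ioi x)) (𝓝[>] 0) (𝓝 K)) :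
    ∃ C, 0 ≤ C ∧ ∀ w, 0 < w → w ^ β * ν.real (Ioi w) ≤ C := by
  have h1 := hK.eventually (ge_mem_nhds (lt_add_one K))
  obtain ⟨ε, hε, hεK⟩ := mem_nhdsGT_iff_exists_Ioo_subset.1 h1
  have hε' : 0 < ε := hε
  set M := ∫ x, x ^ 2 ∂ν with hM
  have hM0 : 0 ≤ M := integral_nonneg fun x => sq_nonneg x
  have hb : 0 ≤ M * ε ^ (β - 2) := mul_nonneg hM0 (by positivity)
  refine ⟨max (K + 1) (M * ε ^ (β - 2)), le_max_of_le_right hb, fun w hw => ?_⟩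
  rcases lt_or_ge w ε with h | h
  · exact (hεK ⟨hw, h⟩ : w ^ β * ν.real (Ioi w) ≤ K + 1).trans (le_max_left _ _)
  · refine le_trans ?_ (le_max_right _ _)
    have hch := mul_meas_ge_le_integral_of_nonneg (ae_of_all _ fun x => sq_nonneg x) h2 (w ^ 2)
    have hsub : ν.real (Ioi w) ≤ ν.real {x | w ^ 2 ≤ x ^ 2} := by
      refine measureReal_mono (fun x hx => ?_)
        (h2.measure_ge_lt_top (ε := w ^ 2) (by positivity)).ne
      have hx' : w < x := hx
      change w ^ 2 ≤ x ^ 2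
      gcongr
    have hle : w ^ 2 * ν.real (Ioi w) ≤ M :=
      (mul_le_mul_of_nonneg_left hsub (by positivity)).trans hch
    calc w ^ β * ν.real (Ioi w) = w ^ (β - 2) * (w ^ 2 * ν.real (Ioi w)) := by
          rw [← mul_assoc, ← Real.rpow_natCast w 2, ← Real.rpow_add hw]; norm_num
      _ ≤ w ^ (β - 2) * M := by gcongr
      _ ≤ ε ^ (β - 2) * M := by
          gcongr ?_ * M
          exact Real.rpow_le_rpow_of_nonpos hε' h (by linarith)
      _ = _ := mul_comm _ _

/-- `compExp (z * x)` is the integral over (0, x) of its derivative f, and Fubini trades ν for its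
tail. It applies because |f(w)| ≤ 2z²w makes the inner integral at most 2z²x². -/
theorem setIntegral_compExp_eq_tail [SFinite ν] (h2 : Integrable (fun x : ℝ => x ^ 2) ν) (z : ℝ) :
    ∫ x in Ioi (0 : ℝ), compExp (z * x) ∂ν
      = ∫ w in Ioi (0 : ℝ), Complex.I * z * (Complex.exp (Complex.I * z * w) - 1) *
        ((ν.real (Ioi w) : ℝ) : ℂ) := by
  set f : ℝ → ℂ := fun w => Complex.I * z * (Complex.exp (Complex.I * z * w) - 1) with hf
  have hfc : Continuous f := by fun_prop
  have hx : ∀ x ∈ Ioi (0 : ℝ), compExp (z * x) = ∫ w in Ioi (0 : ℝ), (Iio x).indicator f w := by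
    intro x hx
    have hx' : 0 < x := hx
    have hd : ∀ w ∈ uIcc 0 x, HasDerivAt (fun w : ℝ => compExp (z * w)) (f w) w := by
      intro w _
      have h1 : HasDerivAt (fun w : ℝ => (Complex.I * z * w : ℂ)) (Complex.I * z * 1) w :=
        (Complex.ofRealCLM.hasDerivAt (x := w)).const_mul _
      have h3 := (h1.cexp.sub_const 1).fun_sub h1
      have e : (fun w : ℝ => compExp (z * w))
          = fun w : ℝ => Complex.exp (Complex.I * z * w) - 1 - Complex.I * z * w := by
        funext w; simp only [compExp]; push_cast; ring_nf
      rw [e]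
      exact h3.congr_deriv (by simp only [hf]; ring)
    have h4 := intervalIntegral.integral_eq_sub_of_hasDerivAt hd (hfc.intervalIntegrable _ _)
    rw [mul_zero, compExp_zero, sub_zero] at h4
    rw [← h4, intervalIntegral.integral_of_le hx'.le, setIntegral_indicator measurableSet_Iio,
      Ioi_inter_Iio, integral_Ioc_eq_integral_Ioo]
  rw [setIntegral_congr_fun measurableSet_Ioi hx]
  have hS : MeasurableSet {q : ℝ × ℝ | q.2 < q.1} := measurableSet_lt measurable_snd measurable_fst
  have hFm : Measurable (Function.uncurry fun x w => (Iio x).indicator f w) := by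
    have : (Function.uncurry fun x w => (Iio x).indicator f w)
        = {q : ℝ × ℝ | q.2 < q.1}.indicator (fun q => f q.2) := by
      funext q; rfl
    rw [this]
    exact (hfc.measurable.comp measurable_snd).indicator hS
  have hslice : ∀ x, 0 < x → IntegrableOn ((Iio x).indicator f) (Ioi 0) := by
    intro x hx
    rw [IntegrableOn, integrable_indicator_iff measurableSet_Iio, IntegrableOn,
      Measure.restrict_restrict measurableSet_Iio, inter_comm, Ioi_inter_Iio]
    exact (hfc.integrableOn_Icc (a := 0) (b := x)).mono_set Ioo_subset_Icc_self
  have hFi : Integrable (Function.uncurry fun x w => (Iio x).indicator f w)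
      ((ν.restrict (Ioi 0)).prod (volume.restrict (Ioi 0))) := by
    rw [integrable_prod_iff hFm.aestronglyMeasurable]
    refine ⟨(ae_restrict_iff' measurableSet_Ioi).2 (ae_of_all _ fun x hx => hslice x hx), ?_⟩
    refine ((h2.const_mul (2 * z ^ 2)).integrableOn (s := Ioi 0)).mono'
      hFm.aestronglyMeasurable.norm.integral_prod_right'
      ((ae_restrict_iff' measurableSet_Ioi).2 (ae_of_all _ fun x hx => ?_))
    have hx' : 0 < x := hx
    rw [Real.norm_of_nonneg (integral_nonneg fun w => norm_nonneg _)]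
    simp only [Function.uncurry]
    have e1 : ∫ w in Ioi (0 : ℝ), ‖(Iio x).indicator f w‖ = ∫ w in Ioo (0 : ℝ) x, ‖f w‖ := by
      simp_rw [norm_indicator_eq_indicator_norm]
      rw [setIntegral_indicator measurableSet_Iio, Ioi_inter_Iio]
    rw [e1]
    have e2 := norm_setIntegral_le_of_norm_le_const (μ := volume) (s := Ioo (0 : ℝ) x)
      (f := fun w => ‖f w‖) (C := 2 * z ^ 2 * x) (by simp) (fun w hw => by
        rw [norm_norm]
        refine (norm_I_mul_exp_sub_one_le z w).trans ?_
        rw [abs_of_pos hw.1]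
        have := hw.2.le
        gcongr)
    refine (Real.le_norm_self _).trans (e2.trans (le_of_eq ?_))
    rw [Real.volume_real_Ioo_of_le hx'.le]
    ring
  rw [integral_integral_swap hFi]
  refine setIntegral_congr_fun measurableSet_Ioi fun w hw => ?_
  have hw' : 0 < w := hw
  have e : ∀ x, (Iio x).indicator f w = (Ioi w).indicator (fun _ => f w) x := by
    intro x
    simp only [indicator_apply, mem_Iio, mem_Ioi]
  simp_rw [e]
  rw [setIntegral_indicator measurableSet_Ioi, inter_eq_right.2 (Ioi_subset_Ioi hw'.le),
    setIntegral_const, Complex.real_smul, mul_comm]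

/-- The substitution w = v/z produces z^β times the integral of (v/z)^β ν(v/z, ∞) against a fixed
integrable g. The first factor is bounded and tends to K, so one formula gives both the bound and
the limit. -/
theorem setIntegral_compExp_asymptotics [SFinite ν] (h2 : Integrable (fun x : ℝ => x ^ 2) ν)
    (hβ1 : 1 < β) (hβ2 : β < 2) {K : ℝ}
    (hK : Tendsto (fun x : ℝ => x ^ β * ν.real (Ioi x)) (𝓝[>] 0) (𝓝 K)) :
    (∃ C, 0 ≤ C ∧ ∀ z, 0 < z → ‖∫ x in Ioi (0 : ℝ), compExp (z * x) ∂ν‖ ≤ C * z ^ β) ∧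
      Tendsto (fun z : ℝ => z ^ (-β) • ∫ x in Ioi (0 : ℝ), compExp (z * x) ∂ν) atTop
        (𝓝 (K * (β * stableConst β))) := by
  obtain ⟨C, hC, hCw⟩ := rpow_mul_tail_le h2 hβ2 hK
  set g : ℝ → ℂ := fun v => Complex.I * (Complex.exp (Complex.I * v) - 1) * ((v ^ (-β) : ℝ) : ℂ)
    with hg
  have hgi : IntegrableOn g (Ioi 0) := by
    have h := (integrableOn_rpow_mul_one_sub_exp hβ1 hβ2 (p := -Complex.I) (by simp)).const_mul
      (-Complex.I)
    refine IntegrableOn.congr_fun h (fun v _ => ?_) measurableSet_Ioi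
    simp only [hg, neg_mul, neg_neg]; ring
  have htm : Measurable fun w : ℝ => ν.real (Ioi w) := by
    have hanti : Antitone fun w : ℝ => ν (Ioi w) := fun a b hab => measure_mono (Ioi_subset_Ioi hab)
    exact hanti.measurable.ennreal_toReal
  have hscale : ∀ z : ℝ, 0 < z → z ^ (-β) • ∫ x in Ioi (0 : ℝ), compExp (z * x) ∂ν
      = ∫ v in Ioi (0 : ℝ), (((z⁻¹ * v) ^ β * ν.real (Ioi (z⁻¹ * v)) : ℝ) : ℂ) * g v := by
    intro z hz
    have h3 := integral_comp_mul_left_Ioi (fun v => (((z⁻¹ * v) ^ β * ν.real (Ioi (z⁻¹ * v)) : ℝ) : ℂ)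
      * g v) 0 hz
    rw [mul_zero] at h3
    have h4 : ∫ v in Ioi (0 : ℝ), (((z⁻¹ * v) ^ β * ν.real (Ioi (z⁻¹ * v)) : ℝ) : ℂ) * g v
        = z • ∫ w in Ioi (0 : ℝ), (((z⁻¹ * (z * w)) ^ β * ν.real (Ioi (z⁻¹ * (z * w))) : ℝ) : ℂ) *
          g (z * w) := by
      rw [h3, smul_smul, mul_inv_cancel₀ hz.ne', one_smul]
    rw [h4, setIntegral_compExp_eq_tail h2, ← integral_smul, ← integral_smul]
    refine setIntegral_congr_fun measurableSet_Ioi fun w hw => ?_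
    have hw' : 0 < w := hw
    simp only [hg]
    rw [inv_mul_cancel_left₀ hz.ne', Real.mul_rpow hz.le hw'.le, Complex.real_smul,
      Complex.real_smul]
    have e : w ^ β * w ^ (-β) = 1 := by rw [← Real.rpow_add hw']; simp
    have e' : ((w ^ β : ℝ) : ℂ) * ((w ^ (-β) : ℝ) : ℂ) = 1 := by exact_mod_cast e
    push_cast
    rw [← mul_assoc Complex.I]
    linear_combination (-(z : ℂ) * (ν.real (Ioi w) : ℂ) * (Complex.I *
      (Complex.exp (Complex.I * z * w) - 1)) * ((z ^ (-β) : ℝ) : ℂ)) * e'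
  have hbound : ∀ z : ℝ, 0 < z → ∀ v ∈ Ioi (0 : ℝ),
      ‖(((z⁻¹ * v) ^ β * ν.real (Ioi (z⁻¹ * v)) : ℝ) : ℂ) * g v‖ ≤ C * ‖g v‖ := by
    intro z hz v hv
    have hv' : 0 < v := hv
    rw [norm_mul, Complex.norm_real, Real.norm_of_nonneg (by positivity)]
    exact mul_le_mul_of_nonneg_right (hCw _ (by positivity)) (norm_nonneg _)
  refine ⟨⟨C * ∫ v in Ioi (0 : ℝ), ‖g v‖, mul_nonneg hC (integral_nonneg fun _ => norm_nonneg _),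
    fun z hz => ?_⟩, ?_⟩
  · have h3 : ‖z ^ (-β) • ∫ x in Ioi (0 : ℝ), compExp (z * x) ∂ν‖ ≤ C * ∫ v in Ioi (0 : ℝ), ‖g v‖ := by
      rw [hscale z hz, ← integral_const_mul]
      exact norm_integral_le_of_norm_le (hgi.norm.const_mul C)
        ((ae_restrict_iff' measurableSet_Ioi).2 (ae_of_all _ (hbound z hz)))
    rw [norm_smul, Real.norm_of_nonneg (by positivity), Real.rpow_neg hz.le, ← div_eq_inv_mul,
      div_le_iff₀ (by positivity)] at h3
    exact h3
  · have hlim : Tendsto (fun z : ℝ => ∫ v in Ioi (0 : ℝ),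
        (((z⁻¹ * v) ^ β * ν.real (Ioi (z⁻¹ * v)) : ℝ) : ℂ) * g v) atTop
        (𝓝 (∫ v in Ioi (0 : ℝ), (K : ℂ) * g v)) := by
      refine tendsto_integral_filter_of_dominated_convergence (fun v => C * ‖g v‖) ?_ ?_
        (hgi.norm.const_mul C) ?_
      · refine Eventually.of_forall fun z => AEStronglyMeasurable.mul ?_ hgi.1
        refine Measurable.aestronglyMeasurable ?_
        have h5 : Measurable fun v : ℝ => ν.real (Ioi (z⁻¹ * v)) := htm.comp (by fun_prop)
        fun_prop
      · filter_upwards [eventually_gt_atTop 0] with z hz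
        exact (ae_restrict_iff' measurableSet_Ioi).2 (ae_of_all _ (hbound z hz))
      · refine (ae_restrict_iff' measurableSet_Ioi).2 (ae_of_all _ fun v hv => ?_)
        have hv' : 0 < v := hv
        have h5 : Tendsto (fun z : ℝ => z⁻¹ * v) atTop (𝓝[>] 0) := by
          refine tendsto_nhdsWithin_iff.2 ⟨by simpa using tendsto_inv_atTop_zero.mul_const v, ?_⟩
          filter_upwards [eventually_gt_atTop 0] with z hz
          exact mem_Ioi.2 (by positivity)
        exact ((Complex.continuous_ofReal.tendsto K).comp (hK.comp h5)).mul_const _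
    rw [integral_const_mul, stableConst_eq_tail hβ1 hβ2] at hlim
    refine hlim.congr' ?_
    filter_upwards [eventually_gt_atTop 0] with z hz
    exact (hscale z hz).symm

theorem compExponent_neg (ν : Measure ℝ) (z : ℝ) :
    compExponent ν (-z) = (starRingEnd ℂ) (compExponent ν z) := by
  rw [compExponent, compExponent, ← integral_conj]
  simp_rw [← compExp_neg, neg_mul]

theorem stableSymbol_neg (hβ : β ≠ 0) (Kp Km z : ℝ) :
    stableSymbol β Kp Km (-z) = (starRingEnd ℂ) (stableSymbol β Kp Km z) := by
  rcases lt_trichotomy z 0 with hz | rfl | hz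
  · rw [stableSymbol, stableSymbol, if_pos (by linarith), if_neg (not_le.2 hz)]
    simp
  · simp [stableSymbol_zero hβ]
  · rw [stableSymbol, stableSymbol, if_neg (by linarith), if_pos hz.le]
    simp

/-- The negative jumps are handled by reflecting ν; reflection conjugates their contribution. -/
theorem compExponent_asymptotics (h0 : ν {0} = 0) (h2 : Integrable (fun x : ℝ => x ^ 2) ν)
    (hβ1 : 1 < β) (hβ2 : β < 2) {Kp Km : ℝ}
    (hKp : Tendsto (fun x : ℝ => x ^ β * ν.real (Ioi x)) (𝓝[>] 0) (𝓝 Kp))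
    (hKm : Tendsto (fun x : ℝ => x ^ β * ν.real (Iio (-x))) (𝓝[>] 0) (𝓝 Km)) :
    (∃ C, 0 ≤ C ∧ ∀ z, ‖compExponent ν z‖ ≤ C * |z| ^ β) ∧
      Tendsto (fun z : ℝ => z ^ (-β) • compExponent ν z) atTop
        (𝓝 (stableSymbol β (β * Kp) (β * Km) 1)) := by
  have hsf : SFinite ν := sFinite_of_integrable_sq h0 h2
  have hneg : MeasurableEmbedding (fun x : ℝ => -x) := (MeasurableEquiv.neg ℝ).measurableEmbedding
  set ν' := ν.map fun x : ℝ => -x with hν'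
  have h2' : Integrable (fun x : ℝ => x ^ 2) ν' := by
    rw [hν', hneg.integrable_map_iff]
    simpa [Function.comp_def] using h2
  have hKm' : Tendsto (fun x : ℝ => x ^ β * ν'.real (Ioi x)) (𝓝[>] 0) (𝓝 Km) := by
    refine hKm.congr fun x => ?_
    rw [hν', Measure.real, Measure.real, Measure.map_apply hneg.measurable measurableSet_Ioi]
    congr 3
    ext y; simp
  have hsplit : ∀ z, compExponent ν z = (∫ x in Ioi (0 : ℝ), compExp (z * x) ∂ν)
      + (starRingEnd ℂ) (∫ x in Ioi (0 : ℝ), compExp (z * x) ∂ν') := by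
    intro z
    have hi := integrable_compExp_mul (integrable_min_abs_sq h2) z
    rw [compExponent, ← intervalIntegral.integral_Iic_add_Ioi hi.integrableOn hi.integrableOn,
      add_comm, ← setIntegral_congr_set (Iio_ae_eq_Iic' h0), hν', hneg.setIntegral_map,
      ← integral_conj]
    congr 1
    have : (fun x : ℝ => -x) ⁻¹' Ioi 0 = Iio 0 := by ext; simp
    rw [this]
    simp_rw [mul_neg, compExp_neg, Complex.conj_conj]
  obtain ⟨⟨C₁, hC₁, hb₁⟩, hl₁⟩ := setIntegral_compExp_asymptotics h2 hβ1 hβ2 hKp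
  obtain ⟨⟨C₂, hC₂, hb₂⟩, hl₂⟩ := setIntegral_compExp_asymptotics h2' hβ1 hβ2 hKm'
  have hpos : ∀ z, 0 < z → ‖compExponent ν z‖ ≤ (C₁ + C₂) * z ^ β := by
    intro z hz
    rw [hsplit]
    refine (norm_add_le _ _).trans ?_
    rw [RCLike.norm_conj]
    linarith [hb₁ z hz, hb₂ z hz]
  refine ⟨⟨C₁ + C₂, by positivity, fun z => ?_⟩, ?_⟩
  · rcases lt_trichotomy z 0 with hz | rfl | hz
    · have := hpos (-z) (by linarith)
      rwa [compExponent_neg, RCLike.norm_conj, ← abs_of_neg hz] at this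
    · rw [compExponent_zero, norm_zero]; positivity
    · rw [abs_of_pos hz]; exact hpos z hz
  · have hl := hl₁.add ((Complex.continuous_conj.tendsto _).comp hl₂)
    refine (hl.congr fun z => ?_).trans (le_of_eq ?_)
    · rw [hsplit, smul_add, Function.comp_apply]
      congr 1
      rw [Complex.real_smul, Complex.real_smul, map_mul, Complex.conj_ofReal]
    · congr 1
      rw [stableSymbol, if_pos zero_le_one]
      simp only [map_mul, Complex.conj_ofReal, abs_one, Real.one_rpow]
      push_cast
      ring

/-- Convergence of rescaled exponents to the stable exponent. -/
theorem tendsto_smul_compExponent (hβ0 : 0 < β) {ψ : ℝ → ℂ} {C Kp Km : ℝ}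
    (hψ : ∀ z, ‖ψ z‖ ≤ C * |z| ^ β) (hneg : ∀ z, ψ (-z) = (starRingEnd ℂ) (ψ z))
    (hlim : Tendsto (fun z : ℝ => z ^ (-β) • ψ z) atTop (𝓝 (stableSymbol β Kp Km 1)))
    {l y : ℕ → ℝ} {y₀ : ℝ} (hl0 : ∀ᶠ n in atTop, 0 < l n) (hl : Tendsto l atTop (𝓝 0))
    (hy : Tendsto y atTop (𝓝 y₀)) :
    Tendsto (fun n => l n • ψ ((l n ^ (1 / β))⁻¹ * y n)) atTop (𝓝 (stableSymbol β Kp Km y₀)) := by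
  -- Only a positive limit uses the behaviour of ψ at infinity. A negative one follows by
  -- conjugation, and at 0 the power bound suffices, since there the argument of ψ need not diverge.
  have hpos : ∀ {y : ℕ → ℝ} {y₀ : ℝ}, 0 < y₀ → Tendsto y atTop (𝓝 y₀) →
      Tendsto (fun n => l n • ψ ((l n ^ (1 / β))⁻¹ * y n)) atTop
        (𝓝 (stableSymbol β Kp Km y₀)) := by
    intro y y₀ hy₀ hy
    have h1 : Tendsto (fun n => (l n ^ (1 / β))⁻¹) atTop atTop := by
      refine Tendsto.inv_tendsto_nhdsGT_zero (tendsto_nhdsWithin_iff.2 ⟨?_, ?_⟩)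
      · have := hl.rpow_const (p := 1 / β) (Or.inr (by positivity))
        rwa [Real.zero_rpow (by positivity)] at this
      · filter_upwards [hl0] with n hn
        exact mem_Ioi.2 (by positivity)
    have h2 := hlim.comp (h1.atTop_mul_pos hy₀ hy)
    have h3 := (hy.rpow_const (p := β) (Or.inr hβ0.le)).smul h2
    have e : stableSymbol β Kp Km y₀ = y₀ ^ β • stableSymbol β Kp Km 1 := by
      rw [Complex.real_smul, ← stableSymbol_mul_left hy₀, mul_one]
    rw [e]
    refine h3.congr' ?_
    filter_upwards [hl0, hy.eventually (lt_mem_nhds hy₀)] with n h4 h5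
    simp only [Function.comp_apply]
    rw [smul_smul]
    congr 1
    have h6 : ((l n ^ (1 / β))⁻¹) ^ (-β) = l n := by
      rw [← Real.rpow_neg h4.le, ← Real.rpow_mul h4.le]
      have : -(1 / β) * -β = 1 := by field_simp
      rw [this, Real.rpow_one]
    rw [Real.mul_rpow (by positivity) h5.le, h6, mul_left_comm, ← Real.rpow_add h5]
    simp
  rcases lt_trichotomy y₀ 0 with h | rfl | h
  · have h1 := (Complex.continuous_conj.tendsto _).comp (hpos (neg_pos.2 h) hy.neg)
    rw [← stableSymbol_neg hβ0.ne', neg_neg] at h1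
    refine h1.congr fun n => ?_
    simp only [Function.comp_apply]
    rw [Complex.real_smul, Complex.real_smul, map_mul, Complex.conj_ofReal, ← hneg, mul_neg,
      neg_neg]
  · rw [stableSymbol_zero hβ0.ne']
    have h1 := ((hy.abs.rpow_const (p := β) (Or.inr hβ0.le))).const_mul C
    rw [abs_zero, Real.zero_rpow hβ0.ne', mul_zero] at h1
    refine squeeze_zero_norm' ?_ h1
    filter_upwards [hl0] with n hn
    rw [norm_smul, Real.norm_of_nonneg hn.le]
    have h2 := hψ ((l n ^ (1 / β))⁻¹ * y n)
    rw [abs_mul, abs_of_pos (by positivity : 0 < (l n ^ (1 / β))⁻¹),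
      Real.mul_rpow (by positivity) (abs_nonneg _), Real.inv_rpow (by positivity),
      ← Real.rpow_mul hn.le, one_div_mul_cancel hβ0.ne', Real.rpow_one] at h2
    calc l n * ‖ψ ((l n ^ (1 / β))⁻¹ * y n)‖ ≤ l n * (C * ((l n)⁻¹ * |y n| ^ β)) := by gcongr
      _ = C * |y n| ^ β := by field_simp
  · exact hpos h hy

end Tail


/-! ### The overlap profile and the constant ϱ_a -/

/-- The length of `[s, s + v] ∩ [0, 1]`. -/
noncomputable def overlap (s v : ℝ) : ℝ := max 0 (min (s + v) 1 - max s 0)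

section Overlap

variable {β : ℝ}

theorem overlap_nonneg (s v : ℝ) : 0 ≤ overlap s v := le_max_left _ _

theorem overlap_eq_zero {s v : ℝ} (h : s ∉ Icc (-v) 1) : overlap s v = 0 := by
  refine max_eq_left ?_
  rw [mem_Icc, not_and_or, not_le, not_le] at h
  rcases h with h | h
  · linarith [min_le_left (s + v) 1, le_max_right s 0]
  · linarith [min_le_right (s + v) 1, le_max_left s 0]

/-- As a function of s the overlap is a trapezoid: it rises from 0 at -v with slope 1 to the height
m = min v 1, stays there for a length 1 + v - 2m, and falls back to 0 at 1. The sides give the two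
equal terms m^(β+1)/(β+1). -/
theorem integral_overlap_rpow (hβ : 0 < β) {v : ℝ} (hv : 0 < v) :
    ∫ s, overlap s v ^ β
      = 2 * min v 1 ^ (β + 1) / (β + 1) + min v 1 ^ β * (1 + v - 2 * min v 1) := by
  set m := min v 1 with hm
  have hm0 : 0 < m := lt_min hv one_pos
  have hmv : m ≤ v := min_le_left _ _
  have hm1 : m ≤ 1 := min_le_right _ _
  have hc : Continuous fun s => overlap s v ^ β := by
    unfold overlap
    exact (by fun_prop : Continuous fun s => max 0 (min (s + v) 1 - max s 0)).rpow_const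
      fun _ => Or.inr hβ.le
  have h1 : ∫ s, overlap s v ^ β = ∫ s in (-v)..1, overlap s v ^ β := by
    rw [intervalIntegral.integral_of_le (by linarith), ← integral_Icc_eq_integral_Ioc,
      setIntegral_eq_integral_of_forall_compl_eq_zero fun s hs => by
        rw [overlap_eq_zero hs, Real.zero_rpow hβ.ne']]
  have i : ∀ a b, IntervalIntegrable (fun s => overlap s v ^ β) volume a b :=
    fun a b => hc.intervalIntegrable a b
  have hval1 : ∫ s in (-v)..(m - v), overlap s v ^ β = m ^ (β + 1) / (β + 1) := by
    have e : ∫ s in (-v)..(m - v), overlap s v ^ β = ∫ s in (-v)..(m - v), (s + v) ^ β := by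
      refine intervalIntegral.integral_congr fun s hs => ?_
      rw [uIcc_of_le (by linarith)] at hs
      have h2 : s ≤ 0 := by linarith [hs.2]
      have h3 : s + v ≤ 1 := by linarith [hs.2]
      simp only [overlap]
      rw [min_eq_left h3, max_eq_right h2, sub_zero, max_eq_right (by linarith [hs.1])]
    rw [e, intervalIntegral.integral_comp_add_right (fun x => x ^ β) v, neg_add_cancel,
      sub_add_cancel, integral_rpow (Or.inl (by linarith)), Real.zero_rpow (by linarith), sub_zero]
  have hval2 : ∫ s in (m - v)..(1 - m), overlap s v ^ β = m ^ β * (1 + v - 2 * m) := by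
    have hle : m - v ≤ 1 - m := by
      rcases le_total v 1 with h | h
      · have : m = v := min_eq_left h
        linarith
      · have : m = 1 := min_eq_right h
        linarith
    have e : ∫ s in (m - v)..(1 - m), overlap s v ^ β = ∫ s in (m - v)..(1 - m), m ^ β := by
      refine intervalIntegral.integral_congr fun s hs => ?_
      rw [uIcc_of_le hle] at hs
      simp only [overlap]
      congr 1
      rcases le_total v 1 with h | h
      · have hmv : m = v := min_eq_left h
        rw [hmv] at hs ⊢
        rw [min_eq_left (by linarith [hs.2]), max_eq_left (by linarith [hs.1] : (0 : ℝ) ≤ s)]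
        rw [add_sub_cancel_left, max_eq_right hv.le]
      · have hmv : m = 1 := min_eq_right h
        rw [hmv] at hs ⊢
        rw [min_eq_right (by linarith [hs.1]), max_eq_right (by linarith [hs.2] : s ≤ 0)]
        norm_num
    rw [e, intervalIntegral.integral_const, smul_eq_mul]
    ring
  have hval3 : ∫ s in (1 - m)..1, overlap s v ^ β = m ^ (β + 1) / (β + 1) := by
    have e : ∫ s in (1 - m)..1, overlap s v ^ β = ∫ s in (1 - m)..1, (1 - s) ^ β := by
      refine intervalIntegral.integral_congr fun s hs => ?_
      rw [uIcc_of_le (by linarith)] at hs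
      have h2 : 0 ≤ s := by linarith [hs.1]
      have h3 : 1 ≤ s + v := by linarith [hs.1]
      simp only [overlap]
      rw [min_eq_right h3, max_eq_left h2, max_eq_right (by linarith [hs.2])]
    rw [e, intervalIntegral.integral_comp_sub_left (fun x => x ^ β) 1, sub_self, sub_sub_cancel,
      integral_rpow (Or.inl (by linarith)), Real.zero_rpow (by linarith), sub_zero]
  rw [h1, ← intervalIntegral.integral_add_adjacent_intervals (i (-v) (m - v)) (i (m - v) 1),
    ← intervalIntegral.integral_add_adjacent_intervals (i (m - v) (1 - m)) (i (1 - m) 1), hval1,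
    hval2, hval3]
  ring

/-- The trapezoid integral is split at v = 1. Convergence at 0 requires β > κ - 1, through v^(β-κ),
and at infinity κ > 2, through v^(1-κ); the boundary terms then combine into 1/(κ-2) and 2/(β-κ+2).
-/
theorem rhoConst_eq {κ : ℝ} (hκ : 2 < κ) (hβ : κ - 1 < β) :
    (κ - 1) * ∫ v in Ioi (0 : ℝ), v ^ (-κ) * ∫ s, overlap s v ^ β = rhoConst κ β := by
  have hβ0 : 0 < β := by linarith
  have hβ1 : β + 1 ≠ 0 := by linarith
  have j1 : IntervalIntegrable (fun v : ℝ => v ^ (β - κ + 1)) volume 0 1 :=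
    intervalIntegral.intervalIntegrable_rpow' (by linarith)
  have j0 : IntervalIntegrable (fun v : ℝ => v ^ (β - κ)) volume 0 1 :=
    intervalIntegral.intervalIntegrable_rpow' (by linarith)
  have j2 : IntervalIntegrable (fun v : ℝ => (1 - v) * v ^ (β - κ)) volume 0 1 :=
    j0.continuousOn_mul (by fun_prop)
  have e1 : EqOn (fun v : ℝ => 2 / (β + 1) * v ^ (β - κ + 1) + (1 - v) * v ^ (β - κ))
      (fun v => v ^ (-κ) * ∫ s, overlap s v ^ β) (Ioc 0 1) := by
    intro v hv
    have hv0 : 0 < v := hv.1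
    simp only
    have a1 : v ^ (β - κ + 1) = v ^ (-κ) * v ^ (β + 1) := by rw [← Real.rpow_add hv0]; ring_nf
    have a2 : v ^ (β - κ) = v ^ (-κ) * v ^ β := by rw [← Real.rpow_add hv0]; ring_nf
    rw [integral_overlap_rpow hβ0 hv0, min_eq_left hv.2, a1, a2]
    ring
  have e2 : EqOn (fun v : ℝ => (2 / (β + 1) - 1) * v ^ (-κ) + v ^ (1 - κ))
      (fun v => v ^ (-κ) * ∫ s, overlap s v ^ β) (Ioi 1) := by
    intro v hv
    have hv1 : 1 < v := hv
    have hv0 : 0 < v := by linarith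
    simp only
    rw [integral_overlap_rpow hβ0 hv0, min_eq_right hv1.le, show 1 - κ = -κ + 1 by ring,
      Real.rpow_add hv0, Real.rpow_one, Real.one_rpow, Real.one_rpow]
    ring
  have j3 : IntegrableOn (fun v : ℝ => v ^ (-κ)) (Ioi 1) :=
    integrableOn_Ioi_rpow_of_lt (by linarith) one_pos
  have j4 : IntegrableOn (fun v : ℝ => v ^ (1 - κ)) (Ioi 1) :=
    integrableOn_Ioi_rpow_of_lt (by linarith) one_pos
  have k1 : IntegrableOn (fun v : ℝ => 2 / (β + 1) * v ^ (β - κ + 1) + (1 - v) * v ^ (β - κ))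
      (Ioc 0 1) :=
    (intervalIntegrable_iff_integrableOn_Ioc_of_le zero_le_one).1 ((j1.const_mul _).add j2)
  have k2 : IntegrableOn (fun v : ℝ => (2 / (β + 1) - 1) * v ^ (-κ) + v ^ (1 - κ)) (Ioi 1) :=
    (j3.const_mul _).add j4
  rw [← Ioc_union_Ioi_eq_Ioi (zero_le_one (α := ℝ)), setIntegral_union (Ioc_disjoint_Ioi le_rfl)
    measurableSet_Ioi (k1.congr_fun e1 measurableSet_Ioc) (k2.congr_fun e2 measurableSet_Ioi),
    ← setIntegral_congr_fun measurableSet_Ioc e1, ← setIntegral_congr_fun measurableSet_Ioi e2,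
    integral_add (j3.const_mul _) j4, integral_const_mul,
    integral_Ioi_rpow_of_lt (by linarith) one_pos, integral_Ioi_rpow_of_lt (by linarith) one_pos,
    ← intervalIntegral.integral_of_le zero_le_one,
    intervalIntegral.integral_add (j1.const_mul _) j2, intervalIntegral.integral_const_mul,
    rhoConst, integral_rpow (Or.inl (by linarith)), Real.one_rpow, Real.one_rpow, Real.one_rpow,
    Real.zero_rpow (by linarith)]
  have h1 : β - κ + 1 + 1 ≠ 0 := by linarith
  have h2 : -κ + 1 ≠ 0 := by linarith
  have h3 : 1 - κ + 1 ≠ 0 := by linarith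
  have h4 : κ - 2 ≠ 0 := by linarith
  have h5 : 1 - κ + 1 = -(κ - 2) := by ring
  have h6 : -κ + 1 = -(κ - 1) := by ring
  have h7 : κ - 1 ≠ 0 := by linarith
  rw [h5, h6]
  field_simp
  ring

theorem rhoConst_pos {κ : ℝ} (hκ : 2 < κ) (β : ℝ) : 0 < rhoConst κ β := by
  unfold rhoConst
  have h1 : 0 ≤ ∫ s in (0 : ℝ)..1, (1 - s) * s ^ (β - κ) :=
    intervalIntegral.integral_nonneg zero_le_one fun s hs =>
      mul_nonneg (by linarith [hs.2]) (Real.rpow_nonneg hs.1 _)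
  have h2 : 0 ≤ ∫ s in (0 : ℝ)..1, s ^ (β - κ + 1) :=
    intervalIntegral.integral_nonneg zero_le_one fun s hs => Real.rpow_nonneg hs.1 _
  have h3 : 0 < 1 / (κ - 2) := one_div_pos.2 (by linarith)
  have h4 : 0 ≤ (κ - 1) * ∫ s in (0 : ℝ)..1, (1 - s) * s ^ (β - κ) :=
    mul_nonneg (by linarith) h1
  linarith

theorem abs_latticeCount_div_sub_overlap_le {n : ℕ} (hn : 0 < n) {δ : ℝ} (hδ : 0 < δ) (s v : ℝ) :
    |latticeCount n (n * δ * s / δ) ((n * δ * s + n * δ * v) / δ) / n - overlap s v| ≤ 2 / n := by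
  have hn' : (0 : ℝ) < n := by exact_mod_cast hn
  have hx : n * δ * s / δ = n * s := by field_simp
  have hy : (n * δ * s + n * δ * v) / δ = n * (s + v) := by field_simp
  have h := abs_latticeCount_sub_le n (n * s) (n * (s + v))
  have e : max 0 (min (n * (s + v)) (n : ℝ) - max (n * s) 0) = n * overlap s v := by
    rw [overlap, mul_max_of_nonneg _ _ hn'.le, mul_zero, mul_sub, mul_min_of_nonneg _ _ hn'.le,
      mul_max_of_nonneg _ _ hn'.le, mul_one, mul_zero]
  rw [e] at h
  rw [hx, hy, div_sub' hn'.ne', abs_div, abs_of_pos hn']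
  gcongr

theorem stableSymbol_mul_left_of_nonneg (hβ : β ≠ 0) {Kp Km r : ℝ} (hr : 0 ≤ r) (z : ℝ) :
    stableSymbol β Kp Km (r * z) = ((r ^ β : ℝ) : ℂ) * stableSymbol β Kp Km z := by
  rcases hr.eq_or_lt with rfl | hr
  · rw [zero_mul, stableSymbol_zero hβ, Real.zero_rpow hβ]; simp
  · exact stableSymbol_mul_left hr z

end Overlap


/-! ### Part (ii): small jumps dominate -/

section SmallJumpRegime

variable {a aprime : ℝ → ℝ} {κ ca : ℝ}

/-- The scaling theorem at the scale of the full horizon T = nΔ. The count is of order n, so the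
norming leaves an argument of order l^(-1/β) with l = a(T) T → 0, and ψ is seen only at infinity. -/
theorem PowerLongMemory.tendsto_integral_sectionIntegral_smallJump
    (h : PowerLongMemory a aprime κ ca) {ψ : ℝ → ℂ} (hψc : Continuous ψ) {C β Kp Km : ℝ}
    (hC : 0 ≤ C) (hκβ : κ - 1 < β) (hβ2 : β < 2) (hψ : ∀ y, ‖ψ y‖ ≤ C * |y| ^ β)
    (hψn : ∀ y, ψ (-y) = (starRingEnd ℂ) (ψ y))
    (hlim : Tendsto (fun y : ℝ => y ^ (-β) • ψ y) atTop (𝓝 (stableSymbol β Kp Km 1)))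
    {Δ : ℕ → ℝ} (hΔ_pos : ∀ n, 0 < Δ n) (hΔ : Tendsto Δ atTop (𝓝 0))
    (hnΔ : Tendsto (fun n : ℕ => (n : ℝ) * Δ n) atTop atTop) (z : ℝ) :
    Tendsto (fun n : ℕ => ∫ u in Ioi (0 : ℝ), aprime u •
      sectionIntegral ψ (1 / (n * (a (n * Δ n) * (n * Δ n)) ^ (1 / β))) (fun _ : Unit => z)
        (fun _ => n) (Δ n) u) atTop (𝓝 (rhoConst κ β * stableSymbol β Kp Km z)) := by
  have hκ2 := h.two_lt
  have hκ3 := h.lt_three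
  have hca := h.ca_pos
  have hβ1 : 1 < β := by linarith
  have hβ0 : 0 < β := by linarith
  set T : ℕ → ℝ := fun n => n * Δ n with hT
  set l : ℕ → ℝ := fun n => a (T n) * T n with hl
  set w : ℕ → ℝ := fun n => 1 / (n * l n ^ (1 / β)) with hw
  -- The limit of T^(2-κ)/l, because a(T) T^(κ-1) → ca/(κ-1); it leaves the factor ca · D = κ - 1 in
  -- front of the overlap integral.
  set D := (κ - 1) / ca with hD
  have hκ1 : 0 < κ - 1 := by linarith
  have hD0 : 0 < D := div_pos hκ1 hca
  have hT0 : ∀ᶠ n in atTop, 0 < T n := hnΔ.eventually_gt_atTop 0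
  have hl0 : ∀ᶠ n in atTop, 0 < l n := by
    filter_upwards [hT0] with n hn
    exact mul_pos (h.apply_pos hn.le) hn
  have hρ : Tendsto (fun n => T n ^ (2 - κ) / l n) atTop (𝓝 D) := by
    have h1 := (h.tendsto_mul_rpow hnΔ).inv₀ (div_pos hca hκ1).ne'
    rw [inv_div] at h1
    refine h1.congr' ?_
    filter_upwards [hT0] with n hn
    have := (h.apply_pos hn.le).ne'
    change (a (T n) * T n ^ (κ - 1))⁻¹ = T n ^ (2 - κ) / (a (T n) * T n)
    have e : T n ^ (2 - κ) = T n / T n ^ (κ - 1) := by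
      rw [show 2 - κ = 1 - (κ - 1) by ring, Real.rpow_sub hn, Real.rpow_one]
    have hp : T n ^ (κ - 1) ≠ 0 := (Real.rpow_pos_of_pos hn _).ne'
    have hn0 : T n ≠ 0 := hn.ne'
    rw [e]
    field_simp
  have hllim : Tendsto l atTop (𝓝 0) := by
    have h1 := (h.tendsto_mul_rpow hnΔ).mul
      ((tendsto_rpow_neg_atTop (y := κ - 2) (by linarith)).comp hnΔ)
    rw [mul_zero] at h1
    refine h1.congr' ?_
    filter_upwards [hT0] with n hn
    change a (T n) * T n ^ (κ - 1) * T n ^ (-(κ - 2)) = a (T n) * T n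
    rw [mul_assoc, ← Real.rpow_add hn]
    ring_nf
    rw [Real.rpow_one]
  -- The size of the contribution of u ≤ 1; it vanishes because T^(2-κ)/l is bounded and β > κ - 1.
  have hsmall : Tendsto (fun n => T n ^ (1 - β) / l n) atTop (𝓝 0) := by
    have h1 := hρ.mul ((tendsto_rpow_neg_atTop (y := β - κ + 1) (by linarith)).comp hnΔ)
    rw [mul_zero] at h1
    refine h1.congr' ?_
    filter_upwards [hT0] with n hn
    change T n ^ (2 - κ) / l n * T n ^ (-(β - κ + 1)) = T n ^ (1 - β) / l n
    rw [div_mul_eq_mul_div, ← Real.rpow_add hn]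
    ring_nf
  have hρD : ∀ᶠ n in atTop, T n ^ (2 - κ) / l n ≤ D + 1 :=
    hρ.eventually (ge_mem_nhds (lt_add_one D))
  have hΔ1 : ∀ᶠ n in atTop, Δ n ≤ 1 := hΔ.eventually (ge_mem_nhds one_pos)
  have hwβ : ∀ᶠ n : ℕ in atTop, (|w n| * ∑ _ : Unit, |z|) ^ β
      = |z| ^ β * ((n : ℝ) ^ (-β) * (l n)⁻¹) := by
    filter_upwards [hl0, eventually_gt_atTop 0] with n h1 hn
    have hn' : (0 : ℝ) < n := by exact_mod_cast hn
    simp only [hw, Finset.univ_unique, Finset.sum_const, Finset.card_singleton, one_smul]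
    rw [abs_of_pos (by positivity), Real.mul_rpow (by positivity) (abs_nonneg _), one_div,
      Real.inv_rpow (by positivity), Real.mul_rpow hn'.le (by positivity), ← Real.rpow_mul h1.le,
      one_div_mul_cancel hβ0.ne', Real.rpow_one, mul_inv, Real.rpow_neg hn'.le, mul_comm]
  have hnβ : ∀ n : ℕ, 0 < n → (n : ℝ) ^ (-β) * (n : ℝ) ^ (β - 1) * n = 1 := by
    intro n hn
    have hn' : (0 : ℝ) < n := by exact_mod_cast hn
    rw [← Real.rpow_add hn', ← Real.rpow_add_one hn'.ne']
    ring_nf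
    exact Real.rpow_zero _
  -- One estimate for every range of u: if the counts are at most nK, the powers of n cancel
  -- exactly. It is applied with K = 2/T, 1 and 2v.
  have hJ : ∀ᶠ n : ℕ in atTop, ∀ K u, 0 ≤ K → 0 < u →
      (∀ r, latticeCount n (r / Δ n) ((r + u) / Δ n) ≤ n * K) →
      ‖sectionIntegral ψ (w n) (fun _ : Unit => z) (fun _ => n) (Δ n) u‖
        ≤ C * |z| ^ β * (l n)⁻¹ * K ^ (β - 1) * u := by
    filter_upwards [hwβ, hl0, eventually_gt_atTop 0] with n h1 h2 hn K u hK0 hu hK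
    have hn' : (0 : ℝ) < n := by exact_mod_cast hn
    have h3 := norm_sectionIntegral_le (w := w n) (z := fun _ : Unit => z) (M := fun _ => n) hC
      hβ1.le hψ (hΔ_pos n) hu.le (fun _ => le_rfl) hK
    refine h3.trans (le_of_eq ?_)
    rw [h1, Real.mul_rpow hn'.le hK0]
    linear_combination (C * |z| ^ β * (l n)⁻¹ * K ^ (β - 1) * u) * hnβ n hn
  set A := C * |z| ^ β * 2 ^ (β - 1) * (D + 1) with hA
  have h2pow : (1 : ℝ) ≤ 2 ^ (β - 1) := Real.one_le_rpow one_le_two (by linarith)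
  have hA0 : 0 ≤ A := by positivity
  -- The two entries of the minimum in G come from bounding the count by n and by 2nv. The first
  -- gives integrability of v^(1-κ) at infinity, the second of v^(β-κ) at 0.
  have key := h.tendsto_integral_scaled hnΔ
    (H := fun n u => sectionIntegral ψ (w n) (fun _ : Unit => z) (fun _ => n) (Δ n) u)
    (g := fun v => D • ∫ s, stableSymbol β Kp Km (z * overlap s v))
    (G := fun v => A * min v (v ^ β))
    (ε := fun n => C * |z| ^ β * 2 ^ (β - 1) * (T n ^ (1 - β) / l n))
    (fun n => aestronglyMeasurable_sectionIntegral hψc _ _ _ _ _) ?_ ?_ ?_ ?_ ?_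
  · refine key.trans (le_of_eq ?_)
    congr 1
    have e1 : ∀ s v, stableSymbol β Kp Km (z * overlap s v)
        = ((overlap s v ^ β : ℝ) : ℂ) * stableSymbol β Kp Km z := fun s v => by
      rw [mul_comm z, stableSymbol_mul_left_of_nonneg hβ0.ne' (overlap_nonneg s v)]
    have e2 : ∀ v : ℝ, (ca * v ^ (-κ)) • D • ∫ s, stableSymbol β Kp Km (z * overlap s v)
        = (((κ - 1) * (v ^ (-κ) * ∫ s, overlap s v ^ β) : ℝ) : ℂ) * stableSymbol β Kp Km z := by
      intro v
      simp_rw [e1]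
      rw [integral_mul_const, integral_complex_ofReal, smul_smul, Complex.real_smul, ← mul_assoc,
        ← Complex.ofReal_mul]
      congr 2
      rw [hD]
      field_simp
    simp_rw [e2]
    rw [integral_mul_const, integral_complex_ofReal, integral_const_mul, rhoConst_eq hκ2 hκβ]
  · simpa using hsmall.const_mul (C * |z| ^ β * 2 ^ (β - 1))
  · filter_upwards [hJ, hΔ1, hl0, eventually_gt_atTop 0, hT0] with n h1 h2 h3 hn h4 u hu hu1
    have hn' : (0 : ℝ) < n := by exact_mod_cast hn
    have hΔn := hΔ_pos n
    refine (h1 (2 / T n) u (by positivity) hu fun r => ?_).trans ?_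
    · refine (latticeCount_section_le hΔn hu.le n r).trans ?_
      have : (n : ℝ) * (2 / T n) = 2 / Δ n := by simp only [hT]; field_simp
      rw [this, div_add_one hΔn.ne']
      gcongr
      linarith
    · rw [Real.div_rpow two_pos.le h4.le, show 1 - β = -(β - 1) by ring, Real.rpow_neg h4.le]
      calc C * |z| ^ β * (l n)⁻¹ * (2 ^ (β - 1) / T n ^ (β - 1)) * u
          ≤ C * |z| ^ β * (l n)⁻¹ * (2 ^ (β - 1) / T n ^ (β - 1)) * 1 := by gcongr
        _ = _ := by ring
  · refine integrableOn_Ioi_of_norm_le_rpow (a := β - κ) (b := 1 - κ) (C := A)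
      (Measurable.aestronglyMeasurable (by fun_prop)) (by linarith) (by linarith) ?_ ?_
    · intro v hv _
      rw [Real.norm_of_nonneg (by positivity), sub_eq_neg_add, Real.rpow_add hv]
      calc v ^ (-κ) * (A * min v (v ^ β)) ≤ v ^ (-κ) * (A * v ^ β) := by
            gcongr; exact min_le_right _ _
        _ = _ := by ring
    · intro v hv1
      have hv : 0 < v := one_pos.trans hv1
      rw [Real.norm_of_nonneg (by positivity), sub_eq_neg_add, Real.rpow_add hv, Real.rpow_one]
      calc v ^ (-κ) * (A * min v (v ^ β)) ≤ v ^ (-κ) * (A * v) := by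
            gcongr; exact min_le_left _ _
        _ = _ := by ring
  · filter_upwards [hJ, hΔ1, hl0, eventually_gt_atTop 0, hT0, hρD] with n h1 h2 h3 hn h4 h5 v hv hTv
    have hn' : (0 : ℝ) < n := by exact_mod_cast hn
    have hΔn := hΔ_pos n
    have hTv0 : 0 < T n * v := by positivity
    have hfin : ∀ q : ℝ, 0 ≤ q →
        T n ^ (1 - κ) * (C * |z| ^ β * (l n)⁻¹ * q * (T n * v)) ≤ C * |z| ^ β * (D + 1) * (q * v) := by
      intro q hq
      have e : T n ^ (2 - κ) = T n ^ (1 - κ) * T n := by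
        rw [← Real.rpow_add_one h4.ne']; ring_nf
      calc T n ^ (1 - κ) * (C * |z| ^ β * (l n)⁻¹ * q * (T n * v))
          = C * |z| ^ β * (T n ^ (2 - κ) / l n) * (q * v) := by rw [e]; ring
        _ ≤ _ := by gcongr
    rw [norm_smul, Real.norm_of_nonneg (by positivity), mul_min_of_nonneg _ _ hA0]
    refine le_min ?_ ?_
    · have h6 := h1 1 (T n * v) zero_le_one hTv0 fun r => by
        rw [mul_one]; exact latticeCount_le _ _ _
      refine (mul_le_mul_of_nonneg_left h6 (by positivity)).trans ((hfin _ (by simp)).trans ?_)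
      rw [Real.one_rpow, one_mul, hA]
      have h7 : 0 ≤ C * |z| ^ β * (D + 1) * v := by positivity
      nlinarith
    · have h6 := h1 (2 * v) (T n * v) (by positivity) hTv0 fun r => by
        refine (latticeCount_section_le hΔn hTv0.le n r).trans ?_
        have h8 : 1 ≤ T n * v / Δ n := by rw [one_le_div hΔn]; linarith
        have h9 : T n * v / Δ n = n * v := by simp only [hT]; field_simp
        rw [h9] at h8 ⊢
        linarith
      refine (mul_le_mul_of_nonneg_left h6 (by positivity)).trans
        ((hfin _ (by positivity)).trans (le_of_eq ?_))
      rw [Real.mul_rpow two_pos.le hv.le, mul_assoc (2 ^ (β - 1)), ← Real.rpow_add_one hv.ne',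
        sub_add_cancel, hA]
      ring
  · intro v hv
    set c : ℕ → ℝ → ℝ := fun n s =>
      latticeCount n (T n * s / Δ n) ((T n * s + T n * v) / Δ n) with hc
    -- The factor l is moved inside the integral, so that the integrand has the form l ψ(l^(-1/β) y)
    -- treated by `tendsto_smul_compExponent`.
    have hexpr : ∀ᶠ n in atTop, T n ^ (1 - κ) •
        sectionIntegral ψ (w n) (fun _ : Unit => z) (fun _ => n) (Δ n) (T n * v)
        = (T n ^ (2 - κ) / l n) • ∫ s, l n • ψ ((l n ^ (1 / β))⁻¹ * (z * (c n s / n))) := by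
      filter_upwards [hT0, hl0, eventually_gt_atTop 0] with n h1 h2 hn
      have hn' : (n : ℝ) ≠ 0 := by exact_mod_cast hn.ne'
      rw [sectionIntegral_eq_smul h1, integral_smul, smul_smul, smul_smul, div_mul_cancel₀ _ h2.ne',
        ← Real.rpow_add_one h1.ne', show 1 - κ + 1 = 2 - κ by ring]
      congr 2
      funext s
      congr 1
      simp only [hw, hc, Finset.univ_unique, Finset.sum_const, Finset.card_singleton, one_smul]
      rw [one_div, mul_inv]
      ring
    refine Tendsto.congr' (EventuallyEq.symm hexpr) (hρ.smul ?_)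
    refine tendsto_integral_filter_of_dominated_convergence
      ((Icc (-v) 1).indicator fun _ => C * |z| ^ β) ?_ ?_
      ((integrable_indicator_iff measurableSet_Icc).2 (integrableOn_const (by simp))) ?_
    · refine Eventually.of_forall fun n => Measurable.aestronglyMeasurable ?_
      have hm : Measurable fun s : ℝ => ((T n * s / Δ n, (T n * s + T n * v) / Δ n) : ℝ × ℝ) := by
        fun_prop
      have hcm : Measurable (c n) := (measurable_latticeCount n).comp hm
      exact (hψc.measurable.comp (by fun_prop)).const_smul (l n)
    · filter_upwards [hl0, hT0, eventually_gt_atTop 0] with n h1 h2 hn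
      have hn' : (0 : ℝ) < n := by exact_mod_cast hn
      have hΔn := hΔ_pos n
      refine ae_of_all _ fun s => ?_
      rw [norm_smul, Real.norm_of_nonneg h1.le]
      have h3 := hψ ((l n ^ (1 / β))⁻¹ * (z * (c n s / n)))
      rw [abs_mul, abs_of_pos (by positivity : 0 < (l n ^ (1 / β))⁻¹),
        Real.mul_rpow (by positivity) (abs_nonneg _), Real.inv_rpow (by positivity),
        ← Real.rpow_mul h1.le, one_div_mul_cancel hβ0.ne', Real.rpow_one] at h3
      have h4 : l n * ‖ψ ((l n ^ (1 / β))⁻¹ * (z * (c n s / n)))‖ ≤ C * |z * (c n s / n)| ^ β :=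
        calc l n * ‖ψ ((l n ^ (1 / β))⁻¹ * (z * (c n s / n)))‖
            ≤ l n * (C * ((l n)⁻¹ * |z * (c n s / n)| ^ β)) := by gcongr
          _ = _ := by field_simp
      refine h4.trans ?_
      by_cases hs : s ∈ Icc (-v) 1
      · rw [indicator_of_mem hs]
        refine mul_le_mul_of_nonneg_left (Real.rpow_le_rpow (abs_nonneg _) ?_ hβ0.le) hC
        rw [abs_mul, abs_of_nonneg (div_nonneg (latticeCount_nonneg _ _ _) hn'.le)]
        refine mul_le_of_le_one_right (abs_nonneg _) ?_
        rw [div_le_one hn']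
        exact latticeCount_le _ _ _
      · rw [indicator_of_notMem hs]
        have hz : c n s = 0 := by
          rw [mem_Icc, not_and_or, not_le, not_le] at hs
          rcases hs with hs | hs
          · refine latticeCount_of_neg (div_neg_of_neg_of_pos ?_ hΔn)
            nlinarith
          · refine latticeCount_of_lt ?_
            have e : T n * s / Δ n = n * s := by simp only [hT]; field_simp
            rw [e]
            nlinarith
        rw [hz, zero_div, mul_zero, abs_zero, Real.zero_rpow hβ0.ne', mul_zero]
    · refine ae_of_all _ fun s => ?_
      refine tendsto_smul_compExponent hβ0 hψ hψn hlim hl0 hllim (Tendsto.const_mul z ?_)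
      rw [tendsto_iff_norm_sub_tendsto_zero]
      refine squeeze_zero' (Eventually.of_forall fun n => norm_nonneg _) (g := fun n : ℕ =>
        2 / (n : ℝ)) ?_ (tendsto_const_div_atTop_nhds_zero_nat 2)
      filter_upwards [eventually_gt_atTop 0] with n hn
      exact abs_latticeCount_div_sub_overlap_le hn (hΔ_pos n) s v

variable {Ω : Type*} [MeasurableSpace Ω] {P : Measure Ω} {T : LevyTriplet}
  {L : Set (ℝ × ℝ) → Ω → ℝ}

/-- Convergence of the partial sums of a trawl process to a stable law, when the small jumps
dominate. -/
theorem PowerLongMemory.exists_tendstoInDistribution_stable [IsProbabilityMeasure P]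
    (hL : IsHomogeneousLevyBasis P L T) (hb : T.b = 0)
    (hν2 : Integrable (fun x : ℝ => x ^ 2) T.ν) (ha : PowerLongMemory a aprime κ ca)
    {Δ : ℕ → ℝ} (hΔ_pos : ∀ n, 0 < Δ n) (hΔ : Tendsto Δ atTop (𝓝 0))
    (hnΔ : Tendsto (fun n : ℕ => (n : ℝ) * Δ n) atTop atTop) {β Ktp Ktm : ℝ}
    (hK : 0 < Ktp + Ktm) (hκβ : κ - 1 < β) (hβ2 : β < 2)
    (hKp : Tendsto (fun x : ℝ => x ^ β * T.ν.real (Ioi x)) (𝓝[>] 0) (𝓝 Ktp))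
    (hKm : Tendsto (fun x : ℝ => x ^ β * T.ν.real (Iio (-x))) (𝓝[>] 0) (𝓝 Ktm)) :
    ∃ Kp Km γ : ℝ, Kp = rhoConst κ β * β * Ktp ∧ Km = rhoConst κ β * β * Ktm ∧
      ∃ (Ω' : Type) (_ : MeasurableSpace Ω') (P' : Measure Ω') (_ : IsProbabilityMeasure P')
        (ξ : Ω' → ℝ),
        IsStrictlyStableLaw β Kp Km γ (P'.map ξ) ∧
        (∀ z : ℝ, charFun (P'.map ξ) z = Complex.exp (stableExponent β Kp Km γ z)) ∧
        TendstoInDistribution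
          (fun (n : ℕ) (ω : Ω) => 1 / (n * (a (n * Δ n) * (n * Δ n)) ^ (1 / β))
            * trawlSumProcess P L a Δ n 1 ω) atTop ξ (fun _ => P) P' := by
  have hκ2 := ha.two_lt
  have hβ1 : 1 < β := by linarith
  have hβ0 : 0 < β := by linarith
  have hρ := rhoConst_pos hκ2 β
  have hKp0 : 0 ≤ Ktp := ge_of_tendsto hKp (by
    filter_upwards [self_mem_nhdsWithin] with x hx
    exact mul_nonneg (Real.rpow_nonneg (le_of_lt hx) _) measureReal_nonneg)
  have hKm0 : 0 ≤ Ktm := ge_of_tendsto hKm (by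
    filter_upwards [self_mem_nhdsWithin] with x hx
    exact mul_nonneg (Real.rpow_nonneg (le_of_lt hx) _) measureReal_nonneg)
  obtain ⟨⟨C, hC, hψ⟩, hlim⟩ := compExponent_asymptotics T.ν_zero hν2 hβ1 hβ2 hKp hKm
  set Kp := rhoConst κ β * β * Ktp with hKpdef
  set Km := rhoConst κ β * β * Ktm with hKmdef
  set X : ℕ → Ω → ℝ := fun n ω => 1 / (n * (a (n * Δ n) * (n * Δ n)) ^ (1 / β))
            * trawlSumProcess P L a Δ n 1 ω with hX
  have hXm : ∀ n, Measurable (X n) := fun n => (ha.measurable_trawlSum hL _ _).const_mul _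
  have hconv : ∀ z : ℝ, Tendsto (fun n => charFun (P.map (X n)) z) atTop
      (𝓝 (Complex.exp (stableSymbol β Kp Km z))) := by
    intro z
    have h1 := ha.tendsto_integral_sectionIntegral_smallJump (continuous_compExponent hν2) hC hκβ
      hβ2 hψ (compExponent_neg T.ν) hlim hΔ_pos hΔ hnΔ z
    rw [← stableSymbol_smul, ← mul_assoc, ← mul_assoc] at h1
    refine ((Complex.continuous_exp.tendsto _).comp h1).congr fun n => ?_
    rw [Function.comp_apply, ← ha.charFun_trawlSum hL hb hν2 _ _ _ (hΔ_pos n), charFun_apply_real,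
      integral_map (hXm n).aemeasurable (Continuous.aestronglyMeasurable (by fun_prop))]
    refine integral_congr_ae (ae_of_all _ fun ω => ?_)
    simp only [Finset.univ_unique, Finset.sum_const, Finset.card_singleton, one_smul, hX,
      trawlSumProcess, mul_one, Nat.floor_natCast]
    push_cast
    ring_nf
  obtain ⟨μ, hμ, hμl⟩ := exists_charFun_eq_of_tendsto
    (fun n => (⟨P.map (X n), Measure.isProbabilityMeasure_map (hXm n).aemeasurable⟩ :
      ProbabilityMeasure ℝ))
    ((Complex.continuous_exp.comp (continuous_stableSymbol hβ0 Kp Km)).continuousAt) hconv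
  -- The limit variable is the identity on ℝ under the limit law supplied by Lévy's theorem.
  have hmap : (μ : Measure ℝ).map id = μ := Measure.map_id
  obtain ⟨hs1, hs2⟩ := isStrictlyStableLaw_of_charFun (μ := (μ : Measure ℝ)) hβ1 hβ2
    (by positivity : 0 ≤ Kp) (by positivity : 0 ≤ Km)
    (by rw [hKpdef, hKmdef, ← mul_add]; positivity) hμ
  refine ⟨Kp, Km, (Kp - Km) / (1 - β), rfl, rfl, ℝ, inferInstance, μ, inferInstance, id, ?_, ?_,
    ⟨fun n => (hXm n).aemeasurable, aemeasurable_id, ?_⟩⟩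
  · rwa [hmap]
  · rwa [hmap]
  · have hμ' : (⟨(μ : Measure ℝ).map id, Measure.isProbabilityMeasure_map aemeasurable_id⟩ :
        ProbabilityMeasure ℝ) = μ := Subtype.ext hmap
    rw [hμ']
    exact hμl

end SmallJumpRegime


/-! ### The theorem -/

theorem mainTheorem4
    {Ω : Type*} [MeasurableSpace Ω] (P : Measure Ω) [IsProbabilityMeasure P]
    (T : LevyTriplet) (L : Set (ℝ × ℝ) → Ω → ℝ) (hL : IsHomogeneousLevyBasis P L T)
    (hb : T.b = 0) (hL2 : T.SquareIntegrableSeed)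
    (a aprime : ℝ → ℝ) (κ ca : ℝ) (ha : PowerLongMemory a aprime κ ca)
    (Δ : ℕ → ℝ) (hΔ_pos : ∀ n, 0 < Δ n) (hΔ : Tendsto Δ atTop (𝓝 0))
    (hnΔ : Tendsto (fun n : ℕ => (n : ℝ) * Δ n) atTop atTop) :
    -- part (i)
    (T.ν ≠ 0 → blumenthalGetoor T.ν < κ - 1 →
      Integrable (fun x : ℝ => |x| ^ (κ - 1)) T.ν ∧
      ∃ Kp Km γ : ℝ,
        Kp = ∫ x in Ioi (0 : ℝ), x ^ (κ - 1) ∂T.ν ∧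
        Km = ∫ x in Iio (0 : ℝ), |x| ^ (κ - 1) ∂T.ν ∧
        ∃ (Ω' : Type) (_ : MeasurableSpace Ω') (P' : Measure Ω') (_ : IsProbabilityMeasure P')
          (Y : ℝ≥0 → Ω' → ℝ),
          IsLevyProcess P' Y ∧
          IsStrictlyStableLaw (κ - 1) Kp Km γ (P'.map (Y 1)) ∧
          (∀ z : ℝ, charFun (P'.map (Y 1)) z = Complex.exp (stableExponent (κ - 1) Kp Km γ z)) ∧
          TendstoFDD
            (fun n t ω => Δ n / (ca * (n * Δ n)) ^ (1 / (κ - 1)) * trawlSumProcess P L a Δ n t ω)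
            P Y P') ∧
    -- part (ii)
    (∀ Ktp Ktm : ℝ, 0 < Ktp + Ktm →
      κ - 1 < blumenthalGetoor T.ν → blumenthalGetoor T.ν < 2 →
      Tendsto (fun x : ℝ => x ^ blumenthalGetoor T.ν * T.ν.real (Ioi x)) (𝓝[>] 0) (𝓝 Ktp) →
      Tendsto (fun x : ℝ => x ^ blumenthalGetoor T.ν * T.ν.real (Iio (-x))) (𝓝[>] 0) (𝓝 Ktm) →
      ∃ Kp Km γ : ℝ,
        Kp = rhoConst κ (blumenthalGetoor T.ν) * blumenthalGetoor T.ν * Ktp ∧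
        Km = rhoConst κ (blumenthalGetoor T.ν) * blumenthalGetoor T.ν * Ktm ∧
        ∃ (Ω' : Type) (_ : MeasurableSpace Ω') (P' : Measure Ω') (_ : IsProbabilityMeasure P')
          (ξ : Ω' → ℝ),
          IsStrictlyStableLaw (blumenthalGetoor T.ν) Kp Km γ (P'.map ξ) ∧
          (∀ z : ℝ, charFun (P'.map ξ) z
            = Complex.exp (stableExponent (blumenthalGetoor T.ν) Kp Km γ z)) ∧
          TendstoInDistribution
            (fun (n : ℕ) (ω : Ω) =>
              1 / (n * (a (n * Δ n) * (n * Δ n)) ^ (1 / blumenthalGetoor T.ν))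
                * trawlSumProcess P L a Δ n 1 ω)
            atTop ξ (fun _ => P) P') := by
  have hν2 := hL2.integrable_sq hb
  exact ⟨fun hν hBG =>
      PowerLongMemory.exists_tendstoFDD_stable hL hb hν2 ha hΔ_pos hΔ hnΔ hν hBG,
    fun Ktp Ktm hK hκβ hβ2 hKp hKm =>
      PowerLongMemory.exists_tendstoInDistribution_stable hL hb hν2 ha hΔ_pos hΔ hnΔ hK hκβ hβ2
        hKp hKm⟩
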